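/- **Setting.** Let $X_1,X_2,\dots$ be independent real random variables with $C^1$ Lebesgue densities $p_1,p_2,\dots$ on $\mathbb R$ and common support $(A,B)$ (endpoints possibly infinite; the topological support of each $p_j$ is the closure of $(A,B)$). Their moment generating functions $\Phi_j$ have the same domain of finiteness $\Theta=(\alpha,\beta)$. Put $\kappa_j=\log\Phi_j$ and $m_j=\kappa_j'$; each $m_j$ is strictly increasing on $\Theta$ with $\lim_{\theta\to\alpha}m_j(\theta)=A$ and $\lim_{\theta\to\beta}m_j(\theta)=B$. For $\theta\in\Theta$ let $\widetilde p_j^{\,\theta}(x)=e^{\theta x}p_j(x)/\Phi_j(\theta)$, a density with mean $m_j(\theta)$, and write $s_j^2(\theta)$ for its variance, $\mu_j^\ell(\theta)$ and $|\mu|_j^\ell(\theta)$ for its central and absolute central moments of order $\ell$, and $d_j(\theta)=\|\tfrac{d}{dx}\widetilde p_j^{\,\theta}\|_{L^1}$. Fix $a\in(A,B)$. For $n\ge1$ let $Y_1,\dots,Y_n$ (depending on $n$), defined on a probability space $(\Omega_n,\mathcal A_n,\mathcal P_n)$, have the law of $(X_1,\dots,X_n)$ given $X_1+\dots+X_n=na$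 (given by the usual ratio of densities). Let $k=k_n$ with $n-k\to\infty$, and for $0\le i\le k-1$ let $t_{i,n}\in\Theta$ be the ($\mathcal P_n$-a.s. unique) solution of $\sum_{j=i+1}^n m_j(t_{i,n})=\sum_{j=i+1}^nY_j$. Here $Z_n=\mathcal O_{\mathcal P_n}(1)$ means: for every $\epsilon>0$ there are $C,N$ with $\mathcal P_n(|Z_n|\le C)\ge1-\epsilon$ for $n\ge N$; and $Z_n=o_{\mathcal P_n}(1)$ means: for all $\epsilon,\delta>0$ there is $N$ with $\mathcal P_n(|Z_n|\le\delta)\ge1-\epsilon$ for $n\ge N$. For $e\in\{1,2\}$ let $\overline q_{i+e,n}$ be the continuous density of $$\overline S_{i+e,n}=\frac{\sum_{j=i+e}^n\big(\widetilde X_j-m_j(t_{i,n})\big)}{\big(\sum_{j=i+e}^n s_j^2(t_{i,n})\big)^{1/2}},$$ where, for the given value of $t_{i,n}$, the $\widetilde X_j$ are independent with densities $\widetilde p_j^{\,t_{i,n}}$. Let $\mathfrak n$ be the standard normal density, $H_r$ the (probabilists') Hermite polynomials, and $\lambda_\ell$ the sum over $i+e\le j\le n$ of the $\ell$-th cumulants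 of $\widetilde p_j^{\,t_{i,n}}$ divided by $\big(\sum_{j=i+e}^n s_j^2(t_{i,n})\big)^{\ell/2}$. Put, for $\nu\ge3$, $$\overline P^{(i,e)}_{\nu,n}(x)=\sum H_{\nu-2+2s}(x)\prod_{l=1}^{\nu-2}\frac1{k_l!}\Big(\frac{\lambda_{l+2}}{(l+2)!}\Big)^{k_l},$$ the sum being over integers $k_1,\dots,k_{\nu-2}\ge0$ with $\sum_l l\,k_l=\nu-2$, and $s=\sum_l k_l$. **Theorem.** Let $m\ge3$ be an integer. Assume that $$\max_{0\le i\le k-1}\sup_{j\ge1}\frac1{s_j^2(t_{i,n})},\qquad \max_{0\le i\le k-1}\sup_{j\ge1}|\mu|_j^{m+1}(t_{i,n}),\qquad \max_{0\le i\le k-1}\sup_{j\ge1}d_j(t_{i,n})$$ are all $\mathcal O_{\mathcal P_n}(1)$. Then for $e\in\{1,2\}$, with probability tending to one, the densities $\overline q_{i+e,n}$, $0\le i\le k-1$, exist, and $$\max_{0\le i\le k-1}(n-i-e+1)^{(m-2)/2}\sup_{x\in\mathbb R}\Big|\overline q_{i+e,n}(x)-\mathfrak n(x)\Big(1+\sum_{\nu=3}^m\overline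 P^{(i,e)}_{\nu,n}(x)\Big)\Big|=o_{\mathcal P_n}(1).\tag{$*$}$$ **Corollary.** Let $m\ge3$ be an integer. Assume that there are functions $f_\pm$, strictly increasing on $\Theta$ with limits $A$ at $\alpha$ and $B$ at $\beta$, such that $f_-\le m_j\le f_+$ on $\Theta$ for all $j\ge1$, and that for every compact $K\subset\Theta$: $0<\inf_{j\ge1,\theta\in K}s_j^2(\theta)\le\sup_{j\ge1,\theta\in K}s_j^2(\theta)<\infty$; $\sup_{j\ge1,\theta\in K}|\mu|_j^{r}(\theta)<\infty$ for $r=6$ and $r=m+1$; and $\sup_{j\ge1,\theta\in K}d_j(\theta)<\infty$. Assume also that $\max_{0\le i\le k-1}|t_{i,n}|=\mathcal O_{\mathcal P_n}(1)$. Then $(*)$ holds for $e\in\{1,2\}$. -/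

import Mathlib

open MeasureTheory ProbabilityTheory Filter Topology
open scoped ENNReal NNReal

noncomputable section

namespace TiltedEdgeworth

/-! ### Densities and exponential tilting -/

/-- The measure on `ℝ` with Lebesgue density `p`. -/
def lawOfDensity (p : ℝ → ℝ) : Measure ℝ :=
  volume.withDensity (fun x => ENNReal.ofReal (p x))

/-- The moment generating function `Φ` of a random variable with density `p`. -/
def Phi (p : ℝ → ℝ) (θ : ℝ) : ℝ := mgf id (lawOfDensity p) θ

/-- The tilted density `x ↦ exp (θ x) p(x) / Φ(θ)`. -/
def tiltedDensity (p : ℝ → ℝ) (θ x : ℝ) : ℝ := Real.exp (θ * x) * p x / Phi p θ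

/-- The law of the tilted random variable. -/
def tiltedLaw (p : ℝ → ℝ) (θ : ℝ) : Measure ℝ := lawOfDensity (tiltedDensity p θ)

/-- `m(θ) = κ'(θ)`, where `κ = log Φ`; this is the mean of the tilted law. -/
def tMean (p : ℝ → ℝ) (θ : ℝ) : ℝ := deriv (cgf id (lawOfDensity p)) θ

/-- The central moment `μ^ℓ(θ)` of the tilted law. -/
def tMoment (p : ℝ → ℝ) (ℓ : ℕ) (θ : ℝ) : ℝ :=
  ∫ x, (x - tMean p θ) ^ ℓ ∂(tiltedLaw p θ)

/-- The variance `s²(θ)` of the tilted law. -/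
def tVar (p : ℝ → ℝ) (θ : ℝ) : ℝ := tMoment p 2 θ

/-- The absolute central moment `|μ|^ℓ(θ)` of the tilted law, in `[0, ∞]`. -/
def tAbsMoment (p : ℝ → ℝ) (ℓ : ℕ) (θ : ℝ) : ℝ≥0∞ :=
  ∫⁻ x, ‖x - tMean p θ‖ₑ ^ ℓ ∂(tiltedLaw p θ)

/-- `d(θ)`: the `L¹` norm, in `[0, ∞]`, of the derivative of the tilted density. -/
def tDerivNorm (p : ℝ → ℝ) (θ : ℝ) : ℝ≥0∞ :=
  ∫⁻ x, ‖deriv (tiltedDensity p θ) x‖ₑ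

/-! ### Assumptions on the sequence of random variables (indices start at `1`) -/

/-- The real points of the interval `(a, b)` with finite or infinite end points. -/
def openInterval (a b : EReal) : Set ℝ := {x : ℝ | a < (x : EReal) ∧ (x : EReal) < b}

/-- `f` is strictly increasing on `(α, β)` with limits `A` at `α` and `B` at `β`. -/
def CondH (α β A B : EReal) (f : ℝ → ℝ) : Prop :=
  StrictMonoOn f (openInterval α β) ∧
  Tendsto (fun θ : ℝ => (f θ : EReal)) (comap Real.toEReal (𝓝[>] α)) (𝓝 A) ∧
  Tendsto (fun θ : ℝ => (f θ : EReal)) (comap Real.toEReal (𝓝[<] β)) (𝓝 B)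

/-- `X 1, X 2, …` are independent with `C¹` densities `p 1, p 2, …`, they have common support
`(A, B)`, their moment generating functions have the same domain of finiteness `(α, β)`, and each
`m_j = κ_j'` increases strictly from `A` to `B` on `(α, β)`. -/
structure BasicAssumptions {Ω₀ : Type*} [MeasurableSpace Ω₀] (P₀ : Measure Ω₀)
    (X : ℕ → Ω₀ → ℝ) (p : ℕ → ℝ → ℝ) (A B α β : EReal) : Prop where
  measurable : ∀ j, 1 ≤ j → Measurable (X j)
  indep : iIndepFun (fun j : ℕ => X (j + 1)) P₀
  density_nonneg : ∀ j, 1 ≤ j → ∀ x, 0 ≤ p j x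
  density : ∀ j, 1 ≤ j → P₀.map (X j) = lawOfDensity (p j)
  contDiff : ∀ j, 1 ≤ j → ContDiff ℝ 1 (p j)
  support : ∀ j, 1 ≤ j → tsupport (p j) = closure (openInterval A B)
  mgf_domain : ∀ j, 1 ≤ j → integrableExpSet (X j) P₀ = openInterval α β
  mean_condH : ∀ j, 1 ≤ j → CondH α β A B (tMean (p j))

/-- `(Uf)`: the `m_j` lie between two functions that satisfy `CondH`. -/
def AssumptionUf (p : ℕ → ℝ → ℝ) (A B α β : EReal) : Prop :=
  ∃ fp fm : ℝ → ℝ, CondH α β A B fp ∧ CondH α β A B fm ∧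
    ∀ j, 1 ≤ j → ∀ θ ∈ openInterval α β, fm θ ≤ tMean (p j) θ ∧ tMean (p j) θ ≤ fp θ

/-- `(Cv)`: the variances are bounded above and away from zero, uniformly in `j`, on compacts. -/
def AssumptionCv (p : ℕ → ℝ → ℝ) (α β : EReal) : Prop :=
  ∀ K : Set ℝ, IsCompact K → K ⊆ openInterval α β →
    ∃ c C : ℝ, 0 < c ∧ ∀ j, 1 ≤ j → ∀ θ ∈ K, c ≤ tVar (p j) θ ∧ tVar (p j) θ ≤ C

/-- `(AM r)`: the absolute central moments of order `r` are bounded, uniformly in `j`,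
on compacts. -/
def AssumptionAM (p : ℕ → ℝ → ℝ) (α β : EReal) (r : ℕ) : Prop :=
  ∀ K : Set ℝ, IsCompact K → K ⊆ openInterval α β →
    ∃ C : ℝ≥0, ∀ j, 1 ≤ j → ∀ θ ∈ K, tAbsMoment (p j) r θ ≤ C

/-- `(Cf)` (with the `C¹` property in `BasicAssumptions`): the `L¹` norms of the derivatives of
the tilted densities are bounded, uniformly in `j`, on compacts. -/
def AssumptionCf (p : ℕ → ℝ → ℝ) (α β : EReal) : Prop :=
  ∀ K : Set ℝ, IsCompact K → K ⊆ openInterval α β →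
    ∃ C : ℝ≥0, ∀ j, 1 ≤ j → ∀ θ ∈ K, tDerivNorm (p j) θ ≤ C

/-! ### The conditioned sample and the random tilts -/

/-- The joint density at `x = (x_j)_{j ≠ ℓ}` of `(X_j)_{1 ≤ j ≤ n, j ≠ ℓ}` and of
`S_{1,n} = X_1 + ⋯ + X_n`, evaluated at `S_{1,n} = s`. -/
def jointDensity (p : ℕ → ℝ → ℝ) (n ℓ : ℕ) (s : ℝ)
    (x : ↥((Finset.Icc 1 n).erase ℓ) → ℝ) : ℝ≥0∞ :=
  (∏ j : ↥((Finset.Icc 1 n).erase ℓ), ENNReal.ofReal (p j (x j))) * ENNReal.ofReal (p ℓ (s - ∑ j, x j))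

/-- `(Y_1, …, Y_n)` is distributed as `(X_1, …, X_n)` given `S_{1,n} = s`: the sum is a.s. `s`,
and any `n - 1` of the coordinates have the conditional density
`p_{(U, S)}(x, s) / p_S(s)`, with `p_S(s) = ∫ p_{(U, S)}(x, s) dx`. (For `n = 1` the first
property says everything.) -/
structure IsConditionedSample {Ω : Type*} [MeasurableSpace Ω] (μ : Measure Ω)
    (p : ℕ → ℝ → ℝ) (n : ℕ) (s : ℝ) (Y : ℕ → Ω → ℝ) : Prop where
  measurable : ∀ j ∈ Finset.Icc 1 n, Measurable (Y j)
  sum_eq : ∀ᵐ ω ∂μ, ∑ j ∈ Finset.Icc 1 n, Y j ω = s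
  law : 2 ≤ n → ∀ ℓ ∈ Finset.Icc 1 n,
    μ.map (fun ω (j : ↥((Finset.Icc 1 n).erase ℓ)) => Y j ω) =
      volume.withDensity
        (fun x => jointDensity p n ℓ s x / ∫⁻ z, jointDensity p n ℓ s z)

open Classical in
/-- The solution `θ ∈ (α, β)` of
`(m_{i+1}(θ) + ⋯ + m_n(θ)) / (n - i) = (y_{i+1} + ⋯ + y_n) / (n - i)`
(and `0` if there is none, which has probability zero for the conditioned sample). -/
def tiltOf (p : ℕ → ℝ → ℝ) (α β : EReal) (i n : ℕ) (y : ℕ → ℝ) : ℝ :=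
  if h : ∃ θ ∈ openInterval α β,
      (∑ j ∈ Finset.Icc (i + 1) n, tMean (p j) θ) / ((n : ℝ) - i) =
        (∑ j ∈ Finset.Icc (i + 1) n, y j) / ((n : ℝ) - i)
  then h.choose else 0

/-! ### Normalized tilted sums and their Edgeworth expansion -/

/-- The law of `(∑_{j ∈ I} X̃_j - ∑_{j ∈ I} m_j(θ)) / √(∑_{j ∈ I} s_j²(θ))`, where the `X̃_j` are
independent with the tilted laws of parameter `θ`. -/
def normalizedSumLaw (p : ℕ → ℝ → ℝ) (I : Finset ℕ) (θ : ℝ) : Measure ℝ :=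
  (Measure.pi (fun j : ↥I => tiltedLaw (p j) θ)).map
    (fun x => (∑ j, x j - ∑ j ∈ I, tMean (p j) θ) / √(∑ j ∈ I, tVar (p j) θ))

/-- `q` is a continuous density of `μ`. There is at most one. -/
def IsContinuousDensity (μ : Measure ℝ) (q : ℝ → ℝ) : Prop :=
  Continuous q ∧ (∀ x, 0 ≤ q x) ∧ μ = lawOfDensity q

theorem IsContinuousDensity.unique {μ : Measure ℝ} [IsFiniteMeasure μ] {q r : ℝ → ℝ}
    (hq : IsContinuousDensity μ q) (hr : IsContinuousDensity μ r) : q = r := by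
  obtain ⟨cq, nq, eq⟩ := hq
  obtain ⟨cr, nr, er⟩ := hr
  have h : (fun x => ENNReal.ofReal (q x)) =ᵐ[volume] fun x => ENNReal.ofReal (r x) := by
    refine (withDensity_eq_iff (by fun_prop) (by fun_prop) ?_).1 (eq.symm.trans er)
    have : (volume.withDensity fun x => ENNReal.ofReal (q x)) Set.univ ≠ ∞ := by
      have h2 : μ = volume.withDensity fun x => ENNReal.ofReal (q x) := eq
      rw [← h2]; exact measure_ne_top μ _
    simpa [withDensity_apply] using this
  refine (Continuous.ae_eq_iff_eq volume cq cr).1 ?_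
  filter_upwards [h] with x hx
  exact (ENNReal.ofReal_eq_ofReal_iff (nq x) (nr x)).1 hx

/-- `sup_x |q(x) - g(x)|` for the continuous density `q` of `μ`; it is `∞` if `μ` has no
continuous density, so that a finite value contains the existence of `q`. -/
def densityError (μ : Measure ℝ) (g : ℝ → ℝ) : ℝ≥0∞ :=
  ⨅ (q : ℝ → ℝ) (_ : IsContinuousDensity μ q), ⨆ x : ℝ, ‖q x - g x‖ₑ

/-- The cumulants of a law in terms of its moments `c 1, c 2, …`, through
`c (n+1) = ∑_{r ≤ n} (n choose r) κ (r+1) c (n-r)` (with `c 0 = 1`). For a centered law: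
`κ₂ = c₂`, `κ₃ = c₃`, `κ₄ = c₄ - 3 c₂²`, `κ₅ = c₅ - 10 c₃ c₂`. -/
def cumulantOfMoments (c : ℕ → ℝ) : ℕ → ℝ
  | 0 => 0
  | n + 1 => c (n + 1) -
      ∑ r : Fin n, (n.choose r : ℝ) * cumulantOfMoments c (r + 1) * c (n - r)

/-- The cumulant of order `ℓ` of the normalized tilted sum over `I`. -/
def normalizedCumulant (p : ℕ → ℝ → ℝ) (I : Finset ℕ) (θ : ℝ) (ℓ : ℕ) : ℝ :=
  (∑ j ∈ I, cumulantOfMoments (fun r => tMoment (p j) r θ) ℓ) /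
    √(∑ j ∈ I, tVar (p j) θ) ^ ℓ

/-- With `lam ℓ` the normalized cumulants, the Edgeworth polynomial with index `ν = r + 2`:
`∑ₛ [zʳ] (∑_{l = 1}^{r} lam (l+2) / (l+2)! zˡ)ˢ / s! · H_{r+2s}(x)`, where the power of
`z` collects the terms of order `r`. Expanding the power, this is the sum over
`k₁ + 2 k₂ + ⋯ + r k_r = r` of `H_{r+2s}(x) ∏_l (lam (l+2) / (l+2)!)^{k_l} / k_l!`, with
`s = k₁ + ⋯ + k_r`. -/
def edgeworthPoly (lam : ℕ → ℝ) (ν : ℕ) (x : ℝ) : ℝ :=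
  ∑ s ∈ Finset.range (ν - 2 + 1),
    ((∑ l ∈ Finset.Icc 1 (ν - 2),
        Polynomial.monomial l (lam (l + 2) / ((l + 2).factorial : ℝ))) ^ s).coeff (ν - 2)
      / (s.factorial : ℝ) *
      Polynomial.aeval x (Polynomial.hermite (ν - 2 + 2 * s))

/-- The Edgeworth approximation `𝔫(x) (1 + ∑_{ν=3}^{m} P_ν(x))` of order `m`, for the normalized
tilted sum over `I`. -/
def edgeworthApprox (p : ℕ → ℝ → ℝ) (I : Finset ℕ) (θ : ℝ) (m : ℕ) (x : ℝ) : ℝ :=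
  gaussianPDFReal 0 1 x *
    (1 + ∑ ν ∈ Finset.Icc 3 m, edgeworthPoly (normalizedCumulant p I θ) ν x)

/-! ### Landau notations in probability, on varying probability spaces

For random variables, `P n (Z n ≤ A) ≥ 1 - ε` is written as `P n (Z n > A) ≤ ε`. -/

/-- `Z n = O_P(1)` for nonnegative, possibly infinite `Z n`. -/
def IsBigOProb {Ω : ℕ → Type*} [∀ n, MeasurableSpace (Ω n)] (P : ∀ n, Measure (Ω n))
    (Z : ∀ n, Ω n → ℝ≥0∞) : Prop :=
  ∀ ε : ℝ, 0 < ε → ∃ A : ℝ≥0, ∃ N : ℕ, ∀ n, N ≤ n →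
    P n {ω | (A : ℝ≥0∞) < Z n ω} ≤ ENNReal.ofReal ε

/-- `Z n = o_P(1)` for nonnegative, possibly infinite `Z n`. -/
def IsLittleOProb {Ω : ℕ → Type*} [∀ n, MeasurableSpace (Ω n)] (P : ∀ n, Measure (Ω n))
    (Z : ∀ n, Ω n → ℝ≥0∞) : Prop :=
  ∀ ε : ℝ, 0 < ε → ∀ δ : ℝ, 0 < δ → ∃ N : ℕ, ∀ n, N ≤ n →
    P n {ω | ENNReal.ofReal δ < Z n ω} ≤ ENNReal.ofReal ε

/-- The expansion of order `m` of the density of `S̄_{i+e,n}` at the tilts `t n i`: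
`max_{0 ≤ i ≤ k-1} (n-i-e+1)^{(m-2)/2} sup_x |q̄_{i+e,n}(x) - 𝔫(x) (1 + ∑_ν P̄_ν(x))| = o_P(1)`. -/
def EdgeworthExpansionAt {Ω : ℕ → Type*} [∀ n, MeasurableSpace (Ω n)]
    (P : ∀ n, Measure (Ω n)) (p : ℕ → ℝ → ℝ) (k : ℕ → ℕ) (t : ∀ n, ℕ → Ω n → ℝ)
    (m e : ℕ) : Prop :=
  IsLittleOProb P (fun n ω => ⨆ i : Fin (k n),
    ((n + 1 - (i + e) : ℕ) : ℝ≥0∞) ^ (((m : ℝ) - 2) / 2) *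
      densityError (normalizedSumLaw p (Finset.Icc (i + e) n) (t n i ω))
        (edgeworthApprox p (Finset.Icc (i + e) n) (t n i ω) m))

end TiltedEdgeworth

end

/-!
The expansion is the classical Edgeworth expansion of the density of a normalized sum of
independent variables, with an error bound that depends on the individual laws only through three
constants: a lower bound `σ` for the standard deviations, an upper bound `M` for the absolute
moments of order `m + 1`, and an upper bound `D` for the `L¹` norms of the derivatives of the
densities (`exists_abs_normalizedDensity_sub_le`, `exists_densityError_le`). Its error is
`O(N ^ (-(m - 1) / 2))` for `N` summands, better by a factor `N ^ (-1 / 2)` than what is claimed.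

That bound comes from Fourier inversion. The characteristic function of a sum, normalized by its
standard deviation `B`, is compared with the transform of the approximation in three zones.

* For `|ξ| ≤ N ^ (1 / 8)`, each factor `φ_j(ξ / B)` is the exponential of its cumulant polynomial,
  up to a factor `1 + O(|ξ / B| ^ (m + 1))` (`exists_norm_charFun_mul_exp_sub_one_le`). The product
  of the exponentials is `exp (-ξ² / 2)` times the exponential of a sum of terms of orders
  `N ^ (-l / 2)`, `1 ≤ l ≤ m - 2`, and the Taylor polynomial of the latter of total order `m - 2`
  is the transform of the Edgeworth approximation (`one_add_sum_edgeworthPolyHat`).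
* Integration by parts gives `|φ_j(u)| ≤ D / |u|`. For `|ξ| > 2 D B` each factor is therefore at
  most `1 / 2`, and the product is exponentially small (`exists_norm_sumCharFun_le_of_lt_abs`).
* In between, `|φ_j(u)| ≤ exp (-c u²)` holds for `|u| ≤ 2 D`: the inequality
  `1 - |φ(2u)|² ≤ 4 (1 - |φ(u)|²)` carries the bound `1 / 2` at large `|u|` down to small `|u|`
  (`norm_charFun_sq_le`). This makes the product at most `exp (-c' ξ²)`.

The random tilts enter only through these constants. For the first part, the three boundedness
assumptions say that, with probability close to one, the constants may be chosen for all indices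
`i < k` at once (`edgeworthExpansionAt_of_isBigOProb`).

For the second part, the tilts `t_i` have to be confined to a compact set. Let `θ` be the
parameter at which the means of the tilted variables `X̃_j`, `j ≤ n`, add up to `n a`; it stays in
a compact set by the assumption on the mean functions. Tilting does not change the conditional law
given the sum, so that the law of `Y_{i+1} + ⋯ + Y_n` has, with respect to the law of
`X̃_{i+1} + ⋯ + X̃_n`, a density which is a quotient of densities of sums
(`IsConditionedSample.measure_sum_mem_le`). By the local limit theorem, which the expansion
contains, this quotient is at most a constant times `1 + (n - i)` (`exists_sumDensity_le_mul`). Now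
`t_i` differs from `θ` by more than `δ` only if the sum deviates from its mean to the mean at
`θ ± δ`, and by Chernoff's bound and the strong convexity of the cumulant generating functions
(`cgf_add_le`, `sumLaw_tiltedLaw_le`) this has probability at most `exp (-r (n - i))`. The resulting
bounds `C (1 + (n - i)) exp (-r (n - i))` have a sum over `i < k` that is at most a tail of a
convergent series, starting at `n - k → ∞` (`edgeworthExpansionAt_of_compacts`).
-/

namespace TiltedEdgeworth

/-! ### Bounds on the modulus of a characteristic function -/

theorem norm_exp_mul_I_sub_sum_le (y : ℝ) (k : ℕ) :
    ‖Complex.exp (y * Complex.I) -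
      ∑ n ∈ Finset.range k, ((y : ℂ) * Complex.I) ^ n / n.factorial‖ ≤ 4 * |y| ^ k := by
  have hn : ‖(y : ℂ) * Complex.I‖ = |y| := by simp
  rcases le_total |y| 1 with h | h
  · refine (Complex.norm_exp_sub_sum_le_norm_mul_exp _ k).trans ?_
    rw [hn, mul_comm]
    have : Real.exp |y| ≤ 4 := (Real.exp_le_exp.2 h).trans
      (by linarith [Real.exp_one_lt_d9])
    gcongr
  · have h1 : ‖∑ n ∈ Finset.range k, ((y : ℂ) * Complex.I) ^ n / n.factorial‖
        ≤ Real.exp 1 * |y| ^ k := by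
      refine (norm_sum_le _ _).trans ?_
      have h2 : ∑ n ∈ Finset.range k, (1 : ℝ) ^ n / n.factorial ≤ Real.exp 1 :=
        Real.sum_le_exp_of_nonneg zero_le_one k
      refine le_trans ?_ (mul_le_mul_of_nonneg_right h2 (by positivity))
      rw [Finset.sum_mul]
      refine Finset.sum_le_sum fun n hnk => ?_
      rw [norm_div, norm_pow, hn, one_pow, Complex.norm_natCast, div_mul_eq_mul_div, one_mul]
      gcongr
      exact (Finset.mem_range.1 hnk).le
    refine (norm_sub_le _ _).trans ?_
    rw [Complex.norm_exp_ofReal_mul_I]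
    have h3 : (1 : ℝ) ≤ |y| ^ k := one_le_pow₀ h
    nlinarith [Real.exp_one_lt_d9]

/-- The squared modulus of the characteristic function of `ν` is the characteristic function of
the symmetrization of `ν`. -/
theorem exists_norm_charFun_sq_eq (ν : Measure ℝ) [IsProbabilityMeasure ν] :
    ∃ σ : Measure ℝ, IsProbabilityMeasure σ ∧
      ∀ u, ‖charFun ν u‖ ^ 2 = ∫ x, Real.cos (u * x) ∂σ := by
  have : IsProbabilityMeasure (ν.map (fun x => (-1 : ℝ) * x)) :=
    Measure.isProbabilityMeasure_map (by fun_prop)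
  refine ⟨ν ∗ ν.map (fun x => (-1 : ℝ) * x), inferInstance, fun u => ?_⟩
  have h := charFun_conv (μ := ν) (ν := ν.map (fun x => (-1 : ℝ) * x)) u
  rw [charFun_map_mul, neg_one_mul, charFun_neg, Complex.mul_conj, charFun_apply_real] at h
  have h2 := congrArg Complex.re h
  rw [Complex.ofReal_re, Complex.normSq_eq_norm_sq] at h2
  rw [← h2]
  have hi : Integrable (fun x : ℝ => Complex.exp (u * x * Complex.I))
      (ν ∗ ν.map (fun x => (-1 : ℝ) * x)) := by
    refine (integrable_const (1 : ℝ)).mono (by fun_prop) (ae_of_all _ fun x => ?_)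
    have := Complex.norm_exp_ofReal_mul_I (u * x)
    push_cast at this
    simp [this]
  refine (integral_re hi).symm.trans (integral_congr_ae (ae_of_all _ fun x => ?_))
  have := Complex.exp_ofReal_mul_I_re (u * x)
  push_cast at this
  simpa using this

/-- On the symmetrization, this is `1 - cos 2x ≤ 4 (1 - cos x)`. -/
theorem one_sub_norm_charFun_sq_two_mul_le (ν : Measure ℝ) [IsProbabilityMeasure ν] (u : ℝ) :
    1 - ‖charFun ν (2 * u)‖ ^ 2 ≤ 4 * (1 - ‖charFun ν u‖ ^ 2) := by
  obtain ⟨σ, hσ, h⟩ := exists_norm_charFun_sq_eq ν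
  have hi : ∀ v : ℝ, Integrable (fun x => Real.cos (v * x)) σ := fun v =>
    (integrable_const (1 : ℝ)).mono (by fun_prop)
      (ae_of_all _ fun x => by simpa using Real.abs_cos_le_one _)
  have h1 : ∀ v, 1 - ‖charFun ν v‖ ^ 2 = ∫ x, (1 - Real.cos (v * x)) ∂σ := fun v => by
    rw [integral_sub (integrable_const _) (hi v), h]; simp
  rw [h1, h1, ← integral_const_mul]
  refine integral_mono ((integrable_const _).sub (hi _))
    (((integrable_const _).sub (hi _)).const_mul _) fun x => ?_
  have := Real.cos_two_mul (u * x)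
  simp only [mul_assoc, this]
  nlinarith [Real.cos_le_one (u * x), Real.neg_one_le_cos (u * x)]

/-- A characteristic function bounded by `D / |u|` is at most `1/2` for `|u| ≥ 2D`; halving the
argument repeatedly carries this to a quadratic bound near `0`. -/
theorem norm_charFun_sq_le (ν : Measure ℝ) [IsProbabilityMeasure ν] {D : ℝ} (hD : 0 < D)
    (h : ∀ u, |u| * ‖charFun ν u‖ ≤ D) {u : ℝ} (hu : |u| ≤ 2 * D) :
    ‖charFun ν u‖ ^ 2 ≤ 1 - 3 / (64 * D ^ 2) * u ^ 2 := by
  have key : ∀ k : ℕ, ∀ v : ℝ, 2 * D ≤ 2 ^ k * |v| →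
      3 / 4 ≤ 4 ^ k * (1 - ‖charFun ν v‖ ^ 2) := by
    intro k
    induction k with
    | zero =>
      intro v hv
      have h1 := h v
      have h2 : ‖charFun ν v‖ ≤ 1 / 2 := by
        by_contra! hc
        nlinarith [norm_nonneg (charFun ν v)]
      have := norm_nonneg (charFun ν v)
      nlinarith
    | succ k ih =>
      intro v hv
      have h1 := ih (2 * v) (by rw [abs_mul, abs_two]; rw [pow_succ] at hv; linarith)
      have h2 := one_sub_norm_charFun_sq_two_mul_le ν v
      have h3 : (4 : ℝ) ^ k * (1 - ‖charFun ν (2 * v)‖ ^ 2)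
          ≤ 4 ^ k * (4 * (1 - ‖charFun ν v‖ ^ 2)) := by gcongr
      rw [pow_succ]; linarith
  rcases eq_or_ne u 0 with rfl | h0
  · simp
  have hpos : 0 < |u| := abs_pos.2 h0
  obtain ⟨k, hk1, hk2⟩ := exists_nat_pow_near (x := 2 * D / |u|) (y := 2)
    (by rw [le_div_iff₀ hpos]; linarith) one_lt_two
  rw [le_div_iff₀ hpos] at hk1
  rw [div_lt_iff₀ hpos] at hk2
  have h1 := key (k + 1) u hk2.le
  have h4 : (4 : ℝ) ^ (k + 1) = 4 * (2 ^ k) ^ 2 := by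
    rw [pow_succ, ← pow_mul, mul_comm k 2, pow_mul]; norm_num; ring
  rw [h4] at h1
  have h5 : (2 ^ k * |u|) ^ 2 ≤ (2 * D) ^ 2 := by gcongr
  have h5' : ((2 : ℝ) ^ k) ^ 2 * u ^ 2 ≤ 4 * D ^ 2 := by
    rw [mul_pow, sq_abs] at h5; nlinarith
  set q := 1 - ‖charFun ν u‖ ^ 2 with hq
  have hq0 : 0 ≤ q := by
    have := norm_charFun_le_one (μ := ν) u
    have := norm_nonneg (charFun ν u)
    nlinarith
  have h6 : 3 / (64 * D ^ 2) * u ^ 2 ≤ q := by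
    rw [div_mul_eq_mul_div, div_le_iff₀ (by positivity)]
    have : 3 / 4 * u ^ 2 ≤ q * (16 * D ^ 2) := by
      calc 3 / 4 * u ^ 2 ≤ (4 * (2 ^ k) ^ 2 * q) * u ^ 2 := by gcongr
        _ = 4 * q * ((2 ^ k) ^ 2 * u ^ 2) := by ring
        _ ≤ 4 * q * (4 * D ^ 2) := by gcongr
        _ = _ := by ring
    linarith
  linarith

theorem norm_charFun_le_exp (ν : Measure ℝ) [IsProbabilityMeasure ν] {D : ℝ} (hD : 0 < D)
    (h : ∀ u, |u| * ‖charFun ν u‖ ≤ D) {u : ℝ} (hu : |u| ≤ 2 * D) :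
    ‖charFun ν u‖ ≤ Real.exp (-(3 / (128 * D ^ 2)) * u ^ 2) := by
  have h1 := norm_charFun_sq_le ν hD h hu
  have h2 := Real.add_one_le_exp (-(3 / (64 * D ^ 2)) * u ^ 2)
  have h3 : Real.exp (-(3 / (64 * D ^ 2)) * u ^ 2)
      = Real.exp (-(3 / (128 * D ^ 2)) * u ^ 2) ^ 2 := by
    rw [← Real.exp_nat_mul]; congr 1; push_cast; field_simp; ring
  refine (sq_le_sq₀ (norm_nonneg _) (Real.exp_pos _).le).1 ?_
  rw [← h3]; linarith

/-! ### Cumulants and the local expansion of a characteristic function -/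

/-- The recursion that defines the cumulants, with the term `r = n` moved to the other side. -/
theorem moment_succ_eq_sum_cumulant (c : ℕ → ℝ) (h0 : c 0 = 1) (n : ℕ) :
    c (n + 1) = ∑ r ∈ Finset.range (n + 1),
      (n.choose r : ℝ) * cumulantOfMoments c (r + 1) * c (n - r) := by
  rw [Finset.sum_range_succ, Nat.choose_self, Nat.sub_self, h0]
  have : cumulantOfMoments c (n + 1) = c (n + 1) -
      ∑ r : Fin n, (n.choose r : ℝ) * cumulantOfMoments c (r + 1) * c (n - r) := by
    rw [cumulantOfMoments]
  rw [Fin.sum_univ_eq_sum_range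
    (fun r => (n.choose r : ℝ) * cumulantOfMoments c (r + 1) * c (n - r)) n] at this
  rw [this]; push_cast; ring

theorem cumulantOfMoments_one (c : ℕ → ℝ) : cumulantOfMoments c 1 = c 1 := by
  rw [cumulantOfMoments, Finset.univ_eq_empty, Finset.sum_empty, sub_zero, zero_add]

theorem cumulantOfMoments_two (c : ℕ → ℝ) (h1 : c 1 = 0) : cumulantOfMoments c 2 = c 2 := by
  rw [cumulantOfMoments, Fin.sum_univ_one]
  simp [cumulantOfMoments_one, h1]

theorem exists_cumulantOfMoments_le (M : ℝ) (L : ℕ) : ∃ K : ℝ, 1 ≤ K ∧ ∀ c : ℕ → ℝ,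
    (∀ r ≤ L, |c r| ≤ M) → ∀ l ≤ L, |cumulantOfMoments c l| ≤ K := by
  induction L with
  | zero =>
    refine ⟨1, le_rfl, fun c _ l hl => ?_⟩
    obtain rfl : l = 0 := by omega
    simp [cumulantOfMoments]
  | succ L ih =>
    obtain ⟨K, hK1, hK⟩ := ih
    refine ⟨K + |M| + ∑ r : Fin L, (L.choose r : ℝ) * K * |M|, ?_, fun c hc l hl => ?_⟩
    · have : 0 ≤ ∑ r : Fin L, (L.choose r : ℝ) * K * |M| := by positivity
      have := abs_nonneg M
      linarith
    · have hS : 0 ≤ ∑ r : Fin L, (L.choose r : ℝ) * K * |M| := by positivity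
      have hc' : ∀ r ≤ L, |c r| ≤ M := fun r hr => hc r (by omega)
      rcases Nat.lt_or_ge l (L + 1) with h | h
      · have := hK c hc' l (by omega)
        have := abs_nonneg M
        linarith
      · obtain rfl : l = L + 1 := by omega
        rw [cumulantOfMoments]
        refine (abs_sub _ _).trans ?_
        have h1 : |c (L + 1)| ≤ |M| := (hc _ le_rfl).trans (le_abs_self _)
        have h2 : |∑ r : Fin L, (L.choose r : ℝ) * cumulantOfMoments c (r + 1) * c (L - r)|
            ≤ ∑ r : Fin L, (L.choose r : ℝ) * K * |M| := by
          refine (Finset.abs_sum_le_sum_abs _ _).trans (Finset.sum_le_sum fun r _ => ?_)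
          rw [abs_mul, abs_mul, Nat.abs_cast]
          have h3 := hK c hc' (r + 1) (by omega)
          have h4 : |c (L - r)| ≤ |M| := (hc _ (by omega)).trans (le_abs_self _)
          gcongr
        linarith

/-- The cumulant polynomial `∑_{1 ≤ l ≤ m} κ_l (i u)^l / l!`. -/
noncomputable def cumulantPoly (c : ℕ → ℝ) (m : ℕ) (u : ℝ) : ℂ :=
  ∑ r ∈ Finset.range m, (cumulantOfMoments c (r + 1) : ℂ) * (u * Complex.I) ^ (r + 1) /
    (r + 1).factorial

theorem cumulantPoly_zero (c : ℕ → ℝ) (m : ℕ) : cumulantPoly c m 0 = 0 := by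
  simp [cumulantPoly]

theorem hasDerivAt_cumulantPoly (c : ℕ → ℝ) (m : ℕ) (u : ℝ) :
    HasDerivAt (cumulantPoly c m) (∑ r ∈ Finset.range m,
      Complex.I * cumulantOfMoments c (r + 1) * (u * Complex.I) ^ r / r.factorial) u := by
  unfold cumulantPoly
  refine HasDerivAt.fun_sum fun r _ => ?_
  have h := (((Complex.ofRealCLM.hasDerivAt (x := u)).mul_const Complex.I).pow (r + 1)).const_mul
    (cumulantOfMoments c (r + 1) : ℂ) |>.div_const ((r + 1).factorial : ℂ)
  simp only [Complex.ofRealCLM_apply, Complex.ofReal_one, one_mul, Nat.add_sub_cancel,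
    Nat.factorial_succ, Nat.cast_mul] at h
  simp only [Nat.factorial_succ, Nat.cast_mul]
  refine h.congr_deriv ?_
  have h1 : ((r + 1 : ℕ) : ℂ) ≠ 0 := by exact_mod_cast Nat.succ_ne_zero r
  have h2 : (r.factorial : ℂ) ≠ 0 := by exact_mod_cast Nat.factorial_ne_zero r
  field_simp

theorem norm_cumulantPoly_le {c : ℕ → ℝ} {m : ℕ} {K : ℝ} (hK : 0 ≤ K)
    (hc : ∀ l ≤ m, |cumulantOfMoments c l| ≤ K) {u : ℝ} (hu : |u| ≤ 1) :
    ‖cumulantPoly c m u‖ ≤ m * K := by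
  unfold cumulantPoly
  refine (norm_sum_le_of_le _ (f := fun r => _) (n := fun _ => K) fun r hr => ?_).trans
    (by simp)
  rw [norm_div, norm_mul, norm_pow, Complex.norm_natCast, norm_mul, Complex.norm_I, mul_one,
    Complex.norm_real, Complex.norm_real, Real.norm_eq_abs, Real.norm_eq_abs]
  have h1 : (1 : ℝ) ≤ (r + 1).factorial := by exact_mod_cast Nat.factorial_pos _
  rw [div_le_iff₀ (by positivity)]
  have h2 := hc (r + 1) (by have := Finset.mem_range.1 hr; omega)
  have h3 : |u| ^ (r + 1) ≤ 1 := pow_le_one₀ (abs_nonneg _) hu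
  calc _ ≤ K * 1 := by gcongr
    _ ≤ _ := by gcongr

/-- The Taylor polynomials of `φ'` and of `L' φ` agree up to terms of order `m`. -/
theorem sum_moment_sub_sum_cumulant_mul_sum_moment (c : ℕ → ℝ) (h0 : c 0 = 1) (m : ℕ) (y : ℂ) :
    ∑ n ∈ Finset.range m, (c (n + 1) : ℂ) * y ^ n / n.factorial -
      (∑ r ∈ Finset.range m, (cumulantOfMoments c (r + 1) : ℂ) * y ^ r / r.factorial) *
        (∑ n ∈ Finset.range m, (c n : ℂ) * y ^ n / n.factorial) =
    -∑ r ∈ Finset.range m, ∑ n ∈ Finset.Ico (m - r) m,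
      (cumulantOfMoments c (r + 1) : ℂ) * y ^ r / r.factorial *
        ((c n : ℂ) * y ^ n / n.factorial) := by
  rw [Finset.sum_mul_sum]
  have h1 : ∀ r ∈ Finset.range m, ∑ n ∈ Finset.range m,
      (cumulantOfMoments c (r + 1) : ℂ) * y ^ r / r.factorial *
        ((c n : ℂ) * y ^ n / n.factorial) =
      ∑ n ∈ Finset.range (m - r), (cumulantOfMoments c (r + 1) : ℂ) * y ^ r / r.factorial *
        ((c n : ℂ) * y ^ n / n.factorial) + ∑ n ∈ Finset.Ico (m - r) m,
      (cumulantOfMoments c (r + 1) : ℂ) * y ^ r / r.factorial *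
        ((c n : ℂ) * y ^ n / n.factorial) := fun r _ =>
    (Finset.sum_range_add_sum_Ico _ (by omega)).symm
  rw [Finset.sum_congr rfl h1, Finset.sum_add_distrib, ← sub_sub, ← Finset.sum_range_diag_flip m
    (fun r n => (cumulantOfMoments c (r + 1) : ℂ) * y ^ r / r.factorial *
        ((c n : ℂ) * y ^ n / n.factorial))]
  rw [← Finset.sum_sub_distrib, Finset.sum_eq_zero, zero_sub]
  intro n _
  rw [moment_succ_eq_sum_cumulant c h0, sub_eq_zero, Complex.ofReal_sum, Finset.sum_mul,
    Finset.sum_div]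
  refine Finset.sum_congr rfl fun r hr => ?_
  have hr' : r ≤ n := by have := Finset.mem_range.1 hr; omega
  have h2 : (n.choose r : ℂ) * r.factorial * (n - r).factorial = n.factorial := by
    exact_mod_cast Nat.choose_mul_factorial_mul_factorial hr'
  have h3 : (n.factorial : ℂ) ≠ 0 := by exact_mod_cast Nat.factorial_ne_zero n
  have h4 : (r.factorial : ℂ) ≠ 0 := by exact_mod_cast Nat.factorial_ne_zero r
  have h5 : ((n - r).factorial : ℂ) ≠ 0 := by exact_mod_cast Nat.factorial_ne_zero _
  have h6 : y ^ n = y ^ r * y ^ (n - r) := by rw [← pow_add]; congr 1; omega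
  rw [← h2, h6]
  have h7 : (n.choose r : ℂ) ≠ 0 := by
    exact_mod_cast (Nat.choose_pos hr').ne'
  push_cast
  field_simp

/-- Weighted Taylor expansion of a characteristic function and of its derivatives. -/
theorem norm_integral_pow_mul_exp_sub_le (ν : Measure ℝ) [IsProbabilityMeasure ν] {q k : ℕ}
    (hi : ∀ r ≤ q + k, Integrable (fun x => x ^ r) ν) (u : ℝ) :
    ‖∫ x : ℝ, (x : ℂ) ^ q * Complex.exp (u * x * Complex.I) ∂ν -
      ∑ n ∈ Finset.range k, ((∫ x, x ^ (n + q) ∂ν : ℝ) : ℂ) * (u * Complex.I) ^ n / n.factorial‖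
      ≤ 4 * |u| ^ k * ∫ x, |x| ^ (q + k) ∂ν := by
  have hq : Integrable (fun x : ℝ => (x : ℂ) ^ q) ν := by
    simpa using (hi q (by omega)).ofReal (𝕜 := ℂ)
  have hI : Integrable (fun x : ℝ => (x : ℂ) ^ q * Complex.exp (u * x * Complex.I)) ν := by
    refine hq.mono (by fun_prop) (ae_of_all _ fun x => ?_)
    have := Complex.norm_exp_ofReal_mul_I (u * x)
    push_cast at this
    simp [this]
  have hJ : ∀ n ∈ Finset.range k, Integrable
      (fun x : ℝ => (x : ℂ) ^ q * ((u * x * Complex.I) ^ n / n.factorial)) ν := by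
    intro n hn
    have h := ((hi (n + q) (by have := Finset.mem_range.1 hn; omega)).ofReal (𝕜 := ℂ)).mul_const
      ((u * Complex.I) ^ n / n.factorial)
    refine h.congr (ae_of_all _ fun x => ?_)
    simp only [Complex.coe_algebraMap]
    push_cast
    ring
  have h1 : ∑ n ∈ Finset.range k,
      ((∫ x, x ^ (n + q) ∂ν : ℝ) : ℂ) * (u * Complex.I) ^ n / n.factorial
      = ∫ x : ℝ, ∑ n ∈ Finset.range k,
        (x : ℂ) ^ q * ((u * x * Complex.I) ^ n / n.factorial) ∂ν := by
    rw [integral_finsetSum _ hJ]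
    refine Finset.sum_congr rfl fun n _ => ?_
    rw [← integral_complex_ofReal, mul_div_assoc, ← integral_mul_const]
    refine integral_congr_ae (ae_of_all _ fun x => ?_)
    push_cast
    ring
  rw [h1, ← integral_sub hI (integrable_finsetSum _ hJ), ← integral_const_mul]
  refine norm_integral_le_of_norm_le (((hi (q + k) le_rfl).abs.const_mul _).congr
    (ae_of_all _ fun x => by simp only [abs_pow]; rfl)) (ae_of_all _ fun x => ?_)
  rw [← Finset.mul_sum, ← mul_sub, norm_mul, norm_pow, Complex.norm_real, Real.norm_eq_abs]
  have := norm_exp_mul_I_sub_sum_le (u * x) k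
  push_cast at this
  calc _ ≤ |x| ^ q * (4 * |u * x| ^ k) := by gcongr
    _ = _ := by rw [abs_mul, mul_pow, pow_add]; ring

theorem abs_integral_pow_le (ν : Measure ℝ) [IsProbabilityMeasure ν] {L : ℕ} {M : ℝ}
    (hi : ∀ r ≤ L, Integrable (fun x => x ^ r) ν) (hM : ∫ x, |x| ^ L ∂ν ≤ M) :
    ∀ r ≤ L, ∫ x, |x| ^ r ∂ν ≤ 1 + M := by
  intro r hr
  have ha : ∀ r ≤ L, Integrable (fun x => |x| ^ r) ν := fun r hr =>
    (hi r hr).abs.congr (ae_of_all _ fun x => by simp only [abs_pow])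
  have h1 : ∫ x, |x| ^ r ∂ν ≤ ∫ x, (1 + |x| ^ L) ∂ν := by
    refine integral_mono (ha r hr) ((integrable_const _).add (ha L le_rfl)) fun x => ?_
    rcases le_total |x| 1 with h | h
    · have := pow_le_one₀ (n := r) (abs_nonneg x) h
      have : 0 ≤ |x| ^ L := by positivity
      simp only; linarith
    · have := pow_le_pow_right₀ h hr
      simp only; linarith
  rw [integral_add (integrable_const _) (ha L le_rfl)] at h1
  simp at h1
  linarith

/-- `φ e^{-L} = 1 + O(|u|^{m+1})`, where `L` is the cumulant polynomial: the derivative is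
`(φ' - L' φ) e^{-L}`, and the recursion for the cumulants says that the Taylor coefficients of
`φ' - L' φ` of order less than `m` vanish. -/
theorem exists_norm_charFun_mul_exp_sub_one_le (m : ℕ) (M : ℝ) : ∃ K : ℝ, 1 ≤ K ∧
    ∀ (ν : Measure ℝ) [IsProbabilityMeasure ν],
    (∀ r ≤ m + 1, Integrable (fun x => x ^ r) ν) → ∫ x, |x| ^ (m + 1) ∂ν ≤ M →
    (∀ l ≤ m, |cumulantOfMoments (fun r => ∫ x, x ^ r ∂ν) l| ≤ K) ∧
    ∀ u : ℝ, |u| ≤ 1 →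
      ‖charFun ν u * Complex.exp (-cumulantPoly (fun r => ∫ x, x ^ r ∂ν) m u) - 1‖
        ≤ K * |u| ^ (m + 1) := by
  obtain ⟨K, hK1, hK⟩ := exists_cumulantOfMoments_le (1 + M) (m + 1)
  set G : ℝ := 4 * (1 + |M|) + m * (m * (K * (1 + |M|))) + m * K * (4 * (1 + |M|)) with hG
  have hG0 : 0 ≤ G := by positivity
  refine ⟨K + G * Real.exp (m * K), by nlinarith [Real.exp_pos (m * K)], ?_⟩
  intro ν _ hi hM
  set c : ℕ → ℝ := fun r => ∫ x, x ^ r ∂ν with hc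
  have hmom := abs_integral_pow_le ν hi hM
  have hcb : ∀ r ≤ m + 1, |c r| ≤ 1 + M := fun r hr => by
    have h := norm_integral_le_integral_norm (μ := ν) fun x : ℝ => x ^ r
    simp only [Real.norm_eq_abs, abs_pow] at h
    exact h.trans (hmom r hr)
  have hM1 : 1 + M ≤ 1 + |M| := by linarith [le_abs_self M]
  have hκ := hK c hcb
  have h0 : c 0 = 1 := by simp [hc]
  refine ⟨fun l hl => (hκ l (by omega)).trans
    (le_add_of_nonneg_right (by positivity)), fun u hu => ?_⟩
  have hL := hasDerivAt_cumulantPoly c m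
  -- the derivative of the characteristic function
  have hφ : ∀ v : ℝ, HasDerivAt (charFun ν)
      (Complex.I * ∫ x : ℝ, (x : ℂ) ^ 1 * Complex.exp (v * x * Complex.I) ∂ν) v := by
    intro v
    have hmem : MemLp id ((1 : ℕ) : ℝ≥0∞) ν := by
      simpa [memLp_one_iff_integrable, Function.id_def] using hi 1 (by omega)
    have h1 := iteratedDeriv_charFun (t := v) hmem
    rw [iteratedDeriv_one, pow_one] at h1
    rw [← h1]
    exact ((contDiff_charFun hmem).differentiable (by simp)).differentiableAt.hasDerivAt
  have hg : ∀ v : ℝ, |v| ≤ 1 →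
      ‖Complex.I * (∫ x : ℝ, (x : ℂ) ^ 1 * Complex.exp (v * x * Complex.I) ∂ν) -
        (∑ r ∈ Finset.range m, Complex.I * cumulantOfMoments c (r + 1) *
          (v * Complex.I) ^ r / r.factorial) * charFun ν v‖ ≤ G * |v| ^ m := by
    intro v hv
    have hv1 := norm_integral_pow_mul_exp_sub_le ν (q := 1) (k := m)
      (fun r hr => hi r (by omega)) v
    have hv0 := norm_integral_pow_mul_exp_sub_le ν (q := 0) (k := m)
      (fun r hr => hi r (by omega)) v
    simp only [pow_zero, one_mul, add_zero, zero_add] at hv0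
    rw [← charFun_apply_real] at hv0
    have hs := sum_moment_sub_sum_cumulant_mul_sum_moment c h0 m (v * Complex.I)
    have hfac : ∀ n : ℕ, (1 : ℝ) ≤ n.factorial := fun n => by
      exact_mod_cast Nat.factorial_pos n
    have hℓ : ‖∑ r ∈ Finset.range m, (cumulantOfMoments c (r + 1) : ℂ) * (v * Complex.I) ^ r /
        r.factorial‖ ≤ m * K := by
      refine (norm_sum_le_of_le _ (n := fun _ => K) fun r hr => ?_).trans (by simp)
      rw [norm_div, norm_mul, norm_pow, Complex.norm_natCast, norm_mul, Complex.norm_I, mul_one,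
        Complex.norm_real, Complex.norm_real, Real.norm_eq_abs, Real.norm_eq_abs,
        div_le_iff₀ (by linarith [hfac r])]
      have h2 := hκ (r + 1) (by have := Finset.mem_range.1 hr; omega)
      have h3 : |v| ^ r ≤ 1 := pow_le_one₀ (abs_nonneg _) hv
      calc _ ≤ K * 1 := by gcongr
        _ ≤ _ := by gcongr; exact hfac r
    have hT : ‖∑ r ∈ Finset.range m, ∑ n ∈ Finset.Ico (m - r) m,
      (cumulantOfMoments c (r + 1) : ℂ) * (v * Complex.I) ^ r / r.factorial *
        ((c n : ℂ) * (v * Complex.I) ^ n / n.factorial)‖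
        ≤ m * (m * (K * (1 + |M|))) * |v| ^ m := by
      refine (norm_sum_le_of_le _
        (n := fun _ => m * (K * (1 + |M|)) * |v| ^ m) fun r hr => ?_).trans
        (by simp [mul_assoc])
      refine (norm_sum_le_of_le _
        (n := fun _ => (K * (1 + |M|)) * |v| ^ m) fun n hn => ?_).trans ?_
      · have hr' := Finset.mem_range.1 hr
        have hn' := Finset.mem_Ico.1 hn
        have h2 := hκ (r + 1) (by omega)
        have h3 := (hcb n (by omega)).trans hM1
        rw [norm_mul, norm_div, norm_div, norm_mul, norm_mul, norm_pow, norm_pow,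
          Complex.norm_natCast, Complex.norm_natCast, norm_mul, Complex.norm_I, mul_one,
          Complex.norm_real, Complex.norm_real, Complex.norm_real, Real.norm_eq_abs,
          Real.norm_eq_abs, Real.norm_eq_abs]
        calc _ ≤ (K * |v| ^ r / 1) * ((1 + |M|) * |v| ^ n / 1) := by
              gcongr
              · exact hfac r
              · exact hfac n
          _ = K * (1 + |M|) * |v| ^ (r + n) := by rw [pow_add]; ring
          _ ≤ _ := by
              gcongr K * (1 + |M|) * ?_
              exact pow_le_pow_of_le_one (abs_nonneg _) hv (by omega)
      · rw [Finset.sum_const, Nat.card_Ico, nsmul_eq_mul, mul_assoc]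
        have : ((m - (m - r) : ℕ) : ℝ) ≤ m := by exact_mod_cast Nat.sub_le _ _
        have h9 : 0 ≤ K * (1 + |M|) * |v| ^ m := by positivity
        nlinarith
    have hm1 : ∫ x, |x| ^ (1 + m) ∂ν ≤ 1 + |M| := by
      rw [add_comm 1 m]; linarith [le_abs_self M]
    have hm0 : ∫ x, |x| ^ m ∂ν ≤ 1 + |M| := (hmom m (by omega)).trans hM1
    set F1 := ∫ x : ℝ, (x : ℂ) ^ 1 * Complex.exp (v * x * Complex.I) ∂ν
    set ℓ := ∑ r ∈ Finset.range m, (cumulantOfMoments c (r + 1) : ℂ) * (v * Complex.I) ^ r /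
        r.factorial with hℓd
    set T1 := ∑ n ∈ Finset.range m, (c (n + 1) : ℂ) * (v * Complex.I) ^ n / n.factorial
    set T0 := ∑ n ∈ Finset.range m, (c n : ℂ) * (v * Complex.I) ^ n / n.factorial
    have e1 : ∑ r ∈ Finset.range m, Complex.I * cumulantOfMoments c (r + 1) *
          (v * Complex.I) ^ r / r.factorial = Complex.I * ℓ := by
      rw [hℓd, Finset.mul_sum]
      exact Finset.sum_congr rfl fun r _ => by ring
    rw [e1]
    have e2 : Complex.I * F1 - Complex.I * ℓ * charFun ν v
        = Complex.I * ((F1 - T1) + (T1 - ℓ * T0) - ℓ * (charFun ν v - T0)) := by ring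
    rw [e2, norm_mul, Complex.norm_I, one_mul, hs]
    have hvm : 0 ≤ |v| ^ m := by positivity
    refine (norm_sub_le _ _).trans ?_
    have hv1' : ‖F1 - T1‖ ≤ 4 * |v| ^ m * (1 + |M|) := hv1.trans (by gcongr)
    have hv0' : ‖charFun ν v - T0‖ ≤ 4 * |v| ^ m * (1 + |M|) := hv0.trans (by gcongr)
    refine (add_le_add ((norm_add_le _ _).trans (add_le_add hv1'
      ((norm_neg _).trans_le hT))) ((norm_mul_le _ _).trans
      (mul_le_mul hℓ hv0' (norm_nonneg _) (by positivity)))).trans ?_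
    rw [hG]
    linarith
  have hd : ∀ v : ℝ, HasDerivAt
      (fun v => charFun ν v * Complex.exp (-cumulantPoly c m v))
      ((Complex.I * (∫ x : ℝ, (x : ℂ) ^ 1 * Complex.exp (v * x * Complex.I) ∂ν) -
        (∑ r ∈ Finset.range m, Complex.I * cumulantOfMoments c (r + 1) *
          (v * Complex.I) ^ r / r.factorial) * charFun ν v) *
        Complex.exp (-cumulantPoly c m v)) v := by
    intro v
    refine ((hφ v).mul (hL v).fun_neg.cexp).congr_deriv ?_
    ring
  have hmv := (convex_Icc (-|u|) |u|).norm_image_sub_le_of_norm_hasDerivWithin_le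
    (C := G * Real.exp (m * K) * |u| ^ m) (x := 0) (y := u)
    (fun v _ => (hd v).hasDerivWithinAt) (fun v hv => ?_)
    ⟨by simp, by simp⟩ ⟨neg_abs_le u, le_abs_self u⟩
  · simp only [cumulantPoly_zero, charFun_zero, neg_zero, Complex.exp_zero, probReal_univ,
      Complex.ofReal_one, mul_one, sub_zero, Real.norm_eq_abs] at hmv
    refine hmv.trans ?_
    rw [pow_succ, mul_assoc, mul_assoc, ← mul_assoc G]
    gcongr
    linarith
  · have hv' : |v| ≤ |u| := abs_le.2 hv
    rw [norm_mul]
    have h1 := hg v (hv'.trans hu)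
    have h2 : ‖Complex.exp (-cumulantPoly c m v)‖ ≤ Real.exp (m * K) := by
      refine (Complex.norm_exp_le_exp_norm _).trans (Real.exp_le_exp.2 ?_)
      rw [norm_neg]
      exact norm_cumulantPoly_le (by linarith) (fun l hl => hκ l (by omega)) (hv'.trans hu)
    calc _ ≤ G * |v| ^ m * Real.exp (m * K) := by gcongr
      _ ≤ G * |u| ^ m * Real.exp (m * K) := by gcongr
      _ = _ := by ring

/-! ### Truncation of the exponential of a polynomial -/

/-- The sum of the coefficients of order at most `R` of `∑_{s ≤ R} w(z)^s / s!`, for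
`w(z) = ∑_{1 ≤ l ≤ R} a_l z^l`: the value at `z = 1` of the Taylor polynomial of order `R` of
`exp (w(z))`. -/
noncomputable def truncExp (a : ℕ → ℂ) (R : ℕ) : ℂ :=
  ∑ s ∈ Finset.range (R + 1), ∑ r ∈ Finset.range (R + 1),
    ((∑ l ∈ Finset.Icc 1 R, Polynomial.monomial l (a l)) ^ s).coeff r / (s.factorial : ℂ)

theorem coeff_sum_monomial {𝕜 : Type*} [Semiring 𝕜] (a : ℕ → 𝕜) (R l : ℕ) :
    (∑ l ∈ Finset.Icc 1 R, Polynomial.monomial l (a l)).coeff l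
      = if l ∈ Finset.Icc 1 R then a l else 0 := by
  simp [Polynomial.finsetSum_coeff, Polynomial.coeff_monomial]

theorem norm_coeff_pow_le {𝕜 : Type*} [NormedField 𝕜] {w : Polynomial 𝕜} {T η : ℝ}
    (hT : 0 ≤ T) (hη : 0 ≤ η) (hw : ∀ l, ‖w.coeff l‖ ≤ T * η ^ l) (s r : ℕ) :
    ‖(w ^ s).coeff r‖ ≤ η ^ r * T ^ s * (r + 1) ^ s := by
  induction s generalizing r with
  | zero =>
    rw [pow_zero, Polynomial.coeff_one]
    split_ifs with h
    · subst h; simp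
    · simp; positivity
  | succ s ih =>
    rw [pow_succ, Polynomial.coeff_mul]
    refine (norm_sum_le_of_le _ (n := fun _ => η ^ r * T ^ (s + 1) * (r + 1) ^ s)
      fun x hx => ?_).trans ?_
    · have hx' := Finset.HasAntidiagonal.mem_antidiagonal.1 hx
      rw [norm_mul]
      have h1 : ((x.1 : ℝ) + 1) ≤ r + 1 := by
        have : x.1 ≤ r := by omega
        have : (x.1 : ℝ) ≤ r := by exact_mod_cast this
        linarith
      calc _ ≤ (η ^ x.1 * T ^ s * (x.1 + 1) ^ s) * (T * η ^ x.2) := by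
            gcongr
            · exact ih _
            · exact hw _
        _ = η ^ (x.1 + x.2) * T ^ (s + 1) * (x.1 + 1) ^ s := by rw [pow_add, pow_succ]; ring
        _ ≤ η ^ (x.1 + x.2) * T ^ (s + 1) * (r + 1) ^ s := by gcongr
        _ = _ := by rw [hx']
    · rw [Finset.sum_const, Finset.Nat.card_antidiagonal, nsmul_eq_mul]
      push_cast
      rw [pow_succ ((r : ℝ) + 1)]
      exact le_of_eq (by ring)

theorem norm_coeff_sum_monomial_le {𝕜 : Type*} [NormedField 𝕜] {a : ℕ → 𝕜} {R : ℕ}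
    {T η : ℝ} (hT : 0 ≤ T) (hη : 0 ≤ η) (ha : ∀ l ∈ Finset.Icc 1 R, ‖a l‖ ≤ T * η ^ l) (l : ℕ) :
    ‖(∑ l ∈ Finset.Icc 1 R, Polynomial.monomial l (a l)).coeff l‖ ≤ T * η ^ l := by
  rw [coeff_sum_monomial]
  split_ifs with h
  · exact ha l h
  · rw [norm_zero]; positivity

theorem norm_truncExp_le {a : ℕ → ℂ} {R : ℕ} {T : ℝ} (hT : 1 ≤ T)
    (ha : ∀ l ∈ Finset.Icc 1 R, ‖a l‖ ≤ T) :
    ‖truncExp a R‖ ≤ ((R + 1) * (R + 1) * (R + 1) ^ R) * T ^ R := by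
  unfold truncExp
  have h1 : ∀ s ∈ Finset.range (R + 1), ∀ r ∈ Finset.range (R + 1),
      ‖((∑ l ∈ Finset.Icc 1 R, Polynomial.monomial l (a l)) ^ s).coeff r / (s.factorial : ℂ)‖
        ≤ (R + 1) ^ R * T ^ R := by
    intro s hs r hr
    have hs' : s ≤ R := by have := Finset.mem_range.1 hs; omega
    have hr' : r ≤ R := by have := Finset.mem_range.1 hr; omega
    have hr'' : (r : ℝ) ≤ R := by exact_mod_cast hr'
    have h2 := norm_coeff_pow_le (by linarith) zero_le_one
      (norm_coeff_sum_monomial_le (R := R) (T := T) (η := 1) (by linarith) zero_le_one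
        (by simpa using ha)) s r
    rw [norm_div, Complex.norm_natCast]
    have h3 : (1 : ℝ) ≤ s.factorial := by exact_mod_cast Nat.factorial_pos s
    refine (div_le_self (norm_nonneg _) h3).trans (h2.trans ?_)
    rw [one_pow, one_mul, mul_comm]
    gcongr
    · calc ((r : ℝ) + 1) ^ s ≤ (R + 1) ^ s := by gcongr
        _ ≤ _ := pow_le_pow_right₀ (by linarith [(Nat.cast_nonneg R : (0 : ℝ) ≤ R)]) hs'
  refine (norm_sum_le_of_le _ fun s hs => norm_sum_le_of_le _ fun r hr => h1 s hs r hr).trans ?_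
  simp only [Finset.sum_const, Finset.card_range, nsmul_eq_mul]
  push_cast
  exact le_of_eq (by ring)

/-- If `a l` is of order `η ^ l`, the truncation at order `R` changes the exponential by a term of
order `η ^ (R + 1)`. -/
theorem norm_exp_sub_truncExp_le {a : ℕ → ℂ} {R : ℕ} {T η : ℝ} (hT : 1 ≤ T) (hη : 0 ≤ η)
    (hη1 : η ≤ 1) (ha : ∀ l ∈ Finset.Icc 1 R, ‖a l‖ ≤ T * η ^ l) :
    ‖Complex.exp (∑ l ∈ Finset.Icc 1 R, a l) - truncExp a R‖ ≤
      ((R : ℝ) ^ (R + 1) + (R + 1) * (R * R + 1) * (R * R + 1) ^ R) * (T * η) ^ (R + 1) *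
        Real.exp ‖∑ l ∈ Finset.Icc 1 R, a l‖ := by
  set W := ∑ l ∈ Finset.Icc 1 R, a l with hW
  set w : Polynomial ℂ := ∑ l ∈ Finset.Icc 1 R, Polynomial.monomial l (a l) with hw
  have hT0 : 0 ≤ T := by linarith
  have hdeg : w.natDegree ≤ R := by
    refine Polynomial.natDegree_sum_le_of_forall_le _ _ fun l hl => ?_
    exact (Polynomial.natDegree_monomial_le _).trans (Finset.mem_Icc.1 hl).2
  have hWn : ‖W‖ ≤ R * (T * η) := by
    refine (norm_sum_le_of_le _ (n := fun _ => T * η) fun l hl => ?_).trans (by simp)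
    refine (ha l hl).trans ?_
    gcongr
    exact pow_le_of_le_one hη hη1 (by have := (Finset.mem_Icc.1 hl).1; omega)
  have heval : ∀ s ∈ Finset.range (R + 1), W ^ s =
      ∑ r ∈ Finset.range (R + 1), (w ^ s).coeff r +
        ∑ r ∈ Finset.Ico (R + 1) (R * R + 1), (w ^ s).coeff r := by
    intro s hs
    have h1 : W ^ s = (w ^ s).eval 1 := by
      rw [Polynomial.eval_pow]
      simp [hw, hW, Polynomial.eval_finsetSum]
    have h2 : (w ^ s).natDegree < R * R + 1 := by
      have h3 : (w ^ s).natDegree ≤ s * w.natDegree := Polynomial.natDegree_pow_le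
      have h4 : s * w.natDegree ≤ R * R :=
        Nat.mul_le_mul (by have := Finset.mem_range.1 hs; omega) hdeg
      omega
    rw [Finset.sum_range_add_sum_Ico _ (by nlinarith [sq_nonneg R, Nat.le_mul_self R]), h1,
      Polynomial.eval_eq_sum_range' h2]
    simp
  have hsplit : Complex.exp W - truncExp a R =
      (Complex.exp W - ∑ s ∈ Finset.range (R + 1), W ^ s / s.factorial) +
      ∑ s ∈ Finset.range (R + 1), ∑ r ∈ Finset.Ico (R + 1) (R * R + 1),
        (w ^ s).coeff r / (s.factorial : ℂ) := by
    have : ∑ s ∈ Finset.range (R + 1), W ^ s / s.factorial = truncExp a R +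
      ∑ s ∈ Finset.range (R + 1), ∑ r ∈ Finset.Ico (R + 1) (R * R + 1),
        (w ^ s).coeff r / (s.factorial : ℂ) := by
      unfold truncExp
      rw [← Finset.sum_add_distrib]
      refine Finset.sum_congr rfl fun s hs => ?_
      rw [heval s hs, add_div, Finset.sum_div, Finset.sum_div]
    rw [this]; ring
  have hE : 1 ≤ Real.exp ‖W‖ := Real.one_le_exp (norm_nonneg _)
  have hA := Complex.norm_exp_sub_sum_le_norm_mul_exp W (R + 1)
  have hA' : ‖W‖ ^ (R + 1) * Real.exp ‖W‖
      ≤ (R : ℝ) ^ (R + 1) * (T * η) ^ (R + 1) * Real.exp ‖W‖ := by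
    rw [← mul_pow]; gcongr
  have hB : ‖∑ s ∈ Finset.range (R + 1), ∑ r ∈ Finset.Ico (R + 1) (R * R + 1),
        (w ^ s).coeff r / (s.factorial : ℂ)‖ ≤
      (R + 1) * (R * R + 1) * (R * R + 1) ^ R * (T * η) ^ (R + 1) := by
    have h1 : ∀ s ∈ Finset.range (R + 1), ∀ r ∈ Finset.Ico (R + 1) (R * R + 1),
        ‖(w ^ s).coeff r / (s.factorial : ℂ)‖
          ≤ (R * R + 1) ^ R * (T * η) ^ (R + 1) := by
      intro s hs r hr
      have hs' : s ≤ R := by have := Finset.mem_range.1 hs; omega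
      have hr1 := (Finset.mem_Ico.1 hr).1
      have hr' : r ≤ R * R := by have := (Finset.mem_Ico.1 hr).2; omega
      have hr'' : (r : ℝ) ≤ R * R := by exact_mod_cast hr'
      have h2 := norm_coeff_pow_le hT0 hη
        (norm_coeff_sum_monomial_le (R := R) hT0 hη ha) s r
      rw [norm_div, Complex.norm_natCast]
      have h3 : (1 : ℝ) ≤ s.factorial := by exact_mod_cast Nat.factorial_pos s
      refine (div_le_self (norm_nonneg _) h3).trans (h2.trans ?_)
      rw [mul_pow, mul_comm (T ^ (R + 1)), mul_comm]
      gcongr ?_ * (?_ * ?_)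
      · calc ((r : ℝ) + 1) ^ s ≤ (R * R + 1) ^ s := by gcongr
          _ ≤ _ := pow_le_pow_right₀
            (by linarith [mul_self_nonneg (R : ℝ)]) hs'
      · exact pow_le_pow_of_le_one hη hη1 hr1
      · exact pow_le_pow_right₀ hT (by omega)
    refine (norm_sum_le_of_le _ fun s hs => norm_sum_le_of_le _ fun r hr => h1 s hs r hr).trans ?_
    simp only [Finset.sum_const, Finset.card_range, nsmul_eq_mul, Nat.card_Ico]
    have h5 : ((R * R + 1 - (R + 1) : ℕ) : ℝ) ≤ R * R + 1 := by
      exact_mod_cast Nat.sub_le _ _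
    rw [Nat.cast_add_one R]
    calc _ ≤ ((R : ℝ) + 1) * ((R * R + 1) * ((R * R + 1) ^ R * (T * η) ^ (R + 1))) := by gcongr
      _ = _ := by ring
  rw [hsplit]
  refine (norm_add_le _ _).trans ((add_le_add (hA.trans hA') hB).trans ?_)
  have h7 : 0 ≤ ((R : ℝ) + 1) * (R * R + 1) * (R * R + 1) ^ R * (T * η) ^ (R + 1) := by positivity
  nlinarith

/-! ### The Fourier transform of the Edgeworth approximation, algebraically -/

/-- The Edgeworth polynomial with index `ν` with `(iξ)^k` in place of `H_k`, at `y = iξ`. -/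
noncomputable def edgeworthPolyHat (lam : ℕ → ℝ) (ν : ℕ) (y : ℂ) : ℂ :=
  ∑ s ∈ Finset.range (ν - 2 + 1),
    ((((∑ l ∈ Finset.Icc 1 (ν - 2),
        Polynomial.monomial l (lam (l + 2) / ((l + 2).factorial : ℝ))) ^ s).coeff (ν - 2)
      / (s.factorial : ℝ) : ℝ) : ℂ) * y ^ (ν - 2 + 2 * s)

/-- Giving the monomial of order `l` the weight `y ^ (l + 2)` gives the coefficient of order `l` in
an `s`-th power the weight `y ^ (l + 2 s)`, the exponent in `edgeworthPolyHat`. -/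
theorem coeff_pow_eq_of_coeff_eq {p : Polynomial ℝ} {q : Polynomial ℂ} {r : ℕ} {y : ℂ}
    (h : ∀ l ≤ r, q.coeff l = y ^ (l + 2) * (p.coeff l : ℂ)) (s : ℕ) :
    ∀ l ≤ r, (q ^ s).coeff l = y ^ (l + 2 * s) * ((p ^ s).coeff l : ℂ) := by
  induction s with
  | zero =>
    intro l _
    rw [pow_zero, pow_zero, Polynomial.coeff_one, Polynomial.coeff_one]
    split_ifs with h0
    · subst h0; simp
    · simp
  | succ s ih =>
    intro l hl
    rw [pow_succ, pow_succ, Polynomial.coeff_mul, Polynomial.coeff_mul, Complex.ofReal_sum,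
      Finset.mul_sum]
    refine Finset.sum_congr rfl fun x hx => ?_
    have hx' := Finset.HasAntidiagonal.mem_antidiagonal.1 hx
    rw [ih _ (by omega), h _ (by omega), ← hx']
    push_cast
    ring

theorem coeff_sum_monomial_pow_of_lt {𝕜 : Type*} [CommSemiring 𝕜] (a : ℕ → 𝕜) (R : ℕ) {r s : ℕ}
    (h : r < s) :
    ((∑ l ∈ Finset.Icc 1 R, Polynomial.monomial l (a l)) ^ s).coeff r = 0 := by
  have h1 : (Polynomial.X : Polynomial 𝕜) ∣ ∑ l ∈ Finset.Icc 1 R, Polynomial.monomial l (a l) := by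
    rw [Polynomial.X_dvd_iff, coeff_sum_monomial]; simp
  exact Polynomial.X_pow_dvd_iff.1 (pow_dvd_pow_of_dvd h1 s) r h

/-- The Edgeworth approximation on the Fourier side is the Taylor polynomial, in the formal
variable that counts orders, of the exponential of the cumulant series. -/
theorem one_add_sum_edgeworthPolyHat (lam : ℕ → ℝ) (R : ℕ) (y : ℂ) :
    1 + ∑ ν ∈ Finset.Icc 3 (R + 2), edgeworthPolyHat lam ν y =
      truncExp (fun l => (lam (l + 2) / (l + 2).factorial : ℝ) * y ^ (l + 2)) R := by
  set a : ℕ → ℂ := fun l => (lam (l + 2) / (l + 2).factorial : ℝ) * y ^ (l + 2) with ha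
  have hr : ∀ r ∈ Finset.Icc 1 R, edgeworthPolyHat lam (r + 2) y = ∑ s ∈ Finset.range (R + 1),
      ((∑ l ∈ Finset.Icc 1 R, Polynomial.monomial l (a l)) ^ s).coeff r / (s.factorial : ℂ) := by
    intro r hr
    have hr' := Finset.mem_Icc.1 hr
    have hsub : Finset.range (r + 1) ⊆ Finset.range (R + 1) :=
      Finset.range_subset_range.2 (by omega)
    rw [← Finset.sum_subset hsub]
    · unfold edgeworthPolyHat
      rw [Nat.add_sub_cancel]
      refine Finset.sum_congr rfl fun s _ => ?_
      rw [coeff_pow_eq_of_coeff_eq (r := r) (y := y)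
        (p := ∑ l ∈ Finset.Icc 1 r, Polynomial.monomial l (lam (l + 2) / ((l + 2).factorial : ℝ)))
        _ s r le_rfl]
      · push_cast; ring
      · intro l hl
        rw [coeff_sum_monomial, coeff_sum_monomial]
        by_cases h : 1 ≤ l
        · rw [if_pos (Finset.mem_Icc.2 ⟨h, by omega⟩), if_pos (Finset.mem_Icc.2 ⟨h, hl⟩), ha]
          ring
        · rw [if_neg (by simp [h]), if_neg (by simp [h])]; simp
    · intro s _ hs
      rw [coeff_sum_monomial_pow_of_lt a R (by have := mt Finset.mem_range.2 hs; omega), zero_div]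
  have h0 : ∑ s ∈ Finset.range (R + 1),
      ((∑ l ∈ Finset.Icc 1 R, Polynomial.monomial l (a l)) ^ s).coeff 0 / (s.factorial : ℂ)
      = 1 := by
    rw [Finset.sum_range_succ', Finset.sum_eq_zero, zero_add]
    · simp
    · intro s _
      rw [coeff_sum_monomial_pow_of_lt a R (by omega), zero_div]
  unfold truncExp
  rw [Finset.sum_comm, Finset.range_eq_Ico, Finset.sum_eq_sum_Ico_succ_bot (by omega), zero_add]
  rw [← Finset.range_eq_Ico, h0]
  congr 1
  rw [show Finset.Icc 3 (R + 2) = (Finset.Icc 1 R).image (· + 2) by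
    rw [Finset.image_add_right_Icc], Finset.sum_image (by intro x _ y _ h; simpa using h)]
  rw [show Finset.Ico 1 (R + 1) = Finset.Icc 1 R by rfl]
  exact Finset.sum_congr rfl hr

/-! ### Uniform bounds on the Fourier side -/

/-- A class of centered laws on which the Edgeworth expansion of order `m` is uniform: the
standard deviation is at least `σ`, the absolute moment of order `m + 1` is at most `M`, and the
characteristic function is at most `D / |u|`. -/
structure TameLaw (m : ℕ) (σ M D : ℝ) (ν : Measure ℝ) : Prop where
  prob : IsProbabilityMeasure ν
  integrable : ∀ r ≤ m + 1, Integrable (fun x => x ^ r) ν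
  mean : ∫ x, x ∂ν = 0
  var : σ ^ 2 ≤ ∫ x, x ^ 2 ∂ν
  moment : ∫ x, |x| ^ (m + 1) ∂ν ≤ M
  decay : ∀ u, |u| * ‖charFun ν u‖ ≤ D

/-- The standard deviation of a sum of independent centered variables with laws `ν j`, `j ∈ I`. -/
noncomputable def sumSd (ν : ℕ → Measure ℝ) (I : Finset ℕ) : ℝ := √(∑ j ∈ I, ∫ x, x ^ 2 ∂(ν j))

/-- The cumulants of the normalized sum of independent centered variables with laws `ν j`. -/
noncomputable def sumCumulant (ν : ℕ → Measure ℝ) (I : Finset ℕ) (l : ℕ) : ℝ :=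
  (∑ j ∈ I, cumulantOfMoments (fun r => ∫ x, x ^ r ∂(ν j)) l) / sumSd ν I ^ l

/-- The characteristic function of the normalized sum of independent variables with laws `ν j`. -/
noncomputable def sumCharFun (ν : ℕ → Measure ℝ) (I : Finset ℕ) (ξ : ℝ) : ℂ :=
  ∏ j ∈ I, charFun (ν j) (ξ / sumSd ν I)

/-- The Fourier transform of the Edgeworth approximation with cumulants `lam`. -/
noncomputable def edgeworthHat (lam : ℕ → ℝ) (m : ℕ) (ξ : ℝ) : ℂ :=
  Complex.exp (-(ξ : ℂ) ^ 2 / 2) *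
    (1 + ∑ ν ∈ Finset.Icc 3 m, edgeworthPolyHat lam ν (ξ * Complex.I))

section Bounds

variable {m : ℕ} {σ M D : ℝ} {ν : ℕ → Measure ℝ} {I : Finset ℕ}

theorem TameLaw.moment_two_le {μ : Measure ℝ} (h : TameLaw m σ M D μ) (hm : 3 ≤ m) :
    ∫ x, x ^ 2 ∂μ ≤ 1 + M := by
  have := h.prob
  have := abs_integral_pow_le μ h.integrable h.moment 2 (by omega)
  simpa using this

theorem sumSd_sq : sumSd ν I ^ 2 = ∑ j ∈ I, ∫ x, x ^ 2 ∂(ν j) :=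
  Real.sq_sqrt (Finset.sum_nonneg fun _ _ => integral_nonneg fun _ => by positivity)

theorem sumSd_sq_le (h : ∀ j ∈ I, TameLaw m σ M D (ν j)) (hm : 3 ≤ m) :
    sumSd ν I ^ 2 ≤ I.card * (1 + M) := by
  rw [sumSd_sq]
  exact (Finset.sum_le_card_nsmul _ _ _ fun j hj => (h j hj).moment_two_le hm).trans
    (by rw [nsmul_eq_mul])

theorem le_sumSd (h : ∀ j ∈ I, TameLaw m σ M D (ν j)) {ρ : ℝ}
    (hρ : ρ ^ 8 = I.card) : σ * ρ ^ 4 ≤ sumSd ν I := by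
  refine Real.le_sqrt_of_sq_le ?_
  refine le_trans ?_ (Finset.card_nsmul_le_sum _ _ _ fun j hj => (h j hj).var)
  rw [nsmul_eq_mul, ← hρ]
  exact le_of_eq (by ring)

/-- The normalized cumulant of order `l + 2` is of order `N^{-l/2}`, where `N = ρ^8` is the number
of summands. -/
theorem exists_sumCumulant_le (m : ℕ) (M : ℝ) {σ : ℝ} (hσ : 0 < σ) (hσ1 : σ ≤ 1) :
    ∃ K : ℝ, 1 ≤ K ∧ ∀ (D : ℝ) (ν : ℕ → Measure ℝ) (I : Finset ℕ) (ρ : ℝ),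
      (∀ j ∈ I, TameLaw m σ M D (ν j)) → 1 ≤ ρ → ρ ^ 8 = I.card →
      ∀ l ∈ Finset.Icc 1 (m - 2),
        |sumCumulant ν I (l + 2) / ((l + 2).factorial : ℝ)| ≤ K * (1 / ρ ^ 4) ^ l := by
  obtain ⟨K, hK1, hK⟩ := exists_norm_charFun_mul_exp_sub_one_le m M
  refine ⟨K / σ ^ m, ?_, ?_⟩
  · rw [le_div_iff₀ (by positivity), one_mul]
    exact (pow_le_one₀ hσ.le hσ1).trans hK1
  intro D ν I ρ h hρ1 hρ l hl
  have hl' := Finset.mem_Icc.1 hl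
  have hρ0 : 0 < ρ := by linarith
  have hB := le_sumSd h hρ
  have hB0 : 0 < sumSd ν I := lt_of_lt_of_le (by positivity) hB
  have h1 : |∑ j ∈ I, cumulantOfMoments (fun r => ∫ x, x ^ r ∂(ν j)) (l + 2)| ≤ ρ ^ 8 * K := by
    refine (Finset.abs_sum_le_sum_abs _ _).trans ((Finset.sum_le_card_nsmul _ _ K
      fun j hj => ?_).trans (by rw [nsmul_eq_mul, hρ]))
    have := (h j hj).prob
    exact (hK (ν j) (h j hj).integrable (h j hj).moment).1 (l + 2) (by omega)
  have hf : (1 : ℝ) ≤ (l + 2).factorial := by exact_mod_cast Nat.factorial_pos _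
  rw [abs_div, Nat.abs_cast]
  refine (div_le_self (abs_nonneg _) hf).trans ?_
  unfold sumCumulant
  rw [abs_div, abs_of_pos (pow_pos hB0 _), div_le_iff₀ (by positivity)]
  refine h1.trans ?_
  calc ρ ^ 8 * K = K * 1 * (1 / ρ ^ 4) ^ l * (ρ ^ 4) ^ (l + 2) := by
        rw [pow_add, one_div, inv_pow]; field_simp
    _ ≤ K * (σ ^ (l + 2) / σ ^ m) * (1 / ρ ^ 4) ^ l * (ρ ^ 4) ^ (l + 2) := by
        gcongr
        rw [le_div_iff₀ (by positivity), one_mul]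
        exact pow_le_pow_of_le_one hσ.le hσ1 (by omega)
    _ = K / σ ^ m * (1 / ρ ^ 4) ^ l * (σ * ρ ^ 4) ^ (l + 2) := by rw [mul_pow]; ring
    _ ≤ _ := by gcongr

theorem sum_cumulantPoly (hm : 3 ≤ m) (h : ∀ j ∈ I, TameLaw m σ M D (ν j))
    (hB : 0 < sumSd ν I) (ξ : ℝ) :
    ∑ j ∈ I, cumulantPoly (fun r => ∫ x, x ^ r ∂(ν j)) m (ξ / sumSd ν I) =
      -(ξ : ℂ) ^ 2 / 2 + ∑ l ∈ Finset.Icc 1 (m - 2),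
        (sumCumulant ν I (l + 2) / ((l + 2).factorial : ℝ) : ℝ) * (ξ * Complex.I) ^ (l + 2) := by
  obtain ⟨R, rfl⟩ : ∃ R, m = R + 2 := ⟨m - 2, by omega⟩
  have hB' : (sumSd ν I : ℂ) ≠ 0 := by exact_mod_cast hB.ne'
  have hterm : ∀ r : ℕ, ∑ j ∈ I, (cumulantOfMoments (fun r => ∫ x, x ^ r ∂(ν j)) (r + 1) : ℂ) *
      (((ξ / sumSd ν I : ℝ) : ℂ) * Complex.I) ^ (r + 1) / (r + 1).factorial =
      (sumCumulant ν I (r + 1) / ((r + 1).factorial : ℝ) : ℝ) * (ξ * Complex.I) ^ (r + 1) := by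
    intro r
    unfold sumCumulant
    rw [← Finset.sum_div, ← Finset.sum_mul]
    push_cast
    rw [div_mul_eq_mul_div, div_pow]
    field_simp
  unfold cumulantPoly
  rw [Finset.sum_comm, Finset.sum_congr rfl fun r _ => hterm r, Finset.sum_range_succ',
    Finset.sum_range_succ']
  have h1 : sumCumulant ν I (0 + 1) = 0 := by
    unfold sumCumulant
    rw [Finset.sum_eq_zero, zero_div]
    intro j hj
    rw [zero_add, cumulantOfMoments_one]
    simpa using (h j hj).mean
  have h2 : sumCumulant ν I (0 + 1 + 1) = 1 := by
    unfold sumCumulant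
    rw [zero_add, one_add_one_eq_two, sumSd_sq, ← sumSd_sq,
      Finset.sum_congr rfl fun j hj => cumulantOfMoments_two
        (fun r => ∫ x, x ^ r ∂(ν j)) (by simpa using (h j hj).mean), ← sumSd_sq]
    exact div_self (by positivity)
  rw [h1, h2, Nat.add_sub_cancel, show Finset.Icc 1 R = Finset.Ico 1 (R + 1) by rfl,
    Finset.sum_Ico_eq_sum_range, Nat.add_sub_cancel]
  have h3 : (ξ * Complex.I) ^ (0 + 1 + 1) = -(ξ : ℂ) ^ 2 := by
    rw [zero_add, one_add_one_eq_two, mul_pow, Complex.I_sq]; ring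
  rw [h3]
  have h4 : ∀ k ∈ Finset.range R, ((sumCumulant ν I (k + 1 + 1 + 1) /
      ((k + 1 + 1 + 1).factorial : ℝ) : ℝ) : ℂ) * (ξ * Complex.I) ^ (k + 1 + 1 + 1) =
      ((sumCumulant ν I (1 + k + 2) / ((1 + k + 2).factorial : ℝ) : ℝ) : ℂ) *
        (ξ * Complex.I) ^ (1 + k + 2) := fun k _ => by
    rw [show k + 1 + 1 + 1 = 1 + k + 2 by ring]
  rw [Finset.sum_congr rfl h4]
  simp [Nat.factorial]
  ring

theorem norm_cumulant_term_le {lam : ℕ → ℝ} {K η : ℝ} (hK : 1 ≤ K) (hη : 0 ≤ η)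
    (h : ∀ l ∈ Finset.Icc 1 (m - 2), |lam (l + 2) / ((l + 2).factorial : ℝ)| ≤ K * η ^ l) (ξ : ℝ) :
    ∀ l ∈ Finset.Icc 1 (m - 2),
      ‖((lam (l + 2) / ((l + 2).factorial : ℝ) : ℝ) : ℂ) * (ξ * Complex.I) ^ (l + 2)‖
        ≤ K * (1 + |ξ|) ^ m * η ^ l := by
  intro l hl
  have hl' := Finset.mem_Icc.1 hl
  rw [norm_mul, norm_pow, norm_mul, Complex.norm_I, mul_one, Complex.norm_real, Complex.norm_real,
    Real.norm_eq_abs, Real.norm_eq_abs]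
  have h2 : |ξ| ^ (l + 2) ≤ (1 + |ξ|) ^ m := by
    have := abs_nonneg ξ
    calc |ξ| ^ (l + 2) ≤ (1 + |ξ|) ^ (l + 2) := by gcongr; linarith
      _ ≤ _ := pow_le_pow_right₀ (by linarith) (by omega)
  calc _ ≤ (K * η ^ l) * (1 + |ξ|) ^ m := by gcongr; exact h l hl
    _ = _ := by ring

theorem edgeworthHat_eq (lam : ℕ → ℝ) (hm : 3 ≤ m) (ξ : ℝ) :
    edgeworthHat lam m ξ = Complex.exp (-(ξ : ℂ) ^ 2 / 2) *
      truncExp (fun l => (lam (l + 2) / ((l + 2).factorial : ℝ) : ℝ) * (ξ * Complex.I) ^ (l + 2))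
        (m - 2) := by
  rw [← one_add_sum_edgeworthPolyHat, Nat.sub_add_cancel (by omega)]
  rfl

theorem norm_exp_neg_sq_div_two (ξ : ℝ) :
    ‖Complex.exp (-(ξ : ℂ) ^ 2 / 2)‖ = Real.exp (-ξ ^ 2 / 2) := by
  rw [Complex.norm_exp]
  congr 1
  norm_cast

theorem norm_edgeworthHat_le {lam : ℕ → ℝ} {K η : ℝ} (hm : 3 ≤ m) (hK : 1 ≤ K) (hη : 0 ≤ η)
    (hη1 : η ≤ 1)
    (h : ∀ l ∈ Finset.Icc 1 (m - 2), |lam (l + 2) / ((l + 2).factorial : ℝ)| ≤ K * η ^ l) (ξ : ℝ) :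
    ‖edgeworthHat lam m ξ‖ ≤ (m * m * m ^ m * K ^ m) * (1 + |ξ|) ^ (m * m) *
      Real.exp (-ξ ^ 2 / 2) := by
  have h0 := abs_nonneg ξ
  have h1 : 1 ≤ K * (1 + |ξ|) ^ m := by
    have : 1 ≤ (1 + |ξ|) ^ m := one_le_pow₀ (by linarith)
    nlinarith
  have h2 := norm_truncExp_le (R := m - 2) h1 (fun l hl =>
    (norm_cumulant_term_le hK hη h ξ l hl).trans (mul_le_of_le_one_right (by positivity)
      (pow_le_one₀ hη hη1)))
  rw [edgeworthHat_eq _ hm, norm_mul, norm_exp_neg_sq_div_two, mul_comm]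
  gcongr
  refine h2.trans ?_
  have hR : ((m - 2 : ℕ) : ℝ) + 1 ≤ m := by
    rw [Nat.cast_sub (by omega)]; push_cast; linarith
  have hm1 : (1 : ℝ) ≤ m := by exact_mod_cast (by omega : 1 ≤ m)
  calc _ ≤ ((m : ℝ) * m * m ^ (m - 2)) * (K * (1 + |ξ|) ^ m) ^ (m - 2) := by gcongr
    _ ≤ ((m : ℝ) * m * m ^ m) * (K * (1 + |ξ|) ^ m) ^ m := by
        gcongr
        · exact Nat.sub_le _ _
        · exact Nat.sub_le _ _
    _ = _ := by rw [mul_pow, ← pow_mul]; ring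

set_option maxHeartbeats 1000000 in
/-- The expansion for `|ξ| ≤ N^{1/8}`. The exponent `1/8` is small enough for the sum of the
cumulant terms, and for the sum of the errors of the local expansions, to remain bounded. -/
theorem exists_norm_sumCharFun_sub_le_of_abs_le (hm : 3 ≤ m) (M : ℝ) {σ : ℝ} (hσ : 0 < σ)
    (hσ1 : σ ≤ 1) :
    ∃ K : ℝ, 1 ≤ K ∧ ∀ (D : ℝ) (ν : ℕ → Measure ℝ) (I : Finset ℕ) (ρ : ℝ),
      (∀ j ∈ I, TameLaw m σ M D (ν j)) → 1 ≤ ρ → ρ ^ 8 = I.card → ρ ≤ sumSd ν I →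
      ∀ ξ : ℝ, |ξ| ≤ ρ → ‖sumCharFun ν I ξ - edgeworthHat (sumCumulant ν I) m ξ‖ ≤
        K * (1 / ρ ^ 4) ^ (m - 1) * (1 + |ξ|) ^ (m * m) * Real.exp (-ξ ^ 2 / 2) := by
  obtain ⟨K1, hK1, hK⟩ := exists_norm_charFun_mul_exp_sub_one_le m M
  obtain ⟨K2, hK2, hlam⟩ := exists_sumCumulant_le m M hσ hσ1
  set K3 := K1 / σ ^ (m + 1) with hK3
  have hK30 : 0 < K3 := by positivity
  set R := m - 2 with hR
  set C : ℝ := (R : ℝ) ^ (R + 1) + (R + 1) * (R * R + 1) * (R * R + 1) ^ R with hC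
  have hC0 : 0 ≤ C := by positivity
  refine ⟨1 + Real.exp (R * K2) * (K3 * Real.exp K3) + C * K2 ^ (R + 1) * Real.exp (R * K2),
    ?_, ?_⟩
  · have : 0 ≤ Real.exp (R * K2) * (K3 * Real.exp K3) + C * K2 ^ (R + 1) * Real.exp (R * K2) := by
      positivity
    linarith
  intro D ν I ρ h hρ1 hρ hρB ξ hξ
  have hρ0 : 0 < ρ := by linarith
  have hB0 : 0 < sumSd ν I := by linarith
  have hBσ := le_sumSd h hρ
  set B := sumSd ν I with hBd
  set η : ℝ := 1 / ρ ^ 4 with hη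
  have hη0 : 0 < η := by positivity
  have hη1 : η ≤ 1 := by
    rw [hη, div_le_one (by positivity)]; exact one_le_pow₀ hρ1
  have hla := hlam D ν I ρ h hρ1 hρ
  set a : ℕ → ℂ := fun l => ((sumCumulant ν I (l + 2) / ((l + 2).factorial : ℝ) : ℝ) : ℂ) *
    (ξ * Complex.I) ^ (l + 2) with ha
  set W := ∑ l ∈ Finset.Icc 1 R, a l with hW
  have h0 := abs_nonneg ξ
  have hu : |ξ / B| ≤ 1 := by
    rw [abs_div, abs_of_pos hB0, div_le_one hB0]; linarith
  -- the exponent is bounded on this range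
  have hWb : ‖W‖ ≤ R * K2 := by
    refine (norm_sum_le_of_le _ (n := fun _ => K2) fun l hl => ?_).trans (by simp)
    have hl1 := (Finset.mem_Icc.1 hl).1
    rw [ha]
    simp only
    rw [norm_mul, norm_pow, norm_mul, Complex.norm_I, mul_one, Complex.norm_real,
      Complex.norm_real, Real.norm_eq_abs, Real.norm_eq_abs]
    calc _ ≤ (K2 * η ^ l) * ρ ^ (l + 2) := by gcongr; exact hla l hl
      _ = K2 * (ρ ^ (l + 2) / ρ ^ (4 * l)) := by
          rw [hη, div_pow, one_pow, ← pow_mul]; ring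
      _ ≤ K2 * 1 := by
          gcongr
          rw [div_le_one (by positivity)]
          exact pow_le_pow_right₀ hρ1 (by omega)
      _ = K2 := mul_one _
  -- the product of the local expansions
  set E : ℝ := ∑ j ∈ I, ‖charFun (ν j) (ξ / B) *
    Complex.exp (-cumulantPoly (fun r => ∫ x, x ^ r ∂(ν j)) m (ξ / B)) - 1‖ with hE
  have hE0 : 0 ≤ E := Finset.sum_nonneg fun _ _ => norm_nonneg _
  have hpow : |ξ / B| ^ (m + 1) * ρ ^ 8 ≤ (1 / σ ^ (m + 1)) * (η ^ (m - 1) * |ξ| ^ (m + 1)) := by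
    have h1 : |ξ / B| ≤ |ξ| / (σ * ρ ^ 4) := by
      rw [abs_div, abs_of_pos hB0]; gcongr
    calc |ξ / B| ^ (m + 1) * ρ ^ 8 ≤ (|ξ| / (σ * ρ ^ 4)) ^ (m + 1) * ρ ^ 8 := by gcongr
      _ = _ := by
        rw [div_pow, mul_pow, hη, div_pow, one_pow,
          show (ρ ^ 4) ^ (m + 1) = (ρ ^ 4) ^ (m - 1) * ρ ^ 8 by
            rw [← pow_mul, ← pow_mul, ← pow_add]; congr 1; omega]
        field_simp
  have hE1 : E ≤ K3 * (η ^ (m - 1) * |ξ| ^ (m + 1)) := by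
    refine (Finset.sum_le_card_nsmul _ _ (K1 * |ξ / B| ^ (m + 1)) fun j hj => ?_).trans ?_
    · have := (h j hj).prob
      exact (hK (ν j) (h j hj).integrable (h j hj).moment).2 (ξ / B) hu
    · rw [nsmul_eq_mul, ← hρ]
      calc ρ ^ 8 * (K1 * |ξ / B| ^ (m + 1)) = K1 * (|ξ / B| ^ (m + 1) * ρ ^ 8) := by ring
        _ ≤ K1 * ((1 / σ ^ (m + 1)) * (η ^ (m - 1) * |ξ| ^ (m + 1))) := by gcongr
        _ = _ := by rw [hK3]; ring
  have hE2 : E ≤ K3 := by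
    refine hE1.trans (mul_le_of_le_one_right hK30.le ?_)
    calc η ^ (m - 1) * |ξ| ^ (m + 1) ≤ η ^ (m - 1) * ρ ^ (m + 1) := by gcongr
      _ = ρ ^ (m + 1) / ρ ^ (4 * (m - 1)) := by
          rw [hη, div_pow, one_pow, ← pow_mul]; ring
      _ ≤ 1 := by
          rw [div_le_one (by positivity)]
          exact pow_le_pow_right₀ hρ1 (by omega)
  have hprod : ‖∏ j ∈ I, (charFun (ν j) (ξ / B) *
      Complex.exp (-cumulantPoly (fun r => ∫ x, x ^ r ∂(ν j)) m (ξ / B))) - 1‖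
        ≤ K3 * Real.exp K3 * (η ^ (m - 1) * |ξ| ^ (m + 1)) := by
    have h1 := Finset.norm_prod_one_add_sub_one_le I (fun j => charFun (ν j) (ξ / B) *
      Complex.exp (-cumulantPoly (fun r => ∫ x, x ^ r ∂(ν j)) m (ξ / B)) - 1)
    simp only [add_sub_cancel] at h1
    refine h1.trans ?_
    rw [← hE]
    have h2 : Real.exp E - 1 ≤ E * Real.exp E := by
      have := Real.add_one_le_exp (-E)
      have h3 : Real.exp (-E) * Real.exp E = 1 := by rw [← Real.exp_add]; simp
      nlinarith [Real.exp_pos E]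
    calc _ ≤ E * Real.exp E := h2
      _ ≤ (K3 * (η ^ (m - 1) * |ξ| ^ (m + 1))) * Real.exp K3 := by gcongr
      _ = _ := by ring
  have hfact : sumCharFun ν I ξ = Complex.exp (-(ξ : ℂ) ^ 2 / 2) * (Complex.exp W *
      ∏ j ∈ I, (charFun (ν j) (ξ / B) *
      Complex.exp (-cumulantPoly (fun r => ∫ x, x ^ r ∂(ν j)) m (ξ / B)))) := by
    rw [Finset.prod_mul_distrib, ← Complex.exp_sum, Finset.sum_neg_distrib,
      sum_cumulantPoly hm h hB0 ξ, ← mul_assoc, ← Complex.exp_add, mul_left_comm,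
      ← Complex.exp_add, add_neg_cancel, Complex.exp_zero, mul_one]
    rfl
  have hT1 : 1 ≤ K2 * (1 + |ξ|) ^ m := by
    have : 1 ≤ (1 + |ξ|) ^ m := one_le_pow₀ (by linarith)
    nlinarith
  have htr := norm_exp_sub_truncExp_le (R := R) hT1 hη0.le hη1
    (norm_cumulant_term_le hK2 hη0.le hla ξ)
  rw [hfact, edgeworthHat_eq _ hm, ← mul_sub, norm_mul, norm_exp_neg_sq_div_two, mul_comm]
  gcongr
  rw [show ∀ P : ℂ, Complex.exp W * P - truncExp a R =
    Complex.exp W * (P - 1) + (Complex.exp W - truncExp a R) by intro P; ring]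
  have hexpW : ‖Complex.exp W‖ ≤ Real.exp (R * K2) :=
    (Complex.norm_exp_le_exp_norm _).trans (Real.exp_le_exp.2 hWb)
  have hRm : R + 1 = m - 1 := by omega
  have hone : (1 : ℝ) ≤ 1 + |ξ| := by linarith
  have hp1 : |ξ| ^ (m + 1) ≤ (1 + |ξ|) ^ (m * m) := by
    calc |ξ| ^ (m + 1) ≤ (1 + |ξ|) ^ (m + 1) := by gcongr; linarith
      _ ≤ _ := pow_le_pow_right₀ hone (by nlinarith)
  have hp2 : ((1 + |ξ|) ^ m) ^ (R + 1) ≤ (1 + |ξ|) ^ (m * m) := by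
    rw [← pow_mul]
    exact pow_le_pow_right₀ hone (Nat.mul_le_mul_left _ (by omega))
  have hf1 : ‖Complex.exp W * (∏ j ∈ I, (charFun (ν j) (ξ / B) *
      Complex.exp (-cumulantPoly (fun r => ∫ x, x ^ r ∂(ν j)) m (ξ / B))) - 1)‖ ≤
      Real.exp (R * K2) * (K3 * Real.exp K3) * (η ^ (m - 1) * (1 + |ξ|) ^ (m * m)) := by
    rw [norm_mul]
    calc _ ≤ Real.exp (R * K2) * (K3 * Real.exp K3 * (η ^ (m - 1) * |ξ| ^ (m + 1))) := by gcongr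
      _ ≤ Real.exp (R * K2) * (K3 * Real.exp K3 * (η ^ (m - 1) * (1 + |ξ|) ^ (m * m))) := by
          gcongr
      _ = _ := by ring
  have hf2 : ‖Complex.exp W - truncExp a R‖ ≤
      C * K2 ^ (R + 1) * Real.exp (R * K2) * (η ^ (m - 1) * (1 + |ξ|) ^ (m * m)) := by
    refine htr.trans ?_
    rw [mul_pow, mul_pow, ← hC, ← hRm]
    calc C * (K2 ^ (R + 1) * ((1 + |ξ|) ^ m) ^ (R + 1) * η ^ (R + 1)) * Real.exp ‖W‖
        ≤ C * (K2 ^ (R + 1) * (1 + |ξ|) ^ (m * m) * η ^ (R + 1)) * Real.exp (R * K2) := by gcongr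
      _ = _ := by ring
  refine (norm_add_le _ _).trans ((add_le_add hf1 hf2).trans ?_)
  have hf3 : 0 ≤ η ^ (m - 1) * (1 + |ξ|) ^ (m * m) := by positivity
  nlinarith

end Bounds

/-! ### The Edgeworth expansion on the Fourier side -/

section Bounds

variable {m : ℕ} {σ M D : ℝ} {ν : ℕ → Measure ℝ} {I : Finset ℕ}

theorem norm_sumCharFun_le_exp (hm : 3 ≤ m) (hM : 0 ≤ M) (hD : 0 < D)
    (h : ∀ j ∈ I, TameLaw m σ M D (ν j)) (hB : 0 < sumSd ν I) {ξ : ℝ}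
    (hξ : |ξ| ≤ 2 * D * sumSd ν I) :
    ‖sumCharFun ν I ξ‖ ≤ Real.exp (-(3 / (128 * D ^ 2 * (1 + M))) * ξ ^ 2) := by
  have h1 : |ξ / sumSd ν I| ≤ 2 * D := by
    rw [abs_div, abs_of_pos hB, div_le_iff₀ hB]; exact hξ
  unfold sumCharFun
  rw [norm_prod]
  refine (Finset.prod_le_prod (g := fun _ => Real.exp (-(3 / (128 * D ^ 2)) *
    (ξ / sumSd ν I) ^ 2)) (fun _ _ => norm_nonneg _) fun j hj => ?_).trans
    ((Finset.prod_const _).le.trans ?_)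
  · have := (h j hj).prob
    exact norm_charFun_le_exp (ν j) hD (h j hj).decay h1
  · rw [← Real.exp_nat_mul]
    refine Real.exp_le_exp.2 ?_
    have h2 := sumSd_sq_le h hm
    have h3 : 1 / (1 + M) ≤ I.card / sumSd ν I ^ 2 := by
      rw [div_le_div_iff₀ (by positivity) (by positivity)]; linarith
    calc (I.card : ℝ) * (-(3 / (128 * D ^ 2)) * (ξ / sumSd ν I) ^ 2)
        = -(3 / (128 * D ^ 2) * ξ ^ 2 * (I.card / sumSd ν I ^ 2)) := by
          rw [div_pow]; ring
      _ ≤ -(3 / (128 * D ^ 2) * ξ ^ 2 * (1 / (1 + M))) := by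
          apply neg_le_neg; gcongr
      _ = _ := by field_simp

theorem norm_sumCharFun_le_pow (h : ∀ j ∈ I, TameLaw m σ M D (ν j)) (hB : 0 < sumSd ν I) {ξ : ℝ}
    (hξ : 0 < |ξ|) :
    ‖sumCharFun ν I ξ‖ ≤ (D * sumSd ν I / |ξ|) ^ I.card := by
  unfold sumCharFun
  rw [norm_prod]
  refine (Finset.prod_le_prod (fun _ _ => norm_nonneg _) fun j hj => ?_).trans
    (Finset.prod_const _).le
  have h1 := (h j hj).decay (ξ / sumSd ν I)
  rw [abs_div, abs_of_pos hB] at h1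
  rw [le_div_iff₀ hξ]
  calc ‖charFun (ν j) (ξ / sumSd ν I)‖ * |ξ|
      = (|ξ| / sumSd ν I * ‖charFun (ν j) (ξ / sumSd ν I)‖) * sumSd ν I := by field_simp
    _ ≤ _ := by gcongr

theorem exists_pow_div_two_pow_le (k : ℕ) : ∃ K : ℝ, 0 ≤ K ∧ ∀ n : ℕ, (n : ℝ) ^ k / 2 ^ n ≤ K := by
  obtain ⟨K, hK⟩ := (tendsto_pow_const_div_const_pow_of_one_lt k one_lt_two).bddAbove_range
  have hK' : ∀ n : ℕ, (n : ℝ) ^ k / 2 ^ n ≤ K := fun n => hK ⟨n, rfl⟩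
  exact ⟨K, le_trans (by positivity) (hK' 0), hK'⟩

/-- In the tail `|ξ| > 2 D B` each factor is at most `1 / 2`, so that the product is exponentially
small; two of the factors are kept as `D B / |ξ|` for the integrability in `ξ`. -/
theorem exists_norm_sumCharFun_le_of_lt_abs (hm : 3 ≤ m) (hM : 0 ≤ M) (hD : 0 < D) :
    ∃ K : ℝ, 0 ≤ K ∧ ∀ (σ : ℝ) (ν : ℕ → Measure ℝ) (I : Finset ℕ) (ρ : ℝ),
      (∀ j ∈ I, TameLaw m σ M D (ν j)) → 1 ≤ ρ → ρ ^ 8 = I.card → 0 < sumSd ν I →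
      1 ≤ 2 * D * sumSd ν I → 2 ≤ I.card →
      ∀ ξ : ℝ, 2 * D * sumSd ν I < |ξ| → ‖sumCharFun ν I ξ‖ ≤
        K * (1 / ρ ^ 4) ^ (m - 1) * (1 / (1 + ξ ^ 2)) := by
  obtain ⟨K, hK0, hK⟩ := exists_pow_div_two_pow_le (m + 1)
  refine ⟨8 * D ^ 2 * (1 + M) * K, by positivity, ?_⟩
  intro σ ν I ρ h hρ1 hρ hB hDB hI ξ hξ
  set B := sumSd ν I
  have hξ0 : 0 < |ξ| := by linarith
  have h1 := norm_sumCharFun_le_pow h hB hξ0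
  set v := D * B / |ξ| with hv
  have hv0 : 0 ≤ v := by positivity
  have hv1 : v ≤ 1 / 2 := by rw [hv, div_le_iff₀ hξ0]; linarith
  have hN : (I.card : ℝ) = ρ ^ 8 := hρ.symm
  have hη : (I.card : ℝ) / 2 ^ I.card ≤ K * (1 / ρ ^ 4) ^ (m - 1) := by
    have h2 := hK I.card
    have h3 : ρ ^ (4 * (m - 1)) ≤ (I.card : ℝ) ^ m := by
      rw [hN, ← pow_mul]; exact pow_le_pow_right₀ hρ1 (by omega)
    rw [one_div, inv_pow, ← pow_mul, ← div_eq_mul_inv, le_div_iff₀ (by positivity)]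
    calc (I.card : ℝ) / 2 ^ I.card * ρ ^ (4 * (m - 1))
        ≤ (I.card : ℝ) / 2 ^ I.card * (I.card : ℝ) ^ m := by gcongr
      _ = (I.card : ℝ) ^ (m + 1) / 2 ^ I.card := by rw [pow_succ]; ring
      _ ≤ K := h2
  have hB2 := sumSd_sq_le h hm
  refine h1.trans ?_
  obtain ⟨k, hk⟩ : ∃ k, I.card = k + 2 := ⟨I.card - 2, by omega⟩
  have h4 : v ^ I.card ≤ 4 * (1 / 2 ^ I.card) * v ^ 2 := by
    rw [hk, pow_add, pow_add]
    calc v ^ k * v ^ 2 ≤ (1 / 2) ^ k * v ^ 2 := by gcongr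
      _ = _ := by rw [one_div, inv_pow]; field_simp; norm_num
  have hξ1 : 1 ≤ ξ ^ 2 := by rw [← sq_abs]; exact one_le_pow₀ (by linarith)
  have h5 : v ^ 2 ≤ D ^ 2 * (I.card * (1 + M)) * (2 * (1 / (1 + ξ ^ 2))) := by
    rw [hv, div_pow, sq_abs, mul_pow, mul_one_div, div_eq_mul_one_div]
    have h6 : 1 / ξ ^ 2 ≤ 2 / (1 + ξ ^ 2) := by
      rw [div_le_div_iff₀ (by positivity) (by positivity)]; linarith
    gcongr
  refine h4.trans ?_
  calc 4 * (1 / 2 ^ I.card) * v ^ 2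
      ≤ 4 * (1 / 2 ^ I.card) * (D ^ 2 * (I.card * (1 + M)) * (2 * (1 / (1 + ξ ^ 2)))) := by gcongr
    _ = 8 * D ^ 2 * (1 + M) * ((I.card : ℝ) / 2 ^ I.card) * (1 / (1 + ξ ^ 2)) := by ring
    _ ≤ 8 * D ^ 2 * (1 + M) * (K * (1 / ρ ^ 4) ^ (m - 1)) * (1 / (1 + ξ ^ 2)) := by gcongr
    _ = _ := by ring

/-- The dominating function on the Fourier side. -/
noncomputable def fourierMajorant (Q : ℕ) (c : ℝ) (ξ : ℝ) : ℝ :=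
  (1 + |ξ|) ^ Q * Real.exp (-c * ξ ^ 2) + 1 / (1 + ξ ^ 2)

theorem integrable_one_add_abs_pow_mul_exp (Q : ℕ) {c : ℝ} (hc : 0 < c) :
    Integrable (fun ξ : ℝ => (1 + |ξ|) ^ Q * Real.exp (-c * ξ ^ 2)) := by
  have h1 : ∀ k : ℕ, Integrable (fun ξ : ℝ => |ξ| ^ k * Real.exp (-c * ξ ^ 2)) := by
    intro k
    have := (integrable_rpow_mul_exp_neg_mul_sq hc (s := k)
      (by linarith [(Nat.cast_nonneg k : (0 : ℝ) ≤ k)])).norm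
    refine this.congr (ae_of_all _ fun x => ?_)
    simp [abs_of_pos (Real.exp_pos _)]
  have h2 : (fun ξ : ℝ => (1 + |ξ|) ^ Q * Real.exp (-c * ξ ^ 2)) = fun ξ =>
      ∑ k ∈ Finset.range (Q + 1), (Q.choose k : ℝ) * (|ξ| ^ k * Real.exp (-c * ξ ^ 2)) := by
    ext ξ
    rw [add_comm, add_pow, Finset.sum_mul]
    refine Finset.sum_congr rfl fun k _ => ?_
    rw [one_pow]; ring
  rw [h2]
  exact integrable_finsetSum _ fun k _ => (h1 k).const_mul _

theorem integrable_fourierMajorant (Q : ℕ) {c : ℝ} (hc : 0 < c) :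
    Integrable (fourierMajorant Q c) := by
  refine (integrable_one_add_abs_pow_mul_exp Q hc).add ?_
  simpa only [one_div] using integrable_inv_one_add_sq

theorem continuous_edgeworthHat (lam : ℕ → ℝ) (m : ℕ) : Continuous (edgeworthHat lam m) := by
  unfold edgeworthHat edgeworthPolyHat
  fun_prop

theorem integrable_edgeworthHat (lam : ℕ → ℝ) (hm : 3 ≤ m) : Integrable (edgeworthHat lam m) := by
  set K : ℝ := 1 + ∑ l ∈ Finset.Icc 1 (m - 2), |lam (l + 2) / ((l + 2).factorial : ℝ)| with hK
  have hS : 0 ≤ ∑ l ∈ Finset.Icc 1 (m - 2), |lam (l + 2) / ((l + 2).factorial : ℝ)| :=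
    Finset.sum_nonneg fun _ _ => abs_nonneg _
  have h := norm_edgeworthHat_le (K := K) (η := 1) hm (by linarith) zero_le_one le_rfl
    (lam := lam) fun l hl => by
      rw [one_pow, mul_one, hK]
      have := Finset.single_le_sum (f := fun l => |lam (l + 2) / ((l + 2).factorial : ℝ)|)
        (fun _ _ => abs_nonneg _) hl
      linarith
  refine ((integrable_one_add_abs_pow_mul_exp (m * m) (c := 1 / 2) (by norm_num)).const_mul
    (m * m * m ^ m * K ^ m)).mono' (continuous_edgeworthHat lam m).aestronglyMeasurable
    (ae_of_all _ fun ξ => (h ξ).trans (le_of_eq ?_))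
  rw [mul_assoc, show -ξ ^ 2 / 2 = -(1 / 2) * ξ ^ 2 by ring]

/-- The pointwise bound for all frequencies. -/
theorem exists_norm_sumCharFun_sub_le (hm : 3 ≤ m) (hM : 0 ≤ M) (hD : 0 < D) (hσ : 0 < σ)
    (hσ1 : σ ≤ 1) :
    ∃ K c ρ₀ : ℝ, 0 ≤ K ∧ 0 < c ∧ 0 ≤ ρ₀ ∧ ∀ (ν : ℕ → Measure ℝ) (I : Finset ℕ) (ρ : ℝ),
      (∀ j ∈ I, TameLaw m σ M D (ν j)) → ρ₀ ≤ ρ → ρ ^ 8 = I.card →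
      0 < sumSd ν I ∧ ∀ ξ : ℝ, ‖sumCharFun ν I ξ - edgeworthHat (sumCumulant ν I) m ξ‖ ≤
        K * (1 / ρ ^ 4) ^ (m - 1) * fourierMajorant (m * m + 4 * (m - 1)) c ξ := by
  obtain ⟨K1, hK1, hcentral⟩ := exists_norm_sumCharFun_sub_le_of_abs_le hm M hσ hσ1
  obtain ⟨K2, hK2, htail⟩ := exists_norm_sumCharFun_le_of_lt_abs (D := D) hm hM hD
  obtain ⟨K3, hK3, hlam⟩ := exists_sumCumulant_le m M hσ hσ1
  set K4 : ℝ := m * m * m ^ m * K3 ^ m with hK4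
  have hK40 : 0 ≤ K4 := by positivity
  set c : ℝ := min (1 / 2) (3 / (128 * D ^ 2 * (1 + M))) with hc
  have hc0 : 0 < c := lt_min (by norm_num) (by positivity)
  refine ⟨K1 + K2 + K4 + 1, c, 2 + 1 / σ + 1 / (2 * D * σ), by positivity, hc0, by positivity, ?_⟩
  intro ν I ρ h hρ0 hρ
  have hs1 : 0 < 1 / σ := by positivity
  have hs2 : 0 < 1 / (2 * D * σ) := by positivity
  have hρ2 : 2 ≤ ρ := by linarith
  have hρ1 : 1 ≤ ρ := by linarith
  have hρp : 0 < ρ := by linarith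
  have hBσ := le_sumSd h hρ
  have hB0 : 0 < sumSd ν I := lt_of_lt_of_le (by positivity) hBσ
  refine ⟨hB0, fun ξ => ?_⟩
  have hρ4 : ρ ≤ ρ ^ 4 := le_self_pow₀ hρ1 (by norm_num)
  have hρB : ρ ≤ sumSd ν I := by
    refine le_trans ?_ hBσ
    have h1 : 1 ≤ σ * ρ := by
      rw [← div_le_iff₀' hσ]; linarith
    have h2 : 1 ≤ ρ ^ 2 := one_le_pow₀ hρ1
    calc ρ ≤ ρ * (σ * ρ) * ρ ^ 2 := by
          have : ρ ≤ ρ * (σ * ρ) := le_mul_of_one_le_right hρp.le h1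
          exact this.trans (le_mul_of_one_le_right (by positivity) h2)
      _ = σ * ρ ^ 4 := by ring
  have hDB : 1 ≤ 2 * D * sumSd ν I := by
    have h1 : 1 ≤ 2 * D * σ * ρ := by
      rw [← div_le_iff₀' (by positivity)]; linarith
    calc (1 : ℝ) ≤ 2 * D * σ * ρ := h1
      _ ≤ 2 * D * σ * ρ ^ 4 := by gcongr
      _ = 2 * D * (σ * ρ ^ 4) := by ring
      _ ≤ _ := by gcongr
  have hcard : 2 ≤ I.card := by
    have : (2 : ℝ) ≤ I.card := by
      rw [← hρ]; exact hρ2.trans (le_self_pow₀ hρ1 (by norm_num))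
    exact_mod_cast this
  set η : ℝ := 1 / ρ ^ 4 with hη
  have hη0 : 0 < η := by positivity
  have hη1 : η ≤ 1 := by rw [hη, div_le_one (by positivity)]; exact one_le_pow₀ hρ1
  set Q := m * m + 4 * (m - 1) with hQ
  have h0 := abs_nonneg ξ
  have hone : (1 : ℝ) ≤ 1 + |ξ| := by linarith
  have hG1 : (1 + |ξ|) ^ (m * m) * Real.exp (-ξ ^ 2 / 2) ≤ fourierMajorant Q c ξ := by
    unfold fourierMajorant
    have : 0 ≤ 1 / (1 + ξ ^ 2) := by positivity
    have h1 : (1 + |ξ|) ^ (m * m) * Real.exp (-ξ ^ 2 / 2)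
        ≤ (1 + |ξ|) ^ Q * Real.exp (-c * ξ ^ 2) := by
      gcongr ?_ * Real.exp ?_
      · exact pow_le_pow_right₀ hone (by omega)
      · have := min_le_left (1 / 2 : ℝ) (3 / (128 * D ^ 2 * (1 + M)))
        nlinarith [sq_nonneg ξ]
    linarith
  rcases le_total |ξ| ρ with hξ | hξ
  · refine (hcentral D ν I ρ h hρ1 hρ hρB ξ hξ).trans ?_
    rw [mul_assoc]
    gcongr
    linarith
  -- away from the centre, `1 ≤ (|ξ| / ρ) ^ (4 (m - 1))` produces the powers of `N`
  have hgain : 1 ≤ η ^ (m - 1) * (1 + |ξ|) ^ (4 * (m - 1)) := by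
    rw [hη, one_div, inv_pow, ← pow_mul, ← div_eq_inv_mul, one_le_div (by positivity)]
    gcongr
    linarith
  have hfar : ∀ c' : ℝ, c ≤ c' → (1 + |ξ|) ^ (m * m) * Real.exp (-c' * ξ ^ 2) ≤
      η ^ (m - 1) * ((1 + |ξ|) ^ Q * Real.exp (-c * ξ ^ 2)) := by
    intro c' hcc
    calc (1 + |ξ|) ^ (m * m) * Real.exp (-c' * ξ ^ 2)
        ≤ (1 + |ξ|) ^ (m * m) * Real.exp (-c * ξ ^ 2) := by gcongr
      _ ≤ (η ^ (m - 1) * (1 + |ξ|) ^ (4 * (m - 1))) *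
          ((1 + |ξ|) ^ (m * m) * Real.exp (-c * ξ ^ 2)) :=
          le_mul_of_one_le_left (by positivity) hgain
      _ = _ := by rw [hQ, pow_add]; ring
  have hhat : ‖edgeworthHat (sumCumulant ν I) m ξ‖ ≤
      K4 * (η ^ (m - 1) * ((1 + |ξ|) ^ Q * Real.exp (-c * ξ ^ 2))) := by
    refine (norm_edgeworthHat_le hm hK3 hη0.le hη1 (hlam D ν I ρ h hρ1 hρ) ξ).trans ?_
    rw [mul_assoc]
    have := hfar (1 / 2) (min_le_left _ _)
    rw [show -(1 / 2) * ξ ^ 2 = -ξ ^ 2 / 2 by ring] at this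
    gcongr
  have hE1 : 0 ≤ (1 + |ξ|) ^ Q * Real.exp (-c * ξ ^ 2) := by positivity
  have hE2 : 0 ≤ 1 / (1 + ξ ^ 2) := by positivity
  have hηm : 0 ≤ η ^ (m - 1) := by positivity
  have hΦ : ‖sumCharFun ν I ξ‖ ≤ (K2 + 1) * η ^ (m - 1) * fourierMajorant Q c ξ := by
    unfold fourierMajorant
    rcases le_or_gt |ξ| (2 * D * sumSd ν I) with hξ2 | hξ2
    · have h1 := norm_sumCharFun_le_exp hm hM hD h hB0 hξ2
      have h2 := hfar _ (min_le_right (1 / 2 : ℝ) (3 / (128 * D ^ 2 * (1 + M))))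
      have h3 : 1 ≤ (1 + |ξ|) ^ (m * m) := one_le_pow₀ hone
      have h4 : Real.exp (-(3 / (128 * D ^ 2 * (1 + M))) * ξ ^ 2) ≤
          η ^ (m - 1) * ((1 + |ξ|) ^ Q * Real.exp (-c * ξ ^ 2)) :=
        (le_mul_of_one_le_left (Real.exp_pos _).le h3).trans h2
      refine (h1.trans h4).trans ?_
      calc η ^ (m - 1) * ((1 + |ξ|) ^ Q * Real.exp (-c * ξ ^ 2))
          = 1 * η ^ (m - 1) * ((1 + |ξ|) ^ Q * Real.exp (-c * ξ ^ 2)) := by ring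
        _ ≤ _ := by gcongr <;> linarith
    · refine (htail σ ν I ρ h hρ1 hρ hB0 hDB hcard ξ hξ2).trans ?_
      gcongr <;> linarith
  calc ‖sumCharFun ν I ξ - edgeworthHat (sumCumulant ν I) m ξ‖
      ≤ ‖sumCharFun ν I ξ‖ + ‖edgeworthHat (sumCumulant ν I) m ξ‖ := norm_sub_le _ _
    _ ≤ (K2 + 1) * η ^ (m - 1) * fourierMajorant Q c ξ +
        K4 * (η ^ (m - 1) * fourierMajorant Q c ξ) := by
        refine add_le_add hΦ (hhat.trans ?_)
        unfold fourierMajorant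
        gcongr
        linarith
    _ = (K2 + K4 + 1) * η ^ (m - 1) * fourierMajorant Q c ξ := by ring
    _ ≤ _ := by
        have : 0 ≤ fourierMajorant Q c ξ := by unfold fourierMajorant; linarith
        gcongr
        linarith

theorem continuous_sumCharFun (h : ∀ j ∈ I, TameLaw m σ M D (ν j)) :
    Continuous (sumCharFun ν I) := by
  unfold sumCharFun
  refine continuous_finsetProd _ fun j hj => ?_
  have := (h j hj).prob
  exact continuous_charFun.comp (continuous_id.div_const _)

/-- The Edgeworth expansion on the Fourier side, with an error in `L¹` of order `N^{-(m-1)/2}`. -/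
theorem exists_integral_norm_sumCharFun_sub_le (hm : 3 ≤ m) (hM : 0 ≤ M) (hD : 0 < D)
    (hσ : 0 < σ) (hσ1 : σ ≤ 1) :
    ∃ K : ℝ, ∃ N₀ : ℕ, 0 ≤ K ∧ ∀ (ν : ℕ → Measure ℝ) (I : Finset ℕ),
      (∀ j ∈ I, TameLaw m σ M D (ν j)) → N₀ ≤ I.card →
      0 < sumSd ν I ∧ Integrable (sumCharFun ν I) ∧
      ∫ ξ, ‖sumCharFun ν I ξ - edgeworthHat (sumCumulant ν I) m ξ‖ ≤
        K * (I.card : ℝ) ^ (-((m : ℝ) - 1) / 2) := by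
  obtain ⟨K, c, ρ₀, hK, hc, hρ₀, hmain⟩ := exists_norm_sumCharFun_sub_le hm hM hD hσ hσ1
  set Q := m * m + 4 * (m - 1)
  have hG0 : ∀ ξ, 0 ≤ fourierMajorant Q c ξ := fun ξ => by unfold fourierMajorant; positivity
  refine ⟨K * ∫ ξ, fourierMajorant Q c ξ, ⌈ρ₀ ^ 8⌉₊,
    mul_nonneg hK (integral_nonneg hG0), fun ν I h hI => ?_⟩
  have hN0 : (0 : ℝ) ≤ I.card := Nat.cast_nonneg _
  set ρ : ℝ := (I.card : ℝ) ^ (1 / 8 : ℝ) with hρd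
  have hρ8 : ρ ^ 8 = I.card := by
    rw [hρd, ← Real.rpow_natCast, ← Real.rpow_mul hN0]; norm_num
  have hρ0 : ρ₀ ≤ ρ := by
    have h1 : ρ₀ ^ 8 ≤ ρ ^ 8 := by rw [hρ8]; exact (Nat.le_ceil _).trans (by exact_mod_cast hI)
    exact le_of_pow_le_pow_left₀ (by norm_num) (by positivity) h1
  obtain ⟨hB, hp⟩ := hmain ν I ρ h hρ0 hρ8
  have hη : (1 / ρ ^ 4) ^ (m - 1) = (I.card : ℝ) ^ (-((m : ℝ) - 1) / 2) := by
    rw [one_div, inv_pow, ← pow_mul, hρd, ← Real.rpow_natCast, ← Real.rpow_mul hN0,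
      ← Real.rpow_neg hN0]
    congr 1
    rw [Nat.cast_mul, Nat.cast_sub (by omega)]
    push_cast; ring
  have hcont : Continuous fun ξ => sumCharFun ν I ξ - edgeworthHat (sumCumulant ν I) m ξ :=
    (continuous_sumCharFun h).sub (continuous_edgeworthHat _ _)
  have hGi : Integrable fun ξ => K * (1 / ρ ^ 4) ^ (m - 1) * fourierMajorant Q c ξ :=
    (integrable_fourierMajorant Q hc).const_mul _
  have hdiff : Integrable fun ξ => sumCharFun ν I ξ - edgeworthHat (sumCumulant ν I) m ξ :=
    hGi.mono' hcont.aestronglyMeasurable (ae_of_all _ hp)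
  refine ⟨hB, ?_, ?_⟩
  · exact (hdiff.add (integrable_edgeworthHat (sumCumulant ν I) hm)).congr
      (ae_of_all _ fun ξ => sub_add_cancel _ _)
  · refine (integral_mono hdiff.norm hGi hp).trans (le_of_eq ?_)
    rw [integral_const_mul, hη]; ring

end Bounds

/-! ### Fourier inversion -/

/-- Fourier inversion with the normalization of characteristic functions. -/
theorem eq_integral_exp_mul_charFun {h : ℝ → ℝ} (hc : Continuous h) (hi : Integrable h)
    {φ : ℝ → ℂ} (hφ : ∀ u, φ u = ∫ x : ℝ, Complex.exp (u * x * Complex.I) * h x)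
    (hφi : Integrable φ) (x : ℝ) :
    (h x : ℂ) = (2 * Real.pi : ℝ)⁻¹ * ∫ ξ : ℝ, Complex.exp (-(ξ * x * Complex.I)) * φ ξ := by
  have hF : (FourierTransform.fourier (fun x => (h x : ℂ)) : ℝ → ℂ)
      = fun w => φ (-2 * Real.pi * w) := by
    ext w
    rw [Real.fourier_eq', hφ]
    refine integral_congr_ae (ae_of_all _ fun v => ?_)
    simp only [smul_eq_mul, RCLike.inner_apply, conj_trivial]
    congr 2
    push_cast
    ring
  have hpi : (-2 * Real.pi) ≠ 0 := by simp [Real.pi_ne_zero]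
  have h1 := (Complex.continuous_ofReal.comp hc).fourierInv_fourier_eq
    (hi.ofReal (𝕜 := ℂ)) (by
      change Integrable (FourierTransform.fourier (fun x => (h x : ℂ)) : ℝ → ℂ)
      rw [hF]; exact hφi.comp_mul_left' hpi)
  have h2 := congrFun h1 x
  change _ = (h x : ℂ) at h2
  rw [← h2]
  change (FourierTransformInv.fourierInv (FourierTransform.fourier (fun x => (h x : ℂ)) : ℝ → ℂ))
    x = _
  rw [hF, Real.fourierInv_eq']
  have h3 := Measure.integral_comp_mul_left
    (fun ξ : ℝ => Complex.exp (-(ξ * x * Complex.I)) * φ ξ) (-2 * Real.pi)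
  rw [abs_inv, abs_mul, abs_neg, abs_two, abs_of_pos Real.pi_pos] at h3
  rw [← Complex.real_smul, ← h3]
  refine integral_congr_ae (ae_of_all _ fun v => ?_)
  simp only [smul_eq_mul, RCLike.inner_apply, conj_trivial]
  congr 2
  push_cast
  ring

theorem norm_exp_neg_mul_I (a b : ℝ) : ‖Complex.exp (-(a * b * Complex.I))‖ = 1 := by
  have := Complex.norm_exp_ofReal_mul_I (-(a * b))
  push_cast at this
  rwa [neg_mul] at this

theorem integrable_pow_mul_exp_neg_sq (k : ℕ) :
    Integrable (fun ξ : ℝ => |ξ| ^ k * Real.exp (-ξ ^ 2 / 2)) := by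
  refine (integrable_one_add_abs_pow_mul_exp k (c := 1 / 2) (by norm_num)).mono' (by fun_prop)
    (ae_of_all _ fun ξ => ?_)
  have := abs_nonneg ξ
  rw [Real.norm_of_nonneg (by positivity), show -ξ ^ 2 / 2 = -(1 / 2) * ξ ^ 2 by ring]
  gcongr
  linarith

theorem norm_pow_mul_exp_mul_exp (k : ℕ) (x ξ : ℝ) :
    ‖(ξ * Complex.I) ^ k * Complex.exp (-(ξ : ℂ) ^ 2 / 2) * Complex.exp (-(ξ * x * Complex.I))‖
      = |ξ| ^ k * Real.exp (-ξ ^ 2 / 2) := by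
  rw [norm_mul, norm_mul, norm_exp_neg_mul_I, mul_one, norm_exp_neg_sq_div_two, norm_pow, norm_mul,
    Complex.norm_I, mul_one, Complex.norm_real, Real.norm_eq_abs]

theorem integrable_pow_mul_exp_mul_exp (k : ℕ) (x : ℝ) :
    Integrable (fun ξ : ℝ => (ξ * Complex.I) ^ k * Complex.exp (-(ξ : ℂ) ^ 2 / 2) *
      Complex.exp (-(ξ * x * Complex.I))) :=
  (integrable_pow_mul_exp_neg_sq k).mono' (by fun_prop)
    (ae_of_all _ fun ξ => (norm_pow_mul_exp_mul_exp k x ξ).le)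

theorem hasDerivAt_gaussianPDFReal (x : ℝ) :
    HasDerivAt (gaussianPDFReal 0 1) (-x * gaussianPDFReal 0 1 x) x := by
  unfold gaussianPDFReal
  simp only [NNReal.coe_one, mul_one, sub_zero]
  have h := ((((hasDerivAt_id x).pow 2).neg.div_const 2).exp).const_mul (√(2 * Real.pi))⁻¹
  simp only [id_eq, Nat.cast_ofNat] at h
  refine h.congr_deriv ?_
  simp
  ring

/-- The Fourier representation of `H_k 𝔫`. -/
theorem integral_pow_mul_exp_mul_exp (k : ℕ) (x : ℝ) :
    ∫ ξ : ℝ, (ξ * Complex.I) ^ k * Complex.exp (-(ξ : ℂ) ^ 2 / 2) *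
      Complex.exp (-(ξ * x * Complex.I)) =
    ((2 * Real.pi * (Polynomial.aeval x (Polynomial.hermite k) * gaussianPDFReal 0 1 x) : ℝ) :
      ℂ) := by
  induction k generalizing x with
  | zero =>
    have h := fourierIntegral_gaussian (b := 1 / 2) (by norm_num) (-(x : ℂ))
    have h2 : ∀ ξ : ℝ, (ξ * Complex.I) ^ 0 * Complex.exp (-(ξ : ℂ) ^ 2 / 2) *
      Complex.exp (-(ξ * x * Complex.I)) = Complex.exp (Complex.I * -(x : ℂ) * ξ) *
        Complex.exp (-(1 / 2) * (ξ : ℂ) ^ 2) := fun ξ => by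
      rw [pow_zero, one_mul, mul_comm]
      congr 2 <;> ring
    simp_rw [h2]
    rw [h]
    have h3 : ((Real.pi : ℂ) / (1 / 2)) ^ (1 / 2 : ℂ) = (√(2 * Real.pi) : ℝ) := by
      rw [Real.sqrt_eq_rpow, Complex.ofReal_cpow (by positivity)]
      push_cast
      congr 1
      ring
    rw [h3, Polynomial.hermite_zero, gaussianPDFReal]
    have h4 : Complex.exp (-(-(x : ℂ)) ^ 2 / (4 * (1 / 2))) = (Real.exp (-x ^ 2 / 2) : ℝ) := by
      push_cast
      congr 1
      ring
    rw [h4, ← Complex.ofReal_mul]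
    congr 1
    simp only [map_one, NNReal.coe_one, mul_one, one_mul, sub_zero]
    have h5 : √(2 * Real.pi) * √(2 * Real.pi) = 2 * Real.pi := Real.mul_self_sqrt (by positivity)
    have h6 : √(2 * Real.pi) ≠ 0 := by positivity
    field_simp
    rw [sq, h5]
  | succ k ih =>
    have hd := (hasDerivAt_integral_of_dominated_loc_of_deriv_le (μ := volume) (s := Set.univ)
      (x₀ := x) (bound := fun ξ : ℝ => |ξ| ^ (k + 1) * Real.exp (-ξ ^ 2 / 2))
      (F := fun (x ξ : ℝ) => (ξ * Complex.I) ^ k * Complex.exp (-(ξ : ℂ) ^ 2 / 2) *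
        Complex.exp (-(ξ * x * Complex.I)))
      (F' := fun (x ξ : ℝ) => -((ξ * Complex.I) ^ (k + 1) * Complex.exp (-(ξ : ℂ) ^ 2 / 2) *
        Complex.exp (-(ξ * x * Complex.I)))) Filter.univ_mem
      (Eventually.of_forall fun x => (integrable_pow_mul_exp_mul_exp k x).aestronglyMeasurable)
      (integrable_pow_mul_exp_mul_exp k x)
      (integrable_pow_mul_exp_mul_exp (k + 1) x).neg.aestronglyMeasurable
      (ae_of_all _ fun ξ x _ => by
        rw [norm_neg]; exact (norm_pow_mul_exp_mul_exp (k + 1) x ξ).le)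
      (integrable_pow_mul_exp_neg_sq (k + 1))
      (ae_of_all _ fun ξ x _ => by
        have h1 : HasDerivAt (fun x : ℝ => -((ξ : ℂ) * x * Complex.I)) (-(ξ * Complex.I)) x := by
          have h := (((Complex.ofRealCLM.hasDerivAt (x := x)).const_mul (ξ : ℂ)).mul_const
            Complex.I).fun_neg
          simpa using h
        refine (h1.cexp.const_mul _).congr_deriv ?_
        ring)).2
    rw [integral_neg] at hd
    simp_rw [ih] at hd
    have hH : HasDerivAt (fun x => 2 * Real.pi *
        (Polynomial.aeval x (Polynomial.hermite k) * gaussianPDFReal 0 1 x))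
        (2 * Real.pi * (Polynomial.aeval x (Polynomial.derivative (Polynomial.hermite k)) *
          gaussianPDFReal 0 1 x + Polynomial.aeval x (Polynomial.hermite k) *
            (-x * gaussianPDFReal 0 1 x))) x :=
      ((Polynomial.hasDerivAt_aeval _ x).mul (hasDerivAt_gaussianPDFReal x)).const_mul _
    have h := hd.unique hH.ofReal_comp
    rw [neg_eq_iff_eq_neg] at h
    rw [h, ← Complex.ofReal_neg, Polynomial.hermite_succ]
    congr 1
    simp only [map_sub, map_mul, Polynomial.aeval_X]
    ring

theorem integral_exp_mul_edgeworthHat (lam : ℕ → ℝ) (m : ℕ) (x : ℝ) :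
    ∫ ξ : ℝ, Complex.exp (-(ξ * x * Complex.I)) * edgeworthHat lam m ξ =
      ((2 * Real.pi * (gaussianPDFReal 0 1 x *
        (1 + ∑ ν ∈ Finset.Icc 3 m, edgeworthPoly lam ν x)) : ℝ) : ℂ) := by
  set E : ℕ → ℝ → ℂ := fun k ξ => (ξ * Complex.I) ^ k * Complex.exp (-(ξ : ℂ) ^ 2 / 2) *
      Complex.exp (-(ξ * x * Complex.I)) with hE
  have hEi : ∀ k, Integrable (E k) := fun k => integrable_pow_mul_exp_mul_exp k x
  have h1 : ∀ ξ : ℝ, Complex.exp (-(ξ * x * Complex.I)) * edgeworthHat lam m ξ =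
      E 0 ξ + ∑ ν ∈ Finset.Icc 3 m, ∑ s ∈ Finset.range (ν - 2 + 1),
        ((((∑ l ∈ Finset.Icc 1 (ν - 2),
        Polynomial.monomial l (lam (l + 2) / ((l + 2).factorial : ℝ))) ^ s).coeff (ν - 2)
      / (s.factorial : ℝ) : ℝ) : ℂ) * E (ν - 2 + 2 * s) ξ := by
    intro ξ
    unfold edgeworthHat edgeworthPolyHat
    rw [mul_add, mul_add, mul_one, Finset.mul_sum, Finset.mul_sum]
    congr 1
    · rw [hE]; simp only [pow_zero]; ring
    · refine Finset.sum_congr rfl fun ν _ => ?_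
      rw [Finset.mul_sum, Finset.mul_sum]
      refine Finset.sum_congr rfl fun s _ => ?_
      rw [hE]; simp only; ring
  simp_rw [h1]
  rw [integral_add (hEi 0) (integrable_finsetSum _ fun ν _ => integrable_finsetSum _ fun s _ =>
    (hEi _).const_mul _), integral_finsetSum _ (fun ν _ => integrable_finsetSum _ fun s _ =>
    (hEi _).const_mul _), hE, integral_pow_mul_exp_mul_exp, mul_add, mul_add, mul_one,
    Finset.mul_sum, Finset.mul_sum, Complex.ofReal_add, Complex.ofReal_sum]
  congr 1
  · simp
  · refine Finset.sum_congr rfl fun ν _ => ?_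
    rw [integral_finsetSum _ fun s _ => (integrable_pow_mul_exp_mul_exp _ x).const_mul _]
    unfold edgeworthPoly
    rw [Finset.mul_sum, Finset.mul_sum, Complex.ofReal_sum]
    refine Finset.sum_congr rfl fun s _ => ?_
    rw [integral_const_mul, integral_pow_mul_exp_mul_exp, ← Complex.ofReal_mul]
    congr 1
    ring

/-! ### Densities of sums -/

/-- A `C¹` probability density on `ℝ` whose derivative has `L¹` norm at most `D`. -/
structure RegDensity (D : ℝ) (f : ℝ → ℝ) : Prop where
  contDiff : ContDiff ℝ 1 f
  nonneg : ∀ x, 0 ≤ f x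
  prob : IsProbabilityMeasure (lawOfDensity f)
  deriv_le : ∫⁻ x, ‖deriv f x‖ₑ ≤ ENNReal.ofReal D

theorem lintegral_lawOfDensity {f : ℝ → ℝ} (hf : Continuous f) {g : ℝ → ℝ≥0∞}
    (hg : Measurable g) :
    ∫⁻ x, g x ∂(lawOfDensity f) = ∫⁻ x, ENNReal.ofReal (f x) * g x := by
  unfold lawOfDensity
  rw [lintegral_withDensity_eq_lintegral_mul _ (by fun_prop) hg]
  rfl

theorem integrable_of_isFiniteMeasure_lawOfDensity {f : ℝ → ℝ} (hf : Continuous f)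
    (h0 : ∀ x, 0 ≤ f x) [IsFiniteMeasure (lawOfDensity f)] : Integrable f := by
  refine ⟨hf.aestronglyMeasurable, ?_⟩
  rw [hasFiniteIntegral_iff_ofReal (ae_of_all _ h0)]
  have h := measure_lt_top (lawOfDensity f) Set.univ
  unfold lawOfDensity at h
  rwa [withDensity_apply _ MeasurableSet.univ, Measure.restrict_univ] at h

theorem integral_lawOfDensity {f : ℝ → ℝ} (hf : Continuous f) (h0 : ∀ x, 0 ≤ f x) {E : Type*}
    [NormedAddCommGroup E] [NormedSpace ℝ E] (g : ℝ → E) :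
    ∫ x, g x ∂(lawOfDensity f) = ∫ x, f x • g x := by
  unfold lawOfDensity
  rw [integral_withDensity_eq_integral_toReal_smul (by fun_prop)
    (ae_of_all _ fun _ => ENNReal.ofReal_lt_top)]
  simp only [ENNReal.toReal_ofReal (h0 _)]

theorem charFun_lawOfDensity {f : ℝ → ℝ} (hf : Continuous f) (h0 : ∀ x, 0 ≤ f x) (u : ℝ) :
    charFun (lawOfDensity f) u = ∫ x : ℝ, Complex.exp (u * x * Complex.I) * f x := by
  rw [charFun_apply_real, integral_lawOfDensity hf h0]
  simp only [Complex.real_smul, mul_comm]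

namespace RegDensity

variable {D : ℝ} {f : ℝ → ℝ}

theorem continuous (h : RegDensity D f) : Continuous f := h.contDiff.continuous

theorem integrable (h : RegDensity D f) : Integrable f :=
  have := h.prob
  integrable_of_isFiniteMeasure_lawOfDensity h.continuous h.nonneg

theorem hasDerivAt (h : RegDensity D f) (x : ℝ) : HasDerivAt f (deriv f x) x :=
  (h.contDiff.differentiable (by simp) x).hasDerivAt

theorem integrable_deriv (h : RegDensity D f) : Integrable (deriv f) :=
  ⟨(h.contDiff.continuous_deriv le_rfl).aestronglyMeasurable,
    lt_of_le_of_lt h.deriv_le ENNReal.ofReal_lt_top⟩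

theorem integral_norm_deriv_le (h : RegDensity D f) (hD : 0 ≤ D) : ∫ x, ‖deriv f x‖ ≤ D := by
  rw [integral_norm_eq_lintegral_enorm h.integrable_deriv.aestronglyMeasurable]
  exact ENNReal.toReal_le_of_le_ofReal hD h.deriv_le

theorem le (h : RegDensity D f) (hD : 0 ≤ D) (x : ℝ) : f x ≤ D := by
  have h0 : Tendsto f atBot (𝓝 0) :=
    tendsto_zero_of_hasDerivAt_of_integrableOn_Iic (a := x) (fun y _ => h.hasDerivAt y)
      h.integrable_deriv.integrableOn h.integrable.integrableOn
  have h1 := integral_Iic_of_hasDerivAt_of_tendsto' (a := x) (fun y _ => h.hasDerivAt y)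
      h.integrable_deriv.integrableOn h0
  rw [sub_zero] at h1
  rw [← h1]
  calc ∫ y in Set.Iic x, deriv f y ≤ ∫ y in Set.Iic x, ‖deriv f y‖ :=
        integral_mono h.integrable_deriv.integrableOn h.integrable_deriv.norm.integrableOn
          fun y => Real.le_norm_self _
    _ ≤ ∫ y, ‖deriv f y‖ := setIntegral_le_integral h.integrable_deriv.norm
          (ae_of_all _ fun y => norm_nonneg _)
    _ ≤ D := h.integral_norm_deriv_le hD

theorem abs_mul_norm_charFun_le (h : RegDensity D f) (hD : 0 ≤ D) (u : ℝ) :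
    |u| * ‖charFun (lawOfDensity f) u‖ ≤ D := by
  have hnorm : ∀ x : ℝ, ‖Complex.exp (u * x * Complex.I)‖ = 1 := fun x => by
    have := Complex.norm_exp_ofReal_mul_I (u * x)
    rwa [Complex.ofReal_mul] at this
  have hexp : ∀ x : ℝ, HasDerivAt (fun x : ℝ => Complex.exp (u * x * Complex.I))
      (u * Complex.I * Complex.exp (u * x * Complex.I)) x := fun x => by
    have h1 : HasDerivAt (fun x : ℝ => (u : ℂ) * x * Complex.I) (u * Complex.I) x := by
      have h := ((Complex.ofRealCLM.hasDerivAt (x := x)).const_mul (u : ℂ)).mul_const Complex.I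
      simpa using h
    exact h1.cexp.congr_deriv (mul_comm _ _)
  have hbdd : ∀ {g : ℝ → ℝ}, Integrable g →
      Integrable (fun x : ℝ => Complex.exp (u * x * Complex.I) * (g x : ℂ)) := fun {g} hg => by
    refine (hg.ofReal (𝕜 := ℂ)).bdd_mul (c := 1) (by fun_prop) (ae_of_all _ fun x => ?_)
    exact (hnorm x).le
  have hparts := integral_mul_deriv_eq_deriv_mul_of_integrable
    (u := fun x : ℝ => Complex.exp (u * x * Complex.I))
    (u' := fun x : ℝ => u * Complex.I * Complex.exp (u * x * Complex.I))
    (v := fun x => (f x : ℂ)) (v' := fun x => ((deriv f x : ℝ) : ℂ))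
    (fun x _ => hexp x) (fun x _ => (h.hasDerivAt x).ofReal_comp)
    (hbdd h.integrable_deriv) (((hbdd h.integrable).const_mul (u * Complex.I)).congr
      (ae_of_all _ fun x => by simp [mul_assoc])) (hbdd h.integrable)
  have h2 : ∫ x : ℝ, u * Complex.I * Complex.exp (u * x * Complex.I) * (f x : ℂ) =
      u * Complex.I * charFun (lawOfDensity f) u := by
    rw [charFun_lawOfDensity h.continuous h.nonneg, ← integral_const_mul]
    simp only [mul_assoc]
  rw [h2] at hparts
  have h3 := congrArg norm hparts
  rw [norm_neg, norm_mul, norm_mul, Complex.norm_I, mul_one, Complex.norm_real,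
    Real.norm_eq_abs] at h3
  rw [← h3]
  refine (norm_integral_le_integral_norm _).trans ((integral_congr_ae (ae_of_all _ fun x => ?_)).trans_le
    (h.integral_norm_deriv_le hD))
  simp only [norm_mul, hnorm, one_mul, Complex.norm_real]

end RegDensity

/-- The density `u ↦ E f(u - Z)` of the sum of a variable with density `f` and an independent
variable `Z` with law `ν`. -/
noncomputable def smooth (f : ℝ → ℝ) (ν : Measure ℝ) (u : ℝ) : ℝ := ∫ y, f (u - y) ∂ν

theorem smooth_nonneg {D : ℝ} {f : ℝ → ℝ} {ν : Measure ℝ} (h : RegDensity D f) (u : ℝ) :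
    0 ≤ smooth f ν u :=
  integral_nonneg fun _ => h.nonneg _

section Smooth

variable {D : ℝ} {f : ℝ → ℝ} {ν : Measure ℝ} [IsProbabilityMeasure ν]

theorem RegDensity.integrable_comp_sub (h : RegDensity D f) (hD : 0 ≤ D) (u : ℝ) :
    Integrable (fun y => f (u - y)) ν := by
  have := h.continuous
  refine (integrable_const D).mono' (by fun_prop) (ae_of_all _ fun y => ?_)
  rw [Real.norm_of_nonneg (h.nonneg _)]
  exact h.le hD _

theorem smooth_le (h : RegDensity D f) (hD : 0 ≤ D) (u : ℝ) : smooth f ν u ≤ D := by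
  refine (integral_mono (h.integrable_comp_sub hD u) (integrable_const D)
    fun y => h.le hD _).trans ?_
  simp

theorem continuous_smooth (h : RegDensity D f) (hD : 0 ≤ D) : Continuous (smooth f ν) := by
  have hc := h.continuous
  refine continuous_of_dominated (bound := fun _ => D) (fun u => by fun_prop)
    (fun u => ae_of_all _ fun y => ?_) (integrable_const D) (ae_of_all _ fun y => by fun_prop)
  rw [Real.norm_of_nonneg (h.nonneg _)]
  exact h.le hD _

theorem lawOfDensity_smooth (h : RegDensity D f) (hD : 0 ≤ D) :
    lawOfDensity (smooth f ν) = lawOfDensity f ∗ ν := by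
  have := h.prob
  have hc := h.continuous
  refine Measure.ext_of_lintegral _ fun g hg => ?_
  rw [lintegral_lawOfDensity (continuous_smooth h hD) hg, Measure.lintegral_conv hg,
    lintegral_lawOfDensity hc (by fun_prop)]
  have h1 : ∀ u, ENNReal.ofReal (smooth f ν u) * g u
      = ∫⁻ y, ENNReal.ofReal (f (u - y)) * g u ∂ν := fun u => by
    rw [lintegral_mul_const _ (by fun_prop)]
    congr 1
    exact ofReal_integral_eq_lintegral_ofReal (h.integrable_comp_sub hD u)
      (ae_of_all _ fun y => h.nonneg _)
  simp_rw [h1]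
  rw [lintegral_lintegral_swap (by fun_prop)]
  have h2 : ∀ x, ENNReal.ofReal (f x) * ∫⁻ y, g (x + y) ∂ν
      = ∫⁻ y, ENNReal.ofReal (f x) * g (x + y) ∂ν := fun x => by
    rw [lintegral_const_mul _ (by fun_prop)]
  simp_rw [h2]
  rw [lintegral_lintegral_swap (f := fun x y => ENNReal.ofReal (f x) * g (x + y)) (by fun_prop)]
  refine lintegral_congr fun y => ?_
  rw [← lintegral_add_right_eq_self _ y]
  simp

end Smooth

/-- The law of the sum of independent variables with laws `ν j`, `j ∈ I`. -/
noncomputable def sumLaw (ν : ℕ → Measure ℝ) (I : Finset ℕ) : Measure ℝ :=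
  (Measure.pi (fun j : ↥I => ν j)).map (fun x => ∑ j, x j)

theorem isProbabilityMeasure_sumLaw {ν : ℕ → Measure ℝ} {I : Finset ℕ}
    (h : ∀ j ∈ I, IsProbabilityMeasure (ν j)) : IsProbabilityMeasure (sumLaw ν I) := by
  have : ∀ j : ↥I, IsProbabilityMeasure (ν j) := fun j => h j j.2
  exact Measure.isProbabilityMeasure_map (by fun_prop)

theorem charFun_sumLaw {ν : ℕ → Measure ℝ} {I : Finset ℕ}
    (h : ∀ j ∈ I, IsProbabilityMeasure (ν j)) (u : ℝ) :
    charFun (sumLaw ν I) u = ∏ j ∈ I, charFun (ν j) u := by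
  have : ∀ j : ↥I, IsProbabilityMeasure (ν j) := fun j => h j j.2
  rw [charFun_apply_real, sumLaw, integral_map (by fun_prop) (by fun_prop)]
  have h1 : ∀ x : ↥I → ℝ, Complex.exp (u * ((∑ j, x j : ℝ) : ℂ) * Complex.I) =
      ∏ j, Complex.exp (u * (x j) * Complex.I) := fun x => by
    rw [← Complex.exp_sum]
    congr 1
    push_cast
    rw [Finset.mul_sum, Finset.sum_mul]
  simp_rw [h1]
  rw [integral_fintype_prod_eq_prod (fun (j : ↥I) (y : ℝ) => Complex.exp (u * y * Complex.I)),
    ← Finset.prod_coe_sort I]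
  simp only [charFun_apply_real]

/-- The centered law of a density. -/
noncomputable def centeredLaw (f : ℝ → ℝ) (μ : ℝ) : Measure ℝ := (lawOfDensity f).map (fun x => x + -μ)

theorem charFun_centeredLaw (f : ℝ → ℝ) (μ u : ℝ) :
    charFun (centeredLaw f μ) u =
      charFun (lawOfDensity f) u * Complex.exp (-(u * μ * Complex.I)) := by
  rw [centeredLaw, charFun_map_add_const]
  congr 2
  simp

/-- The density at `u` of the sum of independent variables with densities `f j`, `j ∈ I`, where
the variable with index `ℓ` is used for smoothing. -/
noncomputable def sumDensity (f : ℕ → ℝ → ℝ) (I : Finset ℕ) (ℓ : ℕ) (u : ℝ) : ℝ :=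
  smooth (f ℓ) (sumLaw (fun j => lawOfDensity (f j)) (I.erase ℓ)) u

theorem lawOfDensity_sumDensity {f : ℕ → ℝ → ℝ} {I : Finset ℕ} {ℓ : ℕ} {D : ℝ} (hD : 0 ≤ D)
    (h : ∀ j ∈ I, RegDensity D (f j)) (hℓ : ℓ ∈ I) :
    lawOfDensity (sumDensity f I ℓ) = sumLaw (fun j => lawOfDensity (f j)) I := by
  have hp : ∀ j ∈ I, IsProbabilityMeasure (lawOfDensity (f j)) := fun j hj => (h j hj).prob
  have hp' : ∀ j ∈ I.erase ℓ, IsProbabilityMeasure (lawOfDensity (f j)) := fun j hj =>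
    hp j (Finset.mem_of_mem_erase hj)
  have := hp ℓ hℓ
  have := isProbabilityMeasure_sumLaw (ν := fun j => lawOfDensity (f j)) hp
  have := isProbabilityMeasure_sumLaw (ν := fun j => lawOfDensity (f j)) hp'
  unfold sumDensity
  change lawOfDensity (smooth (f ℓ) _) = _
  rw [lawOfDensity_smooth (h ℓ hℓ) hD]
  refine Measure.ext_of_charFun (funext fun u => ?_)
  rw [charFun_conv, charFun_sumLaw hp, charFun_sumLaw hp', Finset.mul_prod_erase I
    (fun j => charFun (lawOfDensity (f j)) u) hℓ]

theorem integral_comp_mul_add {E : Type*} [NormedAddCommGroup E] [NormedSpace ℝ E] (g : ℝ → E)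
    {B : ℝ} (hB : 0 < B) (M : ℝ) : ∫ x, B • g (B * x + M) = ∫ x, g x := by
  rw [integral_smul, Measure.integral_comp_mul_left (fun y => g (y + M)),
    integral_add_right_eq_self g M, abs_of_pos (by positivity), smul_smul,
    mul_inv_cancel₀ hB.ne', one_smul]

/-- The continuous density of the normalized sum of independent variables with densities `f j` and
means `μ j`, `j ∈ I`; as in `sumDensity`, the index `ℓ ∈ I` is the one used for smoothing. -/
noncomputable def normalizedDensity (f : ℕ → ℝ → ℝ) (μ : ℕ → ℝ) (I : Finset ℕ) (ℓ : ℕ) (x : ℝ) : ℝ :=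
  sumSd (fun j => centeredLaw (f j) (μ j)) I *
    sumDensity f I ℓ (sumSd (fun j => centeredLaw (f j) (μ j)) I * x + ∑ j ∈ I, μ j)

theorem charFun_sumLaw_mul_exp {f : ℕ → ℝ → ℝ} {I : Finset ℕ} (μ : ℕ → ℝ)
    (h : ∀ j ∈ I, IsProbabilityMeasure (lawOfDensity (f j))) (u : ℝ) :
    Complex.exp (-(u * (∑ j ∈ I, μ j : ℝ) * Complex.I)) *
      charFun (sumLaw (fun j => lawOfDensity (f j)) I) u =
      ∏ j ∈ I, charFun (centeredLaw (f j) (μ j)) u := by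
  rw [charFun_sumLaw h]
  simp_rw [charFun_centeredLaw]
  rw [Finset.prod_mul_distrib, ← Complex.exp_sum, mul_comm]
  congr 2
  push_cast
  rw [Finset.mul_sum, Finset.sum_mul, ← Finset.sum_neg_distrib]

/-- The Edgeworth expansion of the density of a sum of independent variables, uniformly over the
class of laws described by `RegDensity` and `TameLaw`. -/
theorem exists_abs_normalizedDensity_sub_le {m : ℕ} {σ M D : ℝ} (hm : 3 ≤ m) (hM : 0 ≤ M)
    (hD : 0 < D) (hσ : 0 < σ) (hσ1 : σ ≤ 1) :
    ∃ K : ℝ, ∃ N₀ : ℕ, 0 ≤ K ∧ ∀ (f : ℕ → ℝ → ℝ) (μ : ℕ → ℝ) (I : Finset ℕ) (ℓ : ℕ), ℓ ∈ I →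
      (∀ j ∈ I, RegDensity D (f j)) →
      (∀ j ∈ I, TameLaw m σ M D (centeredLaw (f j) (μ j))) → N₀ ≤ I.card →
      0 < sumSd (fun j => centeredLaw (f j) (μ j)) I ∧
      Continuous (normalizedDensity f μ I ℓ) ∧ (∀ x, 0 ≤ normalizedDensity f μ I ℓ x) ∧
      (∀ u, charFun (lawOfDensity (normalizedDensity f μ I ℓ)) u =
        sumCharFun (fun j => centeredLaw (f j) (μ j)) I u) ∧
      ∀ x, |normalizedDensity f μ I ℓ x - gaussianPDFReal 0 1 x *
        (1 + ∑ ν ∈ Finset.Icc 3 m,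
          edgeworthPoly (sumCumulant (fun j => centeredLaw (f j) (μ j)) I) ν x)| ≤
        K * (I.card : ℝ) ^ (-((m : ℝ) - 1) / 2) := by
  obtain ⟨K, N₀, hK, hmain⟩ := exists_integral_norm_sumCharFun_sub_le hm hM hD hσ hσ1
  refine ⟨K, N₀, hK, fun f μ I ℓ hℓ hf ht hI => ?_⟩
  obtain ⟨hB, hint, hle⟩ := hmain (fun j => centeredLaw (f j) (μ j)) I ht hI
  set ν : ℕ → Measure ℝ := fun j => centeredLaw (f j) (μ j) with hν
  set B := sumSd ν I with hBd
  have hp : ∀ j ∈ I, IsProbabilityMeasure (lawOfDensity (f j)) := fun j hj => (hf j hj).prob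
  have hpe := isProbabilityMeasure_sumLaw (ν := fun j => lawOfDensity (f j))
    (I := I.erase ℓ) fun j hj => hp j (Finset.mem_of_mem_erase hj)
  have hcs : Continuous (sumDensity f I ℓ) := continuous_smooth (hf ℓ hℓ) hD.le
  have hns : ∀ x, 0 ≤ sumDensity f I ℓ x := smooth_nonneg (hf ℓ hℓ)
  set q := normalizedDensity f μ I ℓ with hq
  have hqc : Continuous q := by
    change Continuous fun x => B * sumDensity f I ℓ (B * x + ∑ j ∈ I, μ j)
    fun_prop
  have hqn : ∀ x, 0 ≤ q x := fun x => mul_nonneg hB.le (hns _)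
  have hlaw := lawOfDensity_sumDensity hD.le hf hℓ
  have hφ : ∀ u, sumCharFun ν I u = ∫ x : ℝ, Complex.exp (u * x * Complex.I) * q x := by
    intro u
    unfold sumCharFun
    rw [← charFun_sumLaw_mul_exp μ hp, ← hlaw, charFun_lawOfDensity hcs hns,
      ← integral_const_mul, ← integral_comp_mul_add _ hB (∑ j ∈ I, μ j)]
    refine integral_congr_ae (ae_of_all _ fun x => ?_)
    have hB' : (B : ℂ) ≠ 0 := by exact_mod_cast hB.ne'
    change B • (_ * (_ * ((sumDensity f I ℓ (B * x + ∑ j ∈ I, μ j) : ℝ) : ℂ))) =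
      _ * ((B * sumDensity f I ℓ (B * x + ∑ j ∈ I, μ j) : ℝ) : ℂ)
    rw [← mul_assoc (Complex.exp _), ← Complex.exp_add, Complex.real_smul, Complex.ofReal_mul]
    rw [show -(((u / B : ℝ) : ℂ) * ((∑ j ∈ I, μ j : ℝ) : ℂ) * Complex.I) +
      ((u / B : ℝ) : ℂ) * ((B * x + ∑ j ∈ I, μ j : ℝ) : ℂ) * Complex.I = u * x * Complex.I by
        rw [Complex.ofReal_div, Complex.ofReal_add, Complex.ofReal_mul]
        field_simp
        ring]
    ring
  have hqi : Integrable q := by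
    have hsp : IsProbabilityMeasure (lawOfDensity (sumDensity f I ℓ)) := by
      rw [hlaw]; exact isProbabilityMeasure_sumLaw hp
    have hsi := integrable_of_isFiniteMeasure_lawOfDensity hcs hns
    exact ((hsi.comp_add_right (∑ j ∈ I, μ j)).comp_mul_left' hB.ne').const_mul B
  refine ⟨hB, hqc, hqn, fun u => ?_, fun x => ?_⟩
  · rw [charFun_lawOfDensity hqc hqn, hφ]
  · have hinv := eq_integral_exp_mul_charFun hqc hqi hφ hint x
    have happ := integral_exp_mul_edgeworthHat (sumCumulant ν I) m x
    have hbdd : ∀ {g : ℝ → ℂ}, Integrable g →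
        Integrable (fun ξ : ℝ => Complex.exp (-(ξ * x * Complex.I)) * g ξ) := fun {g} hg =>
      hg.bdd_mul (c := 1) (by fun_prop) (ae_of_all _ fun ξ => (norm_exp_neg_mul_I ξ x).le)
    have h2 : (((q x - gaussianPDFReal 0 1 x * (1 + ∑ r ∈ Finset.Icc 3 m,
        edgeworthPoly (sumCumulant ν I) r x) : ℝ)) : ℂ) = (2 * Real.pi : ℝ)⁻¹ *
        ∫ ξ : ℝ, Complex.exp (-(ξ * x * Complex.I)) *
          (sumCharFun ν I ξ - edgeworthHat (sumCumulant ν I) m ξ) := by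
      simp_rw [mul_sub]
      rw [integral_sub (hbdd hint) (hbdd (integrable_edgeworthHat _ hm)), mul_sub, ← hinv, happ,
        Complex.ofReal_sub]
      congr 1
      have : (Real.pi : ℂ) ≠ 0 := by exact_mod_cast Real.pi_ne_zero
      push_cast
      field_simp
    rw [← Real.norm_eq_abs, ← Complex.norm_real, h2, norm_mul]
    have h3 : ‖(((2 * Real.pi : ℝ)⁻¹ : ℝ) : ℂ)‖ ≤ 1 := by
      rw [Complex.norm_real, Real.norm_of_nonneg (by positivity)]
      exact inv_le_one_of_one_le₀ (by linarith [Real.pi_gt_three])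
    refine (mul_le_of_le_one_left (norm_nonneg _) h3).trans
      ((norm_integral_le_integral_norm _).trans ((integral_congr_ae (ae_of_all _ fun ξ => ?_)).trans_le
        hle))
    simp only [norm_mul, norm_exp_neg_mul_I, one_mul]

/-! ### Exponential tilting -/

/-- What is used about a density and a tilting parameter `θ`: the density is `C¹`, and `θ` is an
interior point of the domain of its moment generating function. -/
structure Tiltable (p : ℝ → ℝ) (θ : ℝ) : Prop where
  contDiff : ContDiff ℝ 1 p
  nonneg : ∀ x, 0 ≤ p x
  prob : IsProbabilityMeasure (lawOfDensity p)
  mem : θ ∈ interior (integrableExpSet id (lawOfDensity p))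

namespace Tiltable

variable {p : ℝ → ℝ} {θ : ℝ}

theorem integrable (h : Tiltable p θ) : Integrable (fun x => Real.exp (θ * x)) (lawOfDensity p) :=
  (interior_subset h.mem : θ ∈ integrableExpSet id (lawOfDensity p))

theorem Phi_pos (h : Tiltable p θ) : 0 < Phi p θ :=
  have := h.prob
  mgf_pos h.integrable

theorem tiltedLaw_eq (h : Tiltable p θ) :
    tiltedLaw p θ = (lawOfDensity p).tilted (fun x => θ * id x) := by
  have hc := h.contDiff.continuous
  unfold tiltedLaw Measure.tilted lawOfDensity
  rw [← withDensity_mul _ (by fun_prop) (by fun_prop)]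
  refine congrArg _ (funext fun x => ?_)
  rw [Pi.mul_apply, ← ENNReal.ofReal_mul (h.nonneg x)]
  congr 1
  unfold tiltedDensity
  change _ = p x * (Real.exp (θ * x) / Phi p θ)
  ring

theorem isProbabilityMeasure (h : Tiltable p θ) : IsProbabilityMeasure (tiltedLaw p θ) := by
  have := h.prob
  rw [h.tiltedLaw_eq]
  exact isProbabilityMeasure_tilted h.integrable

theorem tiltedDensity_nonneg (h : Tiltable p θ) (x : ℝ) : 0 ≤ tiltedDensity p θ x :=
  div_nonneg (mul_nonneg (Real.exp_pos _).le (h.nonneg x)) h.Phi_pos.le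

theorem contDiff_tiltedDensity (h : Tiltable p θ) : ContDiff ℝ 1 (tiltedDensity p θ) := by
  have := h.contDiff
  unfold tiltedDensity
  fun_prop

theorem regDensity (h : Tiltable p θ) {D : ℝ} (hD : tDerivNorm p θ ≤ ENNReal.ofReal D) :
    RegDensity D (tiltedDensity p θ) :=
  ⟨h.contDiff_tiltedDensity, h.tiltedDensity_nonneg, h.isProbabilityMeasure, hD⟩

theorem integral_id_tiltedLaw (h : Tiltable p θ) : ∫ x, x ∂(tiltedLaw p θ) = tMean p θ := by
  rw [h.tiltedLaw_eq]
  exact integral_tilted_mul_self h.mem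

theorem integrable_sub_pow (h : Tiltable p θ) (r : ℕ) :
    Integrable (fun x => (x - tMean p θ) ^ r) (tiltedLaw p θ) := by
  have := h.isProbabilityMeasure
  have h1 : MemLp (fun x : ℝ => x) (r : ℝ≥0) (tiltedLaw p θ) := by
    rw [h.tiltedLaw_eq]
    exact memLp_tilted_mul h.mem r
  have h2 : MemLp (fun x : ℝ => x - tMean p θ) (r : ℝ≥0) (tiltedLaw p θ) :=
    h1.sub (memLp_const _)
  have h3 := MemLp.integrable_norm_pow' (p := r) (by simpa using h2)
  refine h3.mono' (by fun_prop) (ae_of_all _ fun x => by rw [norm_pow])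

theorem integral_centeredLaw (g : ℝ → ℝ) (hg : Continuous g) :
    ∫ x, g x ∂(centeredLaw (tiltedDensity p θ) (tMean p θ)) =
      ∫ x, g (x - tMean p θ) ∂(tiltedLaw p θ) := by
  unfold centeredLaw
  rw [integral_map (by fun_prop) hg.aestronglyMeasurable]
  rfl

theorem tameLaw (h : Tiltable p θ) {m : ℕ} {σ M D : ℝ} (hM0 : 0 ≤ M) (hD0 : 0 ≤ D)
    (hσ : σ ^ 2 ≤ tVar p θ) (hM : tAbsMoment p (m + 1) θ ≤ ENNReal.ofReal M)
    (hD : tDerivNorm p θ ≤ ENNReal.ofReal D) :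
    TameLaw m σ M D (centeredLaw (tiltedDensity p θ) (tMean p θ)) where
  prob := by
    have := (h.regDensity hD).prob
    exact Measure.isProbabilityMeasure_map (by fun_prop)
  integrable r _ := by
    unfold centeredLaw
    rw [integrable_map_measure (by fun_prop) (by fun_prop)]
    exact h.integrable_sub_pow r
  mean := by
    have := h.isProbabilityMeasure
    rw [integral_centeredLaw _ continuous_id', integral_sub ?_ (integrable_const _),
      h.integral_id_tiltedLaw]
    · simp
    · have := (h.integrable_sub_pow 1).add (integrable_const (tMean p θ))
      refine this.congr (ae_of_all _ fun x => ?_)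
      simp
  var := by
    rw [integral_centeredLaw _ (by fun_prop)]
    exact hσ
  moment := by
    rw [integral_centeredLaw _ (by fun_prop),
      integral_congr_ae (g := fun x => ‖(x - tMean p θ) ^ (m + 1)‖)
        (ae_of_all _ fun x => by simp),
      integral_norm_eq_lintegral_enorm (h.integrable_sub_pow _).aestronglyMeasurable]
    refine ENNReal.toReal_le_of_le_ofReal hM0 (le_trans (le_of_eq ?_) hM)
    unfold tAbsMoment
    simp only [enorm_pow]
  decay u := by
    rw [charFun_centeredLaw, norm_mul, norm_exp_neg_mul_I, mul_one]
    exact (h.regDensity hD).abs_mul_norm_charFun_le hD0 u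

end Tiltable

section Sums

variable {p : ℕ → ℝ → ℝ} {θ : ℝ} {I : Finset ℕ}

theorem sumSd_centeredLaw (p : ℕ → ℝ → ℝ) (θ : ℝ) (I : Finset ℕ) :
    sumSd (fun j => centeredLaw (tiltedDensity (p j) θ) (tMean (p j) θ)) I =
      √(∑ j ∈ I, tVar (p j) θ) := by
  unfold sumSd
  simp_rw [Tiltable.integral_centeredLaw (fun x => x ^ 2) (by fun_prop)]
  rfl

theorem sumCumulant_centeredLaw (p : ℕ → ℝ → ℝ) (θ : ℝ) (I : Finset ℕ) :
    sumCumulant (fun j => centeredLaw (tiltedDensity (p j) θ) (tMean (p j) θ)) I =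
      normalizedCumulant p I θ := by
  ext l
  unfold sumCumulant normalizedCumulant
  rw [sumSd_centeredLaw]
  have h : ∀ r j, ∫ x, x ^ r ∂(centeredLaw (tiltedDensity (p j) θ) (tMean (p j) θ)) =
      tMoment (p j) r θ := fun r j =>
    Tiltable.integral_centeredLaw (fun x => x ^ r) (by fun_prop)
  simp_rw [h]

theorem normalizedSumLaw_eq_map (p : ℕ → ℝ → ℝ) (θ : ℝ) (I : Finset ℕ) :
    normalizedSumLaw p I θ =
      ((sumLaw (fun j => lawOfDensity (tiltedDensity (p j) θ)) I).map
        (fun y => y + -∑ j ∈ I, tMean (p j) θ)).map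
        (fun y => (√(∑ j ∈ I, tVar (p j) θ))⁻¹ * y) := by
  unfold normalizedSumLaw sumLaw
  rw [Measure.map_map (by fun_prop) (by fun_prop), Measure.map_map (by fun_prop) (by fun_prop)]
  congr 1
  funext x
  simp only [Function.comp]
  rw [inv_mul_eq_div, ← sub_eq_add_neg]

theorem isProbabilityMeasure_normalizedSumLaw (h : ∀ j ∈ I, Tiltable (p j) θ) :
    IsProbabilityMeasure (normalizedSumLaw p I θ) := by
  have := isProbabilityMeasure_sumLaw (ν := fun j => lawOfDensity (tiltedDensity (p j) θ))
    fun j hj => (h j hj).isProbabilityMeasure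
  rw [normalizedSumLaw_eq_map]
  have := Measure.isProbabilityMeasure_map
    (μ := sumLaw (fun j => lawOfDensity (tiltedDensity (p j) θ)) I)
    (f := fun y => y + -∑ j ∈ I, tMean (p j) θ) (by fun_prop)
  exact Measure.isProbabilityMeasure_map (by fun_prop)

theorem charFun_normalizedSumLaw (h : ∀ j ∈ I, Tiltable (p j) θ) (u : ℝ) :
    charFun (normalizedSumLaw p I θ) u =
      sumCharFun (fun j => centeredLaw (tiltedDensity (p j) θ) (tMean (p j) θ)) I u := by
  unfold sumCharFun
  rw [normalizedSumLaw_eq_map, charFun_map_mul, charFun_map_add_const, sumSd_centeredLaw,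
    inv_mul_eq_div, ← charFun_sumLaw_mul_exp _ fun j hj => (h j hj).isProbabilityMeasure, mul_comm]
  congr 2
  simp only [RCLike.inner_apply, conj_trivial]
  push_cast
  ring

/-- The deterministic core: the Edgeworth expansion for the density of a normalized tilted sum,
with an error bound that depends only on the bounds for the individual tilted laws. -/
theorem exists_densityError_le {m : ℕ} {σ M D : ℝ} (hm : 3 ≤ m) (hM : 0 ≤ M)
    (hD : 0 < D) (hσ : 0 < σ) (hσ1 : σ ≤ 1) :
    ∃ K : ℝ, ∃ N₀ : ℕ, 0 ≤ K ∧ ∀ (p : ℕ → ℝ → ℝ) (I : Finset ℕ) (θ : ℝ),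
      (∀ j ∈ I, Tiltable (p j) θ ∧ σ ^ 2 ≤ tVar (p j) θ ∧
        tAbsMoment (p j) (m + 1) θ ≤ ENNReal.ofReal M ∧
        tDerivNorm (p j) θ ≤ ENNReal.ofReal D) → I.Nonempty → N₀ ≤ I.card →
      densityError (normalizedSumLaw p I θ) (edgeworthApprox p I θ m) ≤
        ENNReal.ofReal (K * (I.card : ℝ) ^ (-((m : ℝ) - 1) / 2)) := by
  obtain ⟨K, N₀, hK, h⟩ := exists_abs_normalizedDensity_sub_le hm hM hD hσ hσ1
  refine ⟨K, N₀, hK, fun p I θ hp hI hN => ?_⟩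
  obtain ⟨ℓ, hℓ⟩ := hI
  obtain ⟨hB, hqc, hqn, hφ, hq⟩ := h (fun j => tiltedDensity (p j) θ) (fun j => tMean (p j) θ) I ℓ hℓ
    (fun j hj => (hp j hj).1.regDensity (hp j hj).2.2.2)
    (fun j hj => (hp j hj).1.tameLaw hM hD.le (hp j hj).2.1 (hp j hj).2.2.1 (hp j hj).2.2.2) hN
  set q := normalizedDensity (fun j => tiltedDensity (p j) θ) (fun j => tMean (p j) θ) I ℓ
  have hpr := isProbabilityMeasure_normalizedSumLaw fun j hj => (hp j hj).1
  have hcf : charFun (lawOfDensity q) = charFun (normalizedSumLaw p I θ) := by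
    ext u
    rw [hφ, charFun_normalizedSumLaw fun j hj => (hp j hj).1]
  have hfin : IsFiniteMeasure (lawOfDensity q) := by
    have hi : Integrable q := by
      have hc : Continuous (sumDensity (fun j => tiltedDensity (p j) θ) I ℓ) := by
        have := isProbabilityMeasure_sumLaw (ν := fun j => lawOfDensity (tiltedDensity (p j) θ))
          (I := I.erase ℓ)
          fun j hj => (hp j (Finset.mem_of_mem_erase hj)).1.isProbabilityMeasure
        exact continuous_smooth ((hp ℓ hℓ).1.regDensity (hp ℓ hℓ).2.2.2) hD.le
      have hl := lawOfDensity_sumDensity hD.le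
        (fun j hj => (hp j hj).1.regDensity (hp j hj).2.2.2) hℓ
      have := isProbabilityMeasure_sumLaw (ν := fun j => lawOfDensity (tiltedDensity (p j) θ))
          fun j hj => (hp j hj).1.isProbabilityMeasure
      rw [← hl] at this
      exact (((integrable_of_isFiniteMeasure_lawOfDensity hc (smooth_nonneg
        ((hp ℓ hℓ).1.regDensity (hp ℓ hℓ).2.2.2))).comp_add_right _).comp_mul_left'
        hB.ne').const_mul _
    exact isFiniteMeasure_withDensity_ofReal hi.2
  have hdens : IsContinuousDensity (normalizedSumLaw p I θ) q :=
    ⟨hqc, hqn, (Measure.ext_of_charFun hcf).symm⟩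
  refine (iInf₂_le q hdens).trans (iSup_le fun x => ?_)
  rw [Real.enorm_eq_ofReal_abs]
  refine ENNReal.ofReal_le_ofReal ?_
  have := hq x
  rwa [sumCumulant_centeredLaw] at this

end Sums

/-! ### The expansion at the random tilts -/

section Assumptions

variable {Ω₀ : Type*} [MeasurableSpace Ω₀] {P₀ : Measure Ω₀} [IsProbabilityMeasure P₀]
  {X : ℕ → Ω₀ → ℝ} {p : ℕ → ℝ → ℝ} {A B α β : EReal}

theorem isOpen_openInterval (a b : EReal) : IsOpen (openInterval a b) := by
  have h : openInterval a b = Real.toEReal ⁻¹' Set.Ioo a b := rfl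
  rw [h]
  exact isOpen_Ioo.preimage continuous_coe_real_ereal

theorem BasicAssumptions.tiltable (hX : BasicAssumptions P₀ X p A B α β) {j : ℕ} (hj : 1 ≤ j)
    {θ : ℝ} (hθ : θ ∈ openInterval α β) : Tiltable (p j) θ where
  contDiff := hX.contDiff j hj
  nonneg := hX.density_nonneg j hj
  prob := by
    rw [← hX.density j hj]
    exact Measure.isProbabilityMeasure_map (hX.measurable j hj).aemeasurable
  mem := by
    have h : integrableExpSet id (lawOfDensity (p j)) = openInterval α β := by
      rw [← hX.mgf_domain j hj, ← hX.density j hj]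
      ext t
      simp only [integrableExpSet, Set.mem_ofPred_eq]
      rw [integrable_map_measure (by fun_prop) (hX.measurable j hj).aemeasurable]
      rfl
    rw [h, (isOpen_openInterval α β).interior_eq]
    exact hθ

/-- The parameter `0` belongs to the domain, so that even the junk value of `tiltOf` does. -/
theorem BasicAssumptions.zero_mem (hX : BasicAssumptions P₀ X p A B α β) :
    (0 : ℝ) ∈ openInterval α β := by
  rw [← hX.mgf_domain 1 le_rfl]
  simp [integrableExpSet]

theorem BasicAssumptions.tiltOf_mem (hX : BasicAssumptions P₀ X p A B α β) (i n : ℕ) (y : ℕ → ℝ) :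
    tiltOf p α β i n y ∈ openInterval α β := by
  unfold tiltOf
  split_ifs with h
  · exact h.choose_spec.1
  · exact hX.zero_mem

/-- Bounds, uniform in the index, on the tilted laws with parameter `θ`. -/
def TiltBounds (p : ℕ → ℝ → ℝ) (m : ℕ) (C : ℝ≥0) (θ : ℝ) : Prop :=
  ∀ j, 1 ≤ j → (1 + (C : ℝ))⁻¹ ≤ tVar (p j) θ ∧ tAbsMoment (p j) (m + 1) θ ≤ C ∧
    tDerivNorm (p j) θ ≤ C

theorem TiltBounds.tilt_bounds {m : ℕ} {C : ℝ≥0} {θ : ℝ} (h : TiltBounds p m C θ) {j : ℕ}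
    (hj : 1 ≤ j) : ((1 + (C : ℝ))⁻¹) ^ 2 ≤ tVar (p j) θ ∧
      tAbsMoment (p j) (m + 1) θ ≤ ENNReal.ofReal C ∧
      tDerivNorm (p j) θ ≤ ENNReal.ofReal (C + 1) := by
  obtain ⟨h1, h2, h3⟩ := h j hj
  have hC : (0 : ℝ) ≤ C := C.2
  refine ⟨le_trans ?_ h1, by rwa [ENNReal.ofReal_coe_nnreal], h3.trans ?_⟩
  · exact pow_le_of_le_one (by positivity) (inv_le_one_of_one_le₀ (by linarith)) (by norm_num)
  · rw [← ENNReal.ofReal_coe_nnreal]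
    exact ENNReal.ofReal_le_ofReal (by linarith)

theorem edgeworthExpansionAt_of_tiltBounds (hX : BasicAssumptions P₀ X p A B α β)
    {Ω : ℕ → Type*} [∀ n, MeasurableSpace (Ω n)] {P : ∀ n, Measure (Ω n)}
    {k : ℕ → ℕ} (hk : Tendsto (fun n => n - k n) atTop atTop) {t : ∀ n, ℕ → Ω n → ℝ}
    (ht : ∀ n i ω, t n i ω ∈ openInterval α β) {m : ℕ} (hm : 3 ≤ m)
    (h : ∀ ε : ℝ, 0 < ε → ∃ C : ℝ≥0, ∃ N : ℕ, ∀ n, N ≤ n →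
      P n {ω | ¬ ∀ i : Fin (k n), TiltBounds p m C (t n i ω)} ≤ ENNReal.ofReal ε)
    {e : ℕ} (he : e = 1 ∨ e = 2) : EdgeworthExpansionAt P p k t m e := by
  intro ε hε δ hδ
  obtain ⟨C, N₁, hN₁⟩ := h ε hε
  have hC : (0 : ℝ) ≤ C := C.2
  obtain ⟨K, N₀, hK, hmain⟩ := exists_densityError_le (m := m) (σ := (1 + (C : ℝ))⁻¹) (M := C)
    (D := C + 1) hm hC (by linarith) (by positivity) (inv_le_one_of_one_le₀ (by linarith))
  have hlim : Tendsto (fun n : ℕ => K * ((n - k n : ℕ) : ℝ) ^ (-(1 / 2 : ℝ))) atTop (𝓝 (K * 0)) :=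
    ((tendsto_rpow_neg_atTop (by norm_num)).comp
      (tendsto_natCast_atTop_atTop.comp hk)).const_mul K
  rw [mul_zero] at hlim
  obtain ⟨N₂, hN₂⟩ := eventually_atTop.1 ((hlim.eventually (gt_mem_nhds hδ)).and
    (hk.eventually (eventually_ge_atTop (N₀ + 1))))
  refine ⟨max N₁ N₂, fun n hn => (measure_mono ?_).trans (hN₁ n (le_of_max_le_left hn))⟩
  obtain ⟨hδn, hkn⟩ := hN₂ n (le_of_max_le_right hn)
  intro ω hω hgood
  have hle : (⨆ i : Fin (k n), ((n + 1 - (i + e) : ℕ) : ℝ≥0∞) ^ (((m : ℝ) - 2) / 2) *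
      densityError (normalizedSumLaw p (Finset.Icc (i + e) n) (t n i ω))
        (edgeworthApprox p (Finset.Icc (i + e) n) (t n i ω) m)) ≤ ENNReal.ofReal δ := by
    refine iSup_le fun i => ?_
    have hi := i.2
    have hcard : (Finset.Icc ((i : ℕ) + e) n).card = n + 1 - (i + e) := Nat.card_Icc _ _
    set c := n + 1 - ((i : ℕ) + e) with hc
    have hc1 : n - k n ≤ c := by omega
    have hcN : N₀ + 1 ≤ c := hkn.trans hc1
    have hb := hmain p (Finset.Icc ((i : ℕ) + e) n) (t n i ω)
      (fun j hj => by
        have hj1 : 1 ≤ j := by have := (Finset.mem_Icc.1 hj).1; omega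
        exact ⟨hX.tiltable hj1 (ht n i ω), (hgood i).tilt_bounds hj1⟩)
      (Finset.card_pos.1 (by omega)) (by omega)
    rw [hcard] at hb
    have hc0 : (0 : ℝ) < c := by exact_mod_cast (by omega : 0 < c)
    have h1 : ((c : ℕ) : ℝ≥0∞) ^ (((m : ℝ) - 2) / 2) =
        ENNReal.ofReal ((c : ℝ) ^ (((m : ℝ) - 2) / 2)) := by
      rw [← ENNReal.ofReal_rpow_of_pos hc0, ENNReal.ofReal_natCast]
    rw [h1]
    refine (mul_le_mul_right hb _).trans ?_
    rw [← ENNReal.ofReal_mul (by positivity)]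
    refine ENNReal.ofReal_le_ofReal ?_
    have h2 : (c : ℝ) ^ (((m : ℝ) - 2) / 2) * (K * (c : ℝ) ^ (-((m : ℝ) - 1) / 2)) =
        K * (c : ℝ) ^ (-(1 / 2 : ℝ)) := by
      rw [mul_left_comm, ← Real.rpow_add hc0]
      congr 2
      ring
    rw [h2]
    refine le_trans ?_ hδn.le
    have hn0 : (0 : ℝ) < (n - k n : ℕ) := by exact_mod_cast (by omega : 0 < n - k n)
    gcongr K * ?_
    exact Real.rpow_le_rpow_of_nonpos hn0 (by exact_mod_cast hc1) (by norm_num)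
  exact absurd hω hle.not_gt

theorem edgeworthExpansionAt_of_isBigOProb (hX : BasicAssumptions P₀ X p A B α β)
    {Ω : ℕ → Type*} [∀ n, MeasurableSpace (Ω n)] {P : ∀ n, Measure (Ω n)}
    {k : ℕ → ℕ} (hk : Tendsto (fun n => n - k n) atTop atTop) {t : ∀ n, ℕ → Ω n → ℝ}
    (ht : ∀ n i ω, t n i ω ∈ openInterval α β) {m : ℕ} (hm : 3 ≤ m)
    (h₁ : IsBigOProb P (fun n ω => ⨆ i : Fin (k n), ⨆ (j : ℕ) (_ : 1 ≤ j),
      (ENNReal.ofReal (tVar (p j) (t n i ω)))⁻¹))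
    (h₂ : IsBigOProb P (fun n ω => ⨆ i : Fin (k n), ⨆ (j : ℕ) (_ : 1 ≤ j),
      tAbsMoment (p j) (m + 1) (t n i ω)))
    (h₃ : IsBigOProb P (fun n ω => ⨆ i : Fin (k n), ⨆ (j : ℕ) (_ : 1 ≤ j),
      tDerivNorm (p j) (t n i ω)))
    {e : ℕ} (he : e = 1 ∨ e = 2) : EdgeworthExpansionAt P p k t m e := by
  refine edgeworthExpansionAt_of_tiltBounds hX hk ht hm (fun ε hε => ?_) he
  obtain ⟨C₁, N₁, H₁⟩ := h₁ (ε / 3) (by positivity)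
  obtain ⟨C₂, N₂, H₂⟩ := h₂ (ε / 3) (by positivity)
  obtain ⟨C₃, N₃, H₃⟩ := h₃ (ε / 3) (by positivity)
  refine ⟨C₁ + C₂ + C₃, N₁ + N₂ + N₃, fun n hn => ?_⟩
  have hsum : ENNReal.ofReal (ε / 3) + ENNReal.ofReal (ε / 3) + ENNReal.ofReal (ε / 3) =
      ENNReal.ofReal ε := by
    rw [← ENNReal.ofReal_add (by positivity) (by positivity),
      ← ENNReal.ofReal_add (by positivity) (by positivity)]
    congr 1; ring
  rw [← hsum]
  refine le_trans (measure_mono ?_) ((measure_union_le _ _).trans (add_le_add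
    ((measure_union_le _ _).trans (add_le_add (H₁ n (by omega)) (H₂ n (by omega))))
    (H₃ n (by omega))))
  intro ω hω
  by_contra hcon
  simp only [Set.mem_union, Set.mem_ofPred_eq, not_or, not_lt] at hcon
  obtain ⟨⟨g₁, g₂⟩, g₃⟩ := hcon
  refine hω fun i j hj => ⟨?_, ?_, ?_⟩
  · have h := ((le_iSup₂_of_le (f := fun (j : ℕ) (_ : 1 ≤ j) =>
      (ENNReal.ofReal (tVar (p j) (t n i ω)))⁻¹) j hj le_rfl).trans
      (le_iSup (fun i : Fin (k n) => ⨆ (j : ℕ) (_ : 1 ≤ j),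
      (ENNReal.ofReal (tVar (p j) (t n i ω)))⁻¹) i)).trans g₁
    by_contra! hlt
    have hpos : (0 : ℝ) < 1 + ((C₁ + C₂ + C₃ : ℝ≥0) : ℝ) := by positivity
    have h1 : ENNReal.ofReal (tVar (p j) (t n i ω)) ≤
        ENNReal.ofReal ((1 + ((C₁ + C₂ + C₃ : ℝ≥0) : ℝ))⁻¹) := ENNReal.ofReal_le_ofReal hlt.le
    rw [ENNReal.ofReal_inv_of_pos hpos] at h1
    have h2 := ENNReal.inv_le_inv.2 h1
    rw [inv_inv] at h2
    have h3 := h2.trans h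
    rw [← ENNReal.ofReal_coe_nnreal] at h3
    have h4 : (1 : ℝ) + ((C₁ + C₂ + C₃ : ℝ≥0) : ℝ) ≤ C₁ :=
      (ENNReal.ofReal_le_ofReal_iff C₁.coe_nonneg).1 h3
    rw [NNReal.coe_add, NNReal.coe_add] at h4
    linarith [C₂.coe_nonneg, C₃.coe_nonneg]
  · refine ((le_iSup₂_of_le (f := fun (j : ℕ) (_ : 1 ≤ j) =>
      tAbsMoment (p j) (m + 1) (t n i ω)) j hj le_rfl).trans
      (le_iSup (fun i : Fin (k n) => ⨆ (j : ℕ) (_ : 1 ≤ j),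
      tAbsMoment (p j) (m + 1) (t n i ω)) i)).trans (g₂.trans ?_)
    exact_mod_cast le_add_right (le_add_left le_rfl)
  · refine ((le_iSup₂_of_le (f := fun (j : ℕ) (_ : 1 ≤ j) =>
      tDerivNorm (p j) (t n i ω)) j hj le_rfl).trans
      (le_iSup (fun i : Fin (k n) => ⨆ (j : ℕ) (_ : 1 ≤ j),
      tDerivNorm (p j) (t n i ω)) i)).trans (g₃.trans ?_)
    exact_mod_cast le_add_left le_rfl

end Assumptions

/-! ### A local limit theorem -/

theorem exists_abs_hermite_mul_gaussianPDFReal_le (k : ℕ) :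
    ∃ C : ℝ, 0 ≤ C ∧ ∀ x : ℝ,
      |Polynomial.aeval x (Polynomial.hermite k) * gaussianPDFReal 0 1 x| ≤ C := by
  refine ⟨∫ ξ : ℝ, |ξ| ^ k * Real.exp (-ξ ^ 2 / 2), integral_nonneg fun ξ => by positivity,
    fun x => ?_⟩
  have h1 := congrArg norm (integral_pow_mul_exp_mul_exp k x)
  rw [Complex.norm_real, norm_mul, Real.norm_of_nonneg (by positivity), Real.norm_eq_abs] at h1
  have h2 := norm_integral_le_integral_norm (μ := volume) (fun ξ : ℝ => (ξ * Complex.I) ^ k *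
    Complex.exp (-(ξ : ℂ) ^ 2 / 2) * Complex.exp (-(ξ * x * Complex.I)))
  simp_rw [norm_pow_mul_exp_mul_exp] at h2
  rw [h1] at h2
  refine le_trans (le_mul_of_one_le_left (abs_nonneg _) ?_) h2
  linarith [Real.pi_gt_three]

theorem exists_abs_gaussianPDFReal_mul_edgeworthPoly_le (m : ℕ) {K : ℝ} (hK : 0 ≤ K) {ν : ℕ}
    (hν : ν ∈ Finset.Icc 3 m) :
    ∃ C : ℝ, 0 ≤ C ∧ ∀ (lam : ℕ → ℝ) (η : ℝ), 0 ≤ η → η ≤ 1 →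
      (∀ l ∈ Finset.Icc 1 (m - 2), |lam (l + 2) / ((l + 2).factorial : ℝ)| ≤ K * η ^ l) →
      ∀ x, |gaussianPDFReal 0 1 x * edgeworthPoly lam ν x| ≤ C * η := by
  choose G hG0 hG using exists_abs_hermite_mul_gaussianPDFReal_le
  refine ⟨∑ s ∈ Finset.range (ν - 2 + 1), K ^ s * (((ν - 2 : ℕ) : ℝ) + 1) ^ s * G (ν - 2 + 2 * s),
    Finset.sum_nonneg fun s _ => mul_nonneg (by positivity) (hG0 _), fun lam η h0 h1 hl x => ?_⟩
  have hν' := Finset.mem_Icc.1 hν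
  unfold edgeworthPoly
  rw [Finset.mul_sum, Finset.sum_mul]
  refine (Finset.abs_sum_le_sum_abs _ _).trans (Finset.sum_le_sum fun s _ => ?_)
  have hc := norm_coeff_pow_le hK h0 (norm_coeff_sum_monomial_le
    (a := fun l => lam (l + 2) / ((l + 2).factorial : ℝ)) (R := ν - 2) hK h0 fun l hl' => hl l <| by
      have := Finset.mem_Icc.1 hl'
      exact Finset.mem_Icc.2 ⟨this.1, by omega⟩) s (ν - 2)
  rw [mul_left_comm, abs_mul, abs_div, Nat.abs_cast, mul_comm (gaussianPDFReal 0 1 x)]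
  have h3 : (1 : ℝ) ≤ s.factorial := by exact_mod_cast Nat.factorial_pos s
  have h4 : η ^ (ν - 2) ≤ η := pow_le_of_le_one h0 h1 (by omega)
  calc _ ≤ (η * K ^ s * (((ν - 2 : ℕ) : ℝ) + 1) ^ s) * G (ν - 2 + 2 * s) := by
        gcongr
        · refine (div_le_self (abs_nonneg _) h3).trans (hc.trans ?_)
          gcongr
        · exact hG _ x
    _ = _ := by ring

/-- The local limit theorem for the density of a normalized sum. -/
theorem exists_abs_normalizedDensity_sub_gaussianPDFReal_le {m : ℕ} {σ M D : ℝ} (hm : 3 ≤ m)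
    (hM : 0 ≤ M) (hD : 0 < D) (hσ : 0 < σ) (hσ1 : σ ≤ 1) :
    ∃ K : ℝ, ∃ N₀ : ℕ, 0 ≤ K ∧ ∀ (f : ℕ → ℝ → ℝ) (μ : ℕ → ℝ) (I : Finset ℕ) (ℓ : ℕ), ℓ ∈ I →
      (∀ j ∈ I, RegDensity D (f j)) →
      (∀ j ∈ I, TameLaw m σ M D (centeredLaw (f j) (μ j))) → N₀ ≤ I.card →
      ∀ x, |normalizedDensity f μ I ℓ x - gaussianPDFReal 0 1 x| ≤
        K * (I.card : ℝ) ^ (-(1 / 2) : ℝ) := by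
  obtain ⟨K₁, N₀, hK₁, hE⟩ := exists_abs_normalizedDensity_sub_le hm hM hD hσ hσ1
  obtain ⟨K₂, hK₂, hlam⟩ := exists_sumCumulant_le m M hσ hσ1
  choose! G hG0 hG using fun (ν : ℕ) (hν : ν ∈ Finset.Icc 3 m) =>
    exists_abs_gaussianPDFReal_mul_edgeworthPoly_le m (zero_le_one.trans hK₂) hν
  refine ⟨K₁ + ∑ ν ∈ Finset.Icc 3 m, G ν, N₀, add_nonneg hK₁ (Finset.sum_nonneg hG0),
    fun f μ I ℓ hℓ hf ht hI x => ?_⟩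
  have hcard : (1 : ℝ) ≤ I.card := by exact_mod_cast Finset.card_pos.2 ⟨ℓ, hℓ⟩
  have hc0 : (0 : ℝ) ≤ I.card := by linarith
  set ρ : ℝ := (I.card : ℝ) ^ (1 / 8 : ℝ) with hρ
  have hρ1 : 1 ≤ ρ := Real.one_le_rpow hcard (by norm_num)
  have hρ8 : ρ ^ 8 = I.card := by
    rw [hρ, ← Real.rpow_natCast, ← Real.rpow_mul hc0]
    norm_num
  have hη : 1 / ρ ^ 4 = (I.card : ℝ) ^ (-(1 / 2) : ℝ) := by
    rw [hρ, ← Real.rpow_natCast, ← Real.rpow_mul hc0, one_div, ← Real.rpow_neg hc0]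
    norm_num
  set η : ℝ := (I.card : ℝ) ^ (-(1 / 2) : ℝ) with hηd
  have hη0 : 0 ≤ η := Real.rpow_nonneg hc0 _
  have hη1 : η ≤ 1 := Real.rpow_le_one_of_one_le_of_nonpos hcard (by norm_num)
  have hl := hlam D (fun j => centeredLaw (f j) (μ j)) I ρ ht hρ1 hρ8
  rw [hη] at hl
  have h1 := (hE f μ I ℓ hℓ hf ht hI).2.2.2.2 x
  set L := sumCumulant (fun j => centeredLaw (f j) (μ j)) I
  have h2 : |gaussianPDFReal 0 1 x * ∑ ν ∈ Finset.Icc 3 m, edgeworthPoly L ν x| ≤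
      (∑ ν ∈ Finset.Icc 3 m, G ν) * η := by
    rw [Finset.mul_sum, Finset.sum_mul]
    exact (Finset.abs_sum_le_sum_abs _ _).trans
      (Finset.sum_le_sum fun ν hν => hG ν hν L η hη0 hη1 hl x)
  have h3 : (I.card : ℝ) ^ (-((m : ℝ) - 1) / 2) ≤ η := by
    refine Real.rpow_le_rpow_of_exponent_le hcard ?_
    have : (3 : ℝ) ≤ m := by exact_mod_cast hm
    linarith
  have h4 : K₁ * (I.card : ℝ) ^ (-((m : ℝ) - 1) / 2) ≤ K₁ * η := by gcongr
  rw [mul_add, mul_one] at h1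
  rw [abs_le] at *
  constructor <;> linarith [h1.1, h1.2, h2.1, h2.2]

/-- The density of a sum is of the order of the inverse of its standard deviation: at most so
everywhere, and at least so at the mean. -/
theorem exists_sumDensity_bounds {m : ℕ} {σ M D : ℝ} (hm : 3 ≤ m)
    (hM : 0 ≤ M) (hD : 0 < D) (hσ : 0 < σ) (hσ1 : σ ≤ 1) :
    ∃ N₀ : ℕ, ∀ (f : ℕ → ℝ → ℝ) (μ : ℕ → ℝ) (I : Finset ℕ) (ℓ : ℕ), ℓ ∈ I →
      (∀ j ∈ I, RegDensity D (f j)) →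
      (∀ j ∈ I, TameLaw m σ M D (centeredLaw (f j) (μ j))) → N₀ ≤ I.card →
      1 ≤ 4 * √(1 + M) * √I.card * sumDensity f I ℓ (∑ j ∈ I, μ j) ∧
      ∀ u, σ * √I.card * sumDensity f I ℓ u ≤ 1 := by
  obtain ⟨K, N₀, hK, h⟩ := exists_abs_normalizedDensity_sub_gaussianPDFReal_le hm hM hD hσ hσ1
  have hlim : Tendsto (fun n : ℕ => K * (n : ℝ) ^ (-(1 / 2) : ℝ)) atTop (𝓝 (K * 0)) :=
    ((tendsto_rpow_neg_atTop (by norm_num)).comp tendsto_natCast_atTop_atTop).const_mul K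
  rw [mul_zero] at hlim
  obtain ⟨N₁, hN₁⟩ := eventually_atTop.1
    (hlim.eventually (gt_mem_nhds (show (0 : ℝ) < 1 / 8 by norm_num)))
  refine ⟨max N₀ N₁, fun f μ I ℓ hℓ hf ht hI => ?_⟩
  have hq := h f μ I ℓ hℓ hf ht (le_of_max_le_left hI)
  have hsmall := (hN₁ _ (le_of_max_le_right hI)).le
  have hg0 : ∀ x, 0 ≤ sumDensity f I ℓ x := smooth_nonneg (hf ℓ hℓ)
  have hcard : (0 : ℝ) < I.card := by exact_mod_cast Finset.card_pos.2 ⟨ℓ, hℓ⟩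
  have hB1 : sumSd (fun j => centeredLaw (f j) (μ j)) I ≤ √(1 + M) * √I.card := by
    rw [← Real.sqrt_mul (by linarith)]
    refine Real.le_sqrt_of_sq_le ((sumSd_sq_le ht hm).trans (le_of_eq (mul_comm _ _)))
  have hB2 : σ * √I.card ≤ sumSd (fun j => centeredLaw (f j) (μ j)) I := by
    have := le_sumSd ht (ρ := (I.card : ℝ) ^ (1 / 8 : ℝ)) (by
      rw [← Real.rpow_natCast, ← Real.rpow_mul hcard.le]; norm_num)
    rw [← Real.rpow_natCast, ← Real.rpow_mul hcard.le] at this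
    rw [Real.sqrt_eq_rpow]
    norm_num at this ⊢
    exact this
  set B := sumSd (fun j => centeredLaw (f j) (μ j)) I with hB
  have hB0 : 0 < B := lt_of_lt_of_le (by positivity) hB2
  have hs1 : √(2 * Real.pi) ≤ 8 / 3 := by
    rw [Real.sqrt_le_left (by norm_num)]
    linarith [Real.pi_lt_d2]
  have hs2 : 2 ≤ √(2 * Real.pi) := by
    rw [Real.le_sqrt (by norm_num) (by positivity)]
    linarith [Real.pi_gt_three]
  constructor
  · have h0 := hq 0
    have hg : gaussianPDFReal 0 1 0 = (√(2 * Real.pi))⁻¹ := by simp [gaussianPDFReal]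
    have hg1 : 3 / 8 ≤ (√(2 * Real.pi))⁻¹ := by
      rw [le_inv_comm₀ (by norm_num) (by linarith)]
      exact hs1.trans (by norm_num)
    have hq0 : normalizedDensity f μ I ℓ 0 = B * sumDensity f I ℓ (∑ j ∈ I, μ j) := by
      unfold normalizedDensity
      rw [mul_zero, zero_add]
    rw [hg, hq0] at h0
    have h1 : 1 / 4 ≤ B * sumDensity f I ℓ (∑ j ∈ I, μ j) := by linarith [(abs_le.1 h0).1]
    have h2 : B * sumDensity f I ℓ (∑ j ∈ I, μ j) ≤
        √(1 + M) * √I.card * sumDensity f I ℓ (∑ j ∈ I, μ j) :=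
      mul_le_mul_of_nonneg_right hB1 (hg0 _)
    linarith
  · intro u
    have h0 := hq ((u - ∑ j ∈ I, μ j) / B)
    have hqu : normalizedDensity f μ I ℓ ((u - ∑ j ∈ I, μ j) / B) = B * sumDensity f I ℓ u := by
      unfold normalizedDensity
      rw [mul_div_cancel₀ _ hB0.ne', sub_add_cancel]
    have hg : gaussianPDFReal 0 1 ((u - ∑ j ∈ I, μ j) / B) ≤ 1 / 2 := by
      unfold gaussianPDFReal
      rw [NNReal.coe_one, mul_one]
      have he : Real.exp (-((u - ∑ j ∈ I, μ j) / B - 0) ^ 2 / (2 * 1)) ≤ 1 :=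
        Real.exp_le_one_iff.2 (by
          have := sq_nonneg ((u - ∑ j ∈ I, μ j) / B - 0)
          linarith)
      refine (mul_le_of_le_one_right (by positivity) he).trans ?_
      rw [inv_le_comm₀ (by linarith) (by norm_num)]
      exact le_trans (by norm_num) hs2
    rw [hqu] at h0
    have h2 : σ * √I.card * sumDensity f I ℓ u ≤ B * sumDensity f I ℓ u :=
      mul_le_mul_of_nonneg_right hB2 (hg0 _)
    linarith [(abs_le.1 h0).2]

/-- The density of a partial sum, compared with the density of the full sum at its mean: the
quotient is bounded in terms of the number of the remaining summands alone. -/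
theorem exists_sumDensity_le_mul {m : ℕ} {σ M D : ℝ} (hm : 3 ≤ m)
    (hM : 0 ≤ M) (hD : 0 < D) (hσ : 0 < σ) (hσ1 : σ ≤ 1) :
    ∃ C : ℝ, ∃ N₀ : ℕ, 0 ≤ C ∧ ∀ (f : ℕ → ℝ → ℝ) (μ : ℕ → ℝ) (I J : Finset ℕ) (ℓ : ℕ),
      ℓ ∈ I → I ⊆ J → (∀ j ∈ J, RegDensity D (f j)) →
      (∀ j ∈ J, TameLaw m σ M D (centeredLaw (f j) (μ j))) → N₀ ≤ J.card →
      0 < sumDensity f J ℓ (∑ j ∈ J, μ j) ∧ ∀ u, sumDensity f I ℓ u ≤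
        C * (1 + (J.card - I.card)) * sumDensity f J ℓ (∑ j ∈ J, μ j) := by
  obtain ⟨N₀, h⟩ := exists_sumDensity_bounds hm hM hD hσ hσ1
  refine ⟨4 * √(1 + M) * (σ⁻¹ + D * (N₀ + 1)), N₀, by positivity,
    fun f μ I J ℓ hℓ hIJ hf ht hJ => ?_⟩
  obtain ⟨hlow, -⟩ := h f μ J ℓ (hIJ hℓ) hf ht hJ
  set g := sumDensity f J ℓ (∑ j ∈ J, μ j) with hg
  have hg0 : 0 ≤ g := smooth_nonneg (hf ℓ (hIJ hℓ)) _
  have hi : (1 : ℝ) ≤ I.card := by exact_mod_cast Finset.card_pos.2 ⟨ℓ, hℓ⟩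
  have hij : (I.card : ℝ) ≤ J.card := by exact_mod_cast Finset.card_le_card hIJ
  set i : ℝ := (I.card : ℝ)
  set n : ℝ := (J.card : ℝ)
  set L : ℝ := 1 + (n - i) with hL
  have hL1 : 1 ≤ L := by linarith
  have hn : n ≤ i * L := by nlinarith
  have hM1 : 0 < √(1 + M) := Real.sqrt_pos.2 (by linarith)
  refine ⟨lt_of_le_of_ne hg0 fun h0 => ?_, fun u => ?_⟩
  · rw [← h0, mul_zero] at hlow
    linarith
  have hu0 : 0 ≤ sumDensity f I ℓ u := smooth_nonneg (hf ℓ (hIJ hℓ)) _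
  have hsn : √n ≤ √i * L := by
    refine (Real.sqrt_le_sqrt hn).trans ?_
    rw [Real.sqrt_mul (by linarith)]
    gcongr
    exact Real.sqrt_le_self_iff.2 (Or.inr hL1)
  -- `√n · sumDensity f I ℓ u` is bounded by a multiple of `L`, in two cases.
  have key : √n * sumDensity f I ℓ u ≤ (σ⁻¹ + D * (N₀ + 1)) * L := by
    by_cases hI : N₀ ≤ I.card
    · have h1 := (h f μ I ℓ hℓ (fun j hj => hf j (hIJ hj)) (fun j hj => ht j (hIJ hj)) hI).2 u
      have h2 : √i * sumDensity f I ℓ u ≤ σ⁻¹ := by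
        rw [← one_div, le_div_iff₀ hσ]
        linarith
      calc √n * sumDensity f I ℓ u ≤ (√i * L) * sumDensity f I ℓ u := by gcongr
        _ = (√i * sumDensity f I ℓ u) * L := by ring
        _ ≤ (σ⁻¹ + D * (N₀ + 1)) * L := by
          gcongr
          exact h2.trans (le_add_of_nonneg_right (by positivity))
    · have hiN : i ≤ N₀ + 1 := by
        have : (I.card : ℝ) ≤ ((N₀ + 1 : ℕ) : ℝ) := Nat.cast_le.2 (by omega)
        rwa [Nat.cast_add_one] at this
      have := isProbabilityMeasure_sumLaw (ν := fun j => lawOfDensity (f j)) (I := I.erase ℓ)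
        fun j hj => (hf j (hIJ (Finset.mem_of_mem_erase hj))).prob
      have h1 : sumDensity f I ℓ u ≤ D := smooth_le (hf ℓ (hIJ hℓ)) hD.le u
      have h2 : √i ≤ i := Real.sqrt_le_self_iff.2 (Or.inr hi)
      calc √n * sumDensity f I ℓ u ≤ ((N₀ + 1) * L) * D := by
            gcongr
            refine hsn.trans ?_
            gcongr
            linarith
        _ = (D * (N₀ + 1)) * L := by ring
        _ ≤ _ := by
          gcongr
          exact le_add_of_nonneg_left (by positivity)
  calc sumDensity f I ℓ u ≤ (4 * √(1 + M) * √n * g) * sumDensity f I ℓ u :=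
        le_mul_of_one_le_left hu0 hlow
    _ = (4 * √(1 + M) * g) * (√n * sumDensity f I ℓ u) := by ring
    _ ≤ (4 * √(1 + M) * g) * ((σ⁻¹ + D * (N₀ + 1)) * L) := by gcongr
    _ = _ := by ring

/-! ### The law of a partial sum of the conditioned sample -/

/-- A product of laws with densities has the product density. -/
theorem pi_lawOfDensity {ι : Type*} [Fintype ι] {f : ι → ℝ → ℝ} (hc : ∀ j, Continuous (f j))
    (h0 : ∀ j x, 0 ≤ f j x) (hp : ∀ j, IsProbabilityMeasure (lawOfDensity (f j))) :
    Measure.pi (fun j => lawOfDensity (f j)) =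
      volume.withDensity fun x : ι → ℝ => ∏ j, ENNReal.ofReal (f j (x j)) := by
  refine Measure.pi_eq fun s hs => ?_
  set g : ι → ℝ → ℝ := fun j => (s j).indicator (f j) with hg
  have hg0 : ∀ j x, 0 ≤ g j x := fun j x => Set.indicator_nonneg (fun y _ => h0 j y) x
  have hgi : ∀ j, Integrable (g j) := fun j =>
    (integrable_of_isFiniteMeasure_lawOfDensity (hc j) (h0 j)).indicator (hs j)
  have h1 : ∀ x : ι → ℝ, (Set.univ.pi s).indicator
      (fun x => ∏ j, ENNReal.ofReal (f j (x j))) x = ENNReal.ofReal (∏ j, g j (x j)) := fun x => by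
    rw [ENNReal.ofReal_prod_of_nonneg fun j _ => hg0 j _]
    by_cases hx : x ∈ Set.univ.pi s
    · rw [Set.indicator_of_mem hx]
      refine Finset.prod_congr rfl fun j _ => ?_
      rw [hg]
      simp only [Set.indicator_of_mem (hx j (Set.mem_univ j))]
    · rw [Set.indicator_of_notMem hx]
      simp only [Set.mem_pi, Set.mem_univ, true_imp_iff, not_forall] at hx
      obtain ⟨j, hj⟩ := hx
      rw [Finset.prod_eq_zero (Finset.mem_univ j)]
      rw [hg]
      simp only [Set.indicator_of_notMem hj, ENNReal.ofReal_zero]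
  rw [withDensity_apply _ (MeasurableSet.univ_pi hs), ← lintegral_indicator
    (MeasurableSet.univ_pi hs)]
  simp_rw [h1]
  rw [volume_pi, ← ofReal_integral_eq_lintegral_ofReal (Integrable.fintype_prod hgi)
    (ae_of_all _ fun x => Finset.prod_nonneg fun j _ => hg0 j _),
    integral_fintype_prod_eq_prod, ENNReal.ofReal_prod_of_nonneg
      fun j _ => integral_nonneg (hg0 j)]
  refine Finset.prod_congr rfl fun j _ => ?_
  rw [ofReal_integral_eq_lintegral_ofReal (hgi j) (ae_of_all _ (hg0 j))]
  unfold lawOfDensity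
  rw [withDensity_apply _ (hs j), ← lintegral_indicator (hs j)]
  refine lintegral_congr fun x => ?_
  rw [hg]
  by_cases hx : x ∈ s j
  · simp only [Set.indicator_of_mem hx]
  · simp only [Set.indicator_of_notMem hx, ENNReal.ofReal_zero]

theorem sum_coe_ite_mem {I J : Finset ℕ} (hIJ : I ⊆ J) (z : ↥J → ℝ) :
    ∑ j : ↥J, (if (j : ℕ) ∈ I then z j else 0) = ∑ j : ↥I, z ⟨j, hIJ j.2⟩ := by
  set g : ℕ → ℝ := fun j => if h : j ∈ J then z ⟨j, h⟩ else 0 with hg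
  have h1 : ∀ (j : ℕ) (h : j ∈ J), g j = z ⟨j, h⟩ := fun j h => dif_pos h
  calc _ = ∑ j : ↥J, (fun j : ℕ => if j ∈ I then g j else 0) j :=
        Finset.sum_congr rfl fun j _ => by simp only [h1 j j.2]
    _ = ∑ j : ↥I, g j := by
        rw [Finset.sum_coe_sort J (fun j : ℕ => if j ∈ I then g j else 0), Finset.sum_ite_mem,
          Finset.inter_eq_right.2 hIJ, Finset.sum_coe_sort I g]
    _ = _ := Finset.sum_congr rfl fun j _ => h1 j (hIJ j.2)

/-- Sums over disjoint sets of indices are independent. -/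
theorem map_pi_partialSums {ν : ℕ → Measure ℝ} {J I₁ I₂ : Finset ℕ} (hJ : J = I₁ ∪ I₂)
    (hd : Disjoint I₁ I₂) (hν : ∀ j ∈ J, IsProbabilityMeasure (ν j)) :
    (Measure.pi (fun j : ↥J => ν j)).map
      (fun x => (∑ j : ↥J, if (j : ℕ) ∈ I₁ then x j else 0,
        ∑ j : ↥J, if (j : ℕ) ∈ I₂ then x j else 0)) =
      (sumLaw ν I₁).prod (sumLaw ν I₂) := by
  subst hJ
  -- `measurePreserving_piFinsetUnion` wants a family of laws on all of `ℕ`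
  wlog h : ∀ j, IsProbabilityMeasure (ν j) generalizing ν with H
  · set ν' : ℕ → Measure ℝ := fun j => if j ∈ I₁ ∪ I₂ then ν j else Measure.dirac 0 with hν'
    have h1 : ∀ j, IsProbabilityMeasure (ν' j) := fun j => by
      by_cases hj : j ∈ I₁ ∪ I₂
      · simp only [hν', if_pos hj]; exact hν j hj
      · simp only [hν', if_neg hj]; infer_instance
    have h2 := H (ν := ν') (fun j _ => h1 j) h1
    have e : ∀ I ⊆ I₁ ∪ I₂, (fun j : ↥I => ν' j) = fun j : ↥I => ν j := fun I hI => by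
      funext j
      exact if_pos (hI j.2)
    unfold sumLaw at h2 ⊢
    rwa [e _ subset_rfl, e _ Finset.subset_union_left, e _ Finset.subset_union_right] at h2
  unfold sumLaw
  rw [← (measurePreserving_piFinsetUnion hd ν).map_eq, Measure.map_map ?_ (by fun_prop),
    Measure.map_prod_map _ _ (by fun_prop) (by fun_prop)]
  · congr 1
    funext ⟨x, y⟩
    simp only [Function.comp, Prod.map]
    rw [sum_coe_ite_mem Finset.subset_union_left, sum_coe_ite_mem Finset.subset_union_right]
    congr 1
    · exact Finset.sum_congr rfl fun j _ => Equiv.piFinsetUnion_left (fun _ => ℝ) hd j.2 _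
    · exact Finset.sum_congr rfl fun j _ => Equiv.piFinsetUnion_right (fun _ => ℝ) hd j.2 _
  · refine Measurable.prodMk ?_ ?_ <;>
    · refine Finset.measurable_sum _ fun j _ => ?_
      split_ifs
      · fun_prop
      · fun_prop

theorem lintegral_jointDensity_mul {D : ℝ} {f : ℕ → ℝ → ℝ} {n ℓ : ℕ}
    (hℓ : ℓ ∈ Finset.Icc 1 n) (hf : ∀ j ∈ Finset.Icc 1 n, RegDensity D (f j)) (s : ℝ)
    {G : (↥((Finset.Icc 1 n).erase ℓ) → ℝ) → ℝ≥0∞} (hG : Measurable G) :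
    ∫⁻ x, jointDensity f n ℓ s x * G x =
      ∫⁻ x, ENNReal.ofReal (f ℓ (s - ∑ j, x j)) * G x
        ∂(Measure.pi fun j : ↥((Finset.Icc 1 n).erase ℓ) => lawOfDensity (f j)) := by
  have hm : ∀ j : ↥((Finset.Icc 1 n).erase ℓ), (j : ℕ) ∈ Finset.Icc 1 n := fun j =>
    Finset.mem_of_mem_erase j.2
  have hc : ∀ j : ↥((Finset.Icc 1 n).erase ℓ), Continuous (f j) := fun j => (hf j (hm j)).continuous
  have hcℓ := (hf ℓ hℓ).continuous
  rw [pi_lawOfDensity hc (fun j => (hf j (hm j)).nonneg) (fun j => (hf j (hm j)).prob),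
    lintegral_withDensity_eq_lintegral_mul _ (by fun_prop) (by fun_prop)]
  refine lintegral_congr fun x => ?_
  simp only [Pi.mul_apply, jointDensity, mul_assoc]

theorem lintegral_jointDensity {D : ℝ} (hD : 0 ≤ D) {f : ℕ → ℝ → ℝ} {n ℓ : ℕ}
    (hℓ : ℓ ∈ Finset.Icc 1 n) (hf : ∀ j ∈ Finset.Icc 1 n, RegDensity D (f j)) (s : ℝ) :
    ∫⁻ x, jointDensity f n ℓ s x = ENNReal.ofReal (sumDensity f (Finset.Icc 1 n) ℓ s) := by
  have hcℓ := (hf ℓ hℓ).continuous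
  have := isProbabilityMeasure_sumLaw (ν := fun j => lawOfDensity (f j))
    (I := (Finset.Icc 1 n).erase ℓ) fun j hj => (hf j (Finset.mem_of_mem_erase hj)).prob
  have h := lintegral_jointDensity_mul hℓ hf s (G := fun _ => 1) measurable_const
  simp only [mul_one] at h
  rw [h]
  unfold sumDensity smooth
  rw [ofReal_integral_eq_lintegral_ofReal ((hf ℓ hℓ).integrable_comp_sub hD s)
    (ae_of_all _ fun y => (hf ℓ hℓ).nonneg _)]
  unfold sumLaw
  rw [lintegral_map (by fun_prop) (by fun_prop)]

/-- Conditioning on the sum removes the effect of tilting: the joint densities are proportional. -/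
theorem jointDensity_tiltedDensity {p : ℕ → ℝ → ℝ} {θ : ℝ} {n ℓ : ℕ} (hℓ : ℓ ∈ Finset.Icc 1 n)
    (hp : ∀ j ∈ Finset.Icc 1 n, Tiltable (p j) θ) (s : ℝ)
    (x : ↥((Finset.Icc 1 n).erase ℓ) → ℝ) :
    jointDensity (fun j => tiltedDensity (p j) θ) n ℓ s x =
      ENNReal.ofReal (Real.exp (θ * s) / ∏ j ∈ Finset.Icc 1 n, Phi (p j) θ) *
        jointDensity p n ℓ s x := by
  have hm : ∀ j : ↥((Finset.Icc 1 n).erase ℓ), (j : ℕ) ∈ Finset.Icc 1 n := fun j =>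
    Finset.mem_of_mem_erase j.2
  have hP : 0 < ∏ j ∈ Finset.Icc 1 n, Phi (p j) θ :=
    Finset.prod_pos fun j hj => (hp j hj).Phi_pos
  have h0 : ∀ j : ↥((Finset.Icc 1 n).erase ℓ), 0 ≤ p j (x j) := fun j => (hp j (hm j)).nonneg _
  have ht0 : ∀ j : ↥((Finset.Icc 1 n).erase ℓ), 0 ≤ tiltedDensity (p j) θ (x j) := fun j =>
    (hp j (hm j)).tiltedDensity_nonneg _
  unfold jointDensity
  simp only
  rw [← ENNReal.ofReal_prod_of_nonneg fun j _ => ht0 j,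
    ← ENNReal.ofReal_prod_of_nonneg fun j _ => h0 j,
    ← ENNReal.ofReal_mul (Finset.prod_nonneg fun j _ => ht0 j),
    ← ENNReal.ofReal_mul (Finset.prod_nonneg fun j _ => h0 j),
    ← ENNReal.ofReal_mul (by positivity)]
  congr 1
  unfold tiltedDensity
  rw [Finset.prod_div_distrib, Finset.prod_mul_distrib, ← Real.exp_sum,
    ← Finset.mul_prod_erase _ _ hℓ, ← Finset.prod_coe_sort ((Finset.Icc 1 n).erase ℓ)
      (fun j => Phi (p j) θ), ← Finset.mul_sum]
  have he : Real.exp (θ * s) = Real.exp (θ * ∑ j, x j) * Real.exp (θ * (s - ∑ j, x j)) := by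
    rw [← Real.exp_add]
    congr 1
    ring
  rw [he]
  have h1 : (Phi (p ℓ) θ) ≠ 0 := (hp ℓ hℓ).Phi_pos.ne'
  have h2 : ∏ j : ↥((Finset.Icc 1 n).erase ℓ), Phi (p j) θ ≠ 0 :=
    Finset.prod_ne_zero_iff.2 fun j _ => (hp j (hm j)).Phi_pos.ne'
  field_simp

theorem jointDensity_div_lintegral {p : ℕ → ℝ → ℝ} {θ : ℝ} {n ℓ : ℕ} (hℓ : ℓ ∈ Finset.Icc 1 n)
    (hp : ∀ j ∈ Finset.Icc 1 n, Tiltable (p j) θ) (s : ℝ)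
    (x : ↥((Finset.Icc 1 n).erase ℓ) → ℝ) :
    jointDensity p n ℓ s x / ∫⁻ z, jointDensity p n ℓ s z =
      jointDensity (fun j => tiltedDensity (p j) θ) n ℓ s x /
        ∫⁻ z, jointDensity (fun j => tiltedDensity (p j) θ) n ℓ s z := by
  have hP : 0 < ∏ j ∈ Finset.Icc 1 n, Phi (p j) θ :=
    Finset.prod_pos fun j hj => (hp j hj).Phi_pos
  simp_rw [jointDensity_tiltedDensity hℓ hp]
  rw [lintegral_const_mul' _ _ ENNReal.ofReal_ne_top, ENNReal.mul_div_mul_left]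
  · exact (ENNReal.ofReal_pos.2 (by positivity)).ne'
  · exact ENNReal.ofReal_ne_top

/-- The law of a final partial sum of the conditioned sample has a density with respect to the
law of the same partial sum of independent tilted variables, a quotient of densities of sums. -/
theorem IsConditionedSample.measure_sum_mem_le {Ω : Type*} [MeasurableSpace Ω] {μ : Measure Ω}
    {p : ℕ → ℝ → ℝ} {n : ℕ} {s : ℝ} {Y : ℕ → Ω → ℝ} (h : IsConditionedSample μ p n s Y)
    {θ D R : ℝ} (hp : ∀ j ∈ Finset.Icc 1 n, Tiltable (p j) θ) (hD : 0 ≤ D)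
    (hf : ∀ j ∈ Finset.Icc 1 n, RegDensity D (tiltedDensity (p j) θ))
    (hpos : 0 < sumDensity (fun j => tiltedDensity (p j) θ) (Finset.Icc 1 n) 1 s)
    {i : ℕ} (hi : 1 ≤ i) (hin : i < n)
    (hR : ∀ u, sumDensity (fun j => tiltedDensity (p j) θ) (Finset.Icc 1 i) 1 u ≤
      R * sumDensity (fun j => tiltedDensity (p j) θ) (Finset.Icc 1 n) 1 s)
    {S : Set ℝ} (hS : MeasurableSet S) :
    μ {ω | ∑ j ∈ Finset.Icc (i + 1) n, Y j ω ∈ S} ≤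
      ENNReal.ofReal R * sumLaw (fun j => tiltedLaw (p j) θ) (Finset.Icc (i + 1) n) S := by
  set f : ℕ → ℝ → ℝ := fun j => tiltedDensity (p j) θ with hfd
  set ν : ℕ → Measure ℝ := fun j => lawOfDensity (f j) with hν
  set g := sumDensity f (Finset.Icc 1 n) 1 s with hg
  have h1 : (1 : ℕ) ∈ Finset.Icc 1 n := Finset.mem_Icc.2 ⟨le_rfl, by omega⟩
  have hcf := (hf 1 h1).continuous
  set J := (Finset.Icc 1 n).erase 1 with hJd
  set I₁ := (Finset.Icc 1 i).erase 1 with hI₁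
  set I₂ := Finset.Icc (i + 1) n with hI₂
  have hJ : J = I₁ ∪ I₂ := by
    ext j
    simp only [hJd, hI₁, hI₂, Finset.mem_erase, Finset.mem_union, Finset.mem_Icc]
    omega
  have hd : Disjoint I₁ I₂ := by
    rw [Finset.disjoint_left]
    intro j
    simp only [hI₁, hI₂, Finset.mem_erase, Finset.mem_Icc]
    omega
  have hJm : ∀ j ∈ J, j ∈ Finset.Icc 1 n := fun j hj => Finset.mem_of_mem_erase hj
  have hpr : ∀ j ∈ J, IsProbabilityMeasure (ν j) := fun j hj => (hf j (hJm j hj)).prob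
  have hI₁J : I₁ ⊆ J := hJ ▸ Finset.subset_union_left
  have hI₂J : I₂ ⊆ J := hJ ▸ Finset.subset_union_right
  have hp₁ := isProbabilityMeasure_sumLaw fun j hj => hpr j (hI₁J hj)
  have hp₂ := isProbabilityMeasure_sumLaw fun j hj => hpr j (hI₂J hj)
  -- the sums over `I₁` and `I₂` of the coordinates with index other than `1`
  set T₁ : (↥J → ℝ) → ℝ := fun x => ∑ j : ↥J, if (j : ℕ) ∈ I₁ then x j else 0 with hT₁
  set T₂ : (↥J → ℝ) → ℝ := fun x => ∑ j : ↥J, if (j : ℕ) ∈ I₂ then x j else 0 with hT₂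
  have hTm : ∀ I : Finset ℕ, Measurable fun x : ↥J → ℝ =>
      ∑ j : ↥J, if (j : ℕ) ∈ I then x j else 0 := fun I => by
    refine Finset.measurable_sum _ fun j _ => ?_
    split_ifs <;> fun_prop
  have hT₁m : Measurable T₁ := hTm I₁
  have hT₂m : Measurable T₂ := hTm I₂
  have hsum : ∀ x : ↥J → ℝ, ∑ j, x j = T₁ x + T₂ x := fun x => by
    rw [hT₁, hT₂]
    simp only
    rw [← Finset.sum_add_distrib]
    refine Finset.sum_congr rfl fun j _ => ?_
    have hj : (j : ℕ) ∈ I₁ ∪ I₂ := hJ ▸ j.2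
    by_cases hj₁ : (j : ℕ) ∈ I₁
    · rw [if_pos hj₁, if_neg (Finset.disjoint_left.1 hd hj₁), add_zero]
    · rw [if_neg hj₁, if_pos ((Finset.mem_union.1 hj).resolve_left hj₁), zero_add]
  have hYm : Measurable fun ω (j : ↥J) => Y j ω :=
    measurable_pi_lambda _ fun j => h.measurable j (hJm j j.2)
  have hset : {ω | ∑ j ∈ I₂, Y j ω ∈ S} = (fun ω (j : ↥J) => Y j ω) ⁻¹' (T₂ ⁻¹' S) := by
    ext ω
    have : T₂ (fun j : ↥J => Y j ω) = ∑ j ∈ I₂, Y j ω := by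
      rw [hT₂]
      simp only
      rw [sum_coe_ite_mem hI₂J (fun j : ↥J => Y j ω), ← Finset.sum_coe_sort I₂]
    simp only [Set.mem_preimage, this]
    rfl
  have hlaw := h.law (by omega) 1 h1
  rw [hset, ← Measure.map_apply hYm (hT₂m hS), hlaw, withDensity_apply _ (hT₂m hS),
    ← lintegral_indicator (hT₂m hS)]
  have hind : ∀ x, (T₂ ⁻¹' S).indicator (fun x => jointDensity p n 1 s x /
      ∫⁻ z, jointDensity p n 1 s z) x = (ENNReal.ofReal g)⁻¹ * (jointDensity f n 1 s x *
        S.indicator (fun _ => 1) (T₂ x)) := fun x => by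
    by_cases hx : T₂ x ∈ S
    · rw [Set.indicator_of_mem (show x ∈ T₂ ⁻¹' S from hx), Set.indicator_of_mem hx, mul_one,
        jointDensity_div_lintegral h1 hp, lintegral_jointDensity hD h1 hf, mul_comm,
        ENNReal.div_eq_inv_mul, mul_comm]
    · rw [Set.indicator_of_notMem (show x ∉ T₂ ⁻¹' S from hx), Set.indicator_of_notMem hx,
        mul_zero, mul_zero]
  have hSm : Measurable (S.indicator fun _ => (1 : ℝ≥0∞)) := measurable_const.indicator hS
  rw [lintegral_congr hind, lintegral_const_mul' _ _ (by
      rw [ENNReal.inv_ne_top]; exact (ENNReal.ofReal_pos.2 hpos).ne')]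
  have hmul : ∫⁻ x, jointDensity f n 1 s x * S.indicator (fun _ => 1) (T₂ x) =
      ∫⁻ x, ENNReal.ofReal (f 1 (s - ∑ j, x j)) * S.indicator (fun _ => 1) (T₂ x)
        ∂(Measure.pi fun j : ↥J => ν j) :=
    lintegral_jointDensity_mul h1 hf s (hSm.comp hT₂m)
  have hprod : ∫⁻ x, ENNReal.ofReal (f 1 (s - ∑ j, x j)) * S.indicator (fun _ => 1) (T₂ x)
      ∂(Measure.pi fun j : ↥J => ν j) =
      ∫⁻ t, ENNReal.ofReal (sumDensity f (Finset.Icc 1 i) 1 (s - t)) *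
        S.indicator (fun _ => 1) t ∂(sumLaw ν I₂) := by
    have hG : Measurable fun z : ℝ × ℝ => ENNReal.ofReal (f 1 (s - (z.1 + z.2))) *
        S.indicator (fun _ => 1) z.2 :=
      (by fun_prop : Measurable fun z : ℝ × ℝ => ENNReal.ofReal (f 1 (s - (z.1 + z.2)))).mul
        (hSm.comp measurable_snd)
    simp_rw [hsum]
    rw [← lintegral_map (f := fun z : ℝ × ℝ => ENNReal.ofReal (f 1 (s - (z.1 + z.2))) *
        S.indicator (fun _ => 1) z.2) (g := fun x => (T₁ x, T₂ x)) hG (hT₁m.prodMk hT₂m),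
      map_pi_partialSums hJ hd hpr, lintegral_prod_symm _ hG.aemeasurable]
    refine lintegral_congr fun t => ?_
    simp only
    rw [lintegral_mul_const _ (by fun_prop)]
    congr 1
    unfold sumDensity smooth
    rw [ofReal_integral_eq_lintegral_ofReal ((hf 1 h1).integrable_comp_sub hD _)
      (ae_of_all _ fun y => (hf 1 h1).nonneg _)]
    refine lintegral_congr fun u => ?_
    rw [sub_sub, add_comm u t]
  rw [hmul, hprod]
  calc _ ≤ (ENNReal.ofReal g)⁻¹ * ∫⁻ t, ENNReal.ofReal (R * g) * S.indicator (fun _ => 1) t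
        ∂(sumLaw ν I₂) := by
        gcongr with t
        exact hR _
    _ = _ := by
      rw [lintegral_const_mul _ hSm, lintegral_indicator hS, setLIntegral_const, one_mul,
        mul_comm R, ENNReal.ofReal_mul hpos.le, ← mul_assoc, ← mul_assoc,
        ENNReal.inv_mul_cancel (ENNReal.ofReal_pos.2 hpos).ne' ENNReal.ofReal_ne_top, one_mul]
      rfl

/-! ### Large deviations of tilted sums -/

namespace Tiltable

variable {p : ℝ → ℝ} {θ : ℝ}

theorem hasDerivAt_cgf (h : Tiltable p θ) :
    HasDerivAt (cgf id (lawOfDensity p)) (tMean p θ) θ :=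
  (analyticAt_cgf h.mem).differentiableAt.hasDerivAt

theorem hasDerivAt_tMean (h : Tiltable p θ) : HasDerivAt (tMean p) (tVar p θ) θ := by
  have h1 : tVar p θ = deriv (tMean p) θ := by
    have hv := variance_tilted_mul h.mem
    have hprob := h.isProbabilityMeasure
    rw [← h.tiltedLaw_eq, variance_eq_integral (by fun_prop), iteratedDeriv_succ,
      iteratedDeriv_one] at hv
    change _ = deriv (tMean p) θ at hv
    rw [← hv]
    unfold tVar tMoment
    simp only [id]
    rw [h.integral_id_tiltedLaw]
  rw [h1]
  exact (analyticAt_cgf h.mem).deriv.differentiableAt.hasDerivAt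

theorem exp_mul_tiltedDensity (h : Tiltable p θ) {θ' : ℝ} (h' : Tiltable p θ') (x : ℝ) :
    tiltedDensity p θ x * Real.exp ((θ' - θ) * x) =
      (Phi p θ' / Phi p θ) * tiltedDensity p θ' x := by
  have h1 := h.Phi_pos.ne'
  have h2 := h'.Phi_pos.ne'
  have h3 : Real.exp (θ' * x) = Real.exp (θ * x) * Real.exp ((θ' - θ) * x) := by
    rw [← Real.exp_add]
    congr 1
    ring
  unfold tiltedDensity
  rw [h3]
  field_simp

theorem integrable_tiltedDensity (h : Tiltable p θ) : Integrable (tiltedDensity p θ) :=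
  have : IsProbabilityMeasure (lawOfDensity (tiltedDensity p θ)) := h.isProbabilityMeasure
  integrable_of_isFiniteMeasure_lawOfDensity h.contDiff_tiltedDensity.continuous
    h.tiltedDensity_nonneg

theorem integral_tiltedDensity (h : Tiltable p θ) : ∫ x, tiltedDensity p θ x = 1 := by
  have : IsProbabilityMeasure (lawOfDensity (tiltedDensity p θ)) := h.isProbabilityMeasure
  have h1 := integral_lawOfDensity h.contDiff_tiltedDensity.continuous h.tiltedDensity_nonneg
    (fun _ => (1 : ℝ))
  simpa using h1.symm

theorem integrable_exp_tiltedLaw (h : Tiltable p θ) {θ' : ℝ} (h' : Tiltable p θ') :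
    Integrable (fun x => Real.exp ((θ' - θ) * x)) (tiltedLaw p θ) := by
  have hc := h.contDiff_tiltedDensity.continuous
  unfold tiltedLaw lawOfDensity
  rw [integrable_withDensity_iff_integrable_smul' (by fun_prop)
    (ae_of_all _ fun _ => ENNReal.ofReal_lt_top)]
  simp only [ENNReal.toReal_ofReal (h.tiltedDensity_nonneg _), smul_eq_mul,
    h.exp_mul_tiltedDensity h']
  exact h'.integrable_tiltedDensity.const_mul _

theorem integral_exp_tiltedLaw (h : Tiltable p θ) {θ' : ℝ} (h' : Tiltable p θ') :
    ∫ x, Real.exp ((θ' - θ) * x) ∂(tiltedLaw p θ) = 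
      Real.exp (cgf id (lawOfDensity p) θ' - cgf id (lawOfDensity p) θ) := by
  unfold tiltedLaw
  rw [integral_lawOfDensity h.contDiff_tiltedDensity.continuous h.tiltedDensity_nonneg]
  simp only [smul_eq_mul, h.exp_mul_tiltedDensity h']
  rw [integral_const_mul, h'.integral_tiltedDensity, mul_one, Real.exp_sub]
  exact congrArg₂ _ (Real.exp_log h'.Phi_pos).symm (Real.exp_log h.Phi_pos).symm

end Tiltable

/-- Strong convexity of the cumulant generating function where the variance is bounded below. -/
theorem cgf_add_le {p : ℝ → ℝ} {θ₁ θ₂ c : ℝ} (hp : ∀ θ ∈ Set.Icc θ₁ θ₂, Tiltable p θ)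
    (hc : ∀ θ ∈ Set.Icc θ₁ θ₂, c ≤ tVar p θ) {u v : ℝ} (hu : u ∈ Set.Icc θ₁ θ₂)
    (hv : v ∈ Set.Icc θ₁ θ₂) :
    cgf id (lawOfDensity p) v + (u - v) * tMean p v + c * (u - v) ^ 2 / 2 ≤
      cgf id (lawOfDensity p) u := by
  set κ := cgf id (lawOfDensity p) with hκ
  have hg : ∀ θ ∈ Set.Icc θ₁ θ₂,
      HasDerivAt (fun θ => κ θ - c * θ ^ 2 / 2) (tMean p θ - c * θ) θ := fun θ hθ => by
    refine ((hp θ hθ).hasDerivAt_cgf.sub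
      (((hasDerivAt_pow 2 θ).const_mul c).div_const 2)).congr_deriv ?_
    norm_num
    ring
  have hg' : ∀ θ ∈ Set.Icc θ₁ θ₂,
      HasDerivAt (fun θ => tMean p θ - c * θ) (tVar p θ - c) θ := fun θ hθ => by
    refine ((hp θ hθ).hasDerivAt_tMean.sub ((hasDerivAt_id θ).const_mul c)).congr_deriv ?_
    norm_num
  have hconv : ConvexOn ℝ (Set.Icc θ₁ θ₂) (fun θ => κ θ - c * θ ^ 2 / 2) :=
    convexOn_of_hasDerivWithinAt2_nonneg (f' := fun θ => tMean p θ - c * θ)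
      (f'' := fun θ => tVar p θ - c) (convex_Icc _ _)
      (fun θ hθ => (hg θ hθ).continuousAt.continuousWithinAt)
      (fun θ hθ => (hg θ (interior_subset hθ)).hasDerivWithinAt)
      (fun θ hθ => (hg' θ (interior_subset hθ)).hasDerivWithinAt)
      (fun θ hθ => sub_nonneg.2 (hc θ (interior_subset hθ)))
  rcases lt_trichotomy u v with h | rfl | h
  · have h1 := hconv.slope_le_of_hasDerivAt hu hv h (hg v hv)
    rw [slope_def_field, div_le_iff₀ (sub_pos.2 h)] at h1
    nlinarith [h1]
  · simp
  · have h1 := hconv.le_slope_of_hasDerivAt hv hu h (hg v hv)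
    rw [slope_def_field, le_div_iff₀ (sub_pos.2 h)] at h1
    nlinarith [h1]

/-- Chernoff's bound for a sum of tilted variables, with the means at another parameter. -/
theorem sumLaw_tiltedLaw_le {p : ℕ → ℝ → ℝ} {I : Finset ℕ} {θ₁ θ₂ c : ℝ}
    (hp : ∀ j ∈ I, ∀ θ ∈ Set.Icc θ₁ θ₂, Tiltable (p j) θ)
    (hc : ∀ j ∈ I, ∀ θ ∈ Set.Icc θ₁ θ₂, c ≤ tVar (p j) θ) {θ θ' : ℝ} (hθ : θ ∈ Set.Icc θ₁ θ₂)
    (hθ' : θ' ∈ Set.Icc θ₁ θ₂) :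
    sumLaw (fun j => tiltedLaw (p j) θ) I
      {t | (θ' - θ) * ∑ j ∈ I, tMean (p j) θ' ≤ (θ' - θ) * t} ≤
        ENNReal.ofReal (Real.exp (-(c * (θ' - θ) ^ 2 / 2) * I.card)) := by
  have hpr : ∀ j : ↥I, IsProbabilityMeasure (tiltedLaw (p j) θ) := fun j =>
    (hp j j.2 θ hθ).isProbabilityMeasure
  unfold sumLaw
  rw [Measure.map_apply (by fun_prop) (measurableSet_le (by fun_prop) (by fun_prop))]
  have hprod : ∀ x : ↥I → ℝ, Real.exp (1 * ((θ' - θ) * ∑ j, x j)) =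
      ∏ j, Real.exp ((θ' - θ) * x j) := fun x => by
    rw [one_mul, ← Real.exp_sum, Finset.mul_sum]
  have h1 := measure_ge_le_exp_mul_mgf (μ := Measure.pi fun j : ↥I => tiltedLaw (p j) θ)
    (X := fun x => (θ' - θ) * ∑ j, x j) ((θ' - θ) * ∑ j ∈ I, tMean (p j) θ') zero_le_one (by
      simp_rw [hprod]
      exact Integrable.fintype_prod (f := fun (j : ↥I) y => Real.exp ((θ' - θ) * y)) fun j =>
        (hp j j.2 θ hθ).integrable_exp_tiltedLaw (hp j j.2 θ' hθ'))
  have h2 : mgf (fun x : ↥I → ℝ => (θ' - θ) * ∑ j, x j)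
      (Measure.pi fun j : ↥I => tiltedLaw (p j) θ) 1 =
      Real.exp (∑ j ∈ I, (cgf id (lawOfDensity (p j)) θ' - cgf id (lawOfDensity (p j)) θ)) := by
    unfold mgf
    simp_rw [hprod]
    rw [integral_fintype_prod_eq_prod (fun (j : ↥I) y => Real.exp ((θ' - θ) * y)), Real.exp_sum,
      ← Finset.prod_coe_sort I]
    exact Finset.prod_congr rfl fun j _ =>
      (hp j j.2 θ hθ).integral_exp_tiltedLaw (hp j j.2 θ' hθ')
  rw [h2, ← Real.exp_add] at h1
  refine (ENNReal.le_ofReal_iff_toReal_le (measure_ne_top _ _) (Real.exp_pos _).le).2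
    (h1.trans (Real.exp_le_exp.2 ?_))
  rw [neg_one_mul, Finset.mul_sum, ← Finset.sum_neg_distrib, ← Finset.sum_add_distrib]
  refine (Finset.sum_le_card_nsmul _ _ (-(c * (θ' - θ) ^ 2 / 2)) fun j hj => ?_).trans
    (le_of_eq (by rw [nsmul_eq_mul, mul_comm]))
  have := cgf_add_le (hp j hj) (hc j hj) hθ hθ'
  linarith [sub_sq_comm θ θ']

/-! ### Concentration of the random tilts -/

theorem Icc_subset_openInterval {a b : EReal} {x y : ℝ} (hx : x ∈ openInterval a b)
    (hy : y ∈ openInterval a b) : Set.Icc x y ⊆ openInterval a b := fun _ hz =>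
  ⟨hx.1.trans_le (EReal.coe_le_coe_iff.2 hz.1), (EReal.coe_le_coe_iff.2 hz.2).trans_lt hy.2⟩

theorem CondH.exists_lt {α β A B : EReal} {f : ℝ → ℝ} (hf : CondH α β A B f) (hαβ : α < β)
    {a : ℝ} (ha : (a : EReal) < B) : ∃ θ ∈ openInterval α β, a < f θ := by
  obtain ⟨s, hs, hsub⟩ := mem_comap.1 (hf.2.2.eventually (lt_mem_nhds ha))
  obtain ⟨l, hl, hls⟩ := (mem_nhdsLT_iff_exists_Ioo_subset' hαβ).1 hs
  obtain ⟨θ, h1, h2⟩ := EReal.lt_iff_exists_real_btwn.1 (max_lt hαβ hl)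
  have h3 : a < f θ := EReal.coe_lt_coe_iff.1 (hsub (hls ⟨(le_max_right _ _).trans_lt h1, h2⟩))
  exact ⟨θ, ⟨(le_max_left _ _).trans_lt h1, h2⟩, h3⟩

theorem CondH.exists_gt {α β A B : EReal} {f : ℝ → ℝ} (hf : CondH α β A B f) (hαβ : α < β)
    {a : ℝ} (ha : A < (a : EReal)) : ∃ θ ∈ openInterval α β, f θ < a := by
  obtain ⟨s, hs, hsub⟩ := mem_comap.1 (hf.2.1.eventually (gt_mem_nhds ha))
  obtain ⟨l, hl, hls⟩ := (mem_nhdsGT_iff_exists_Ioo_subset' hαβ).1 hs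
  obtain ⟨θ, h1, h2⟩ := EReal.lt_iff_exists_real_btwn.1 (lt_min hαβ hl)
  have h3 : f θ < a := EReal.coe_lt_coe_iff.1 (hsub (hls ⟨h1, h2.trans_le (min_le_right _ _)⟩))
  exact ⟨θ, ⟨h1, h2.trans_le (min_le_left _ _)⟩, h3⟩

section Assumptions

variable {Ω₀ : Type*} [MeasurableSpace Ω₀] {P₀ : Measure Ω₀}
  {X : ℕ → Ω₀ → ℝ} {p : ℕ → ℝ → ℝ} {A B α β : EReal}

theorem BasicAssumptions.strictMonoOn_sum_tMean (hX : BasicAssumptions P₀ X p A B α β)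
    {i n : ℕ} (hin : i < n) :
    StrictMonoOn (fun θ => ∑ j ∈ Finset.Icc (i + 1) n, tMean (p j) θ) (openInterval α β) :=
  fun u hu v hv huv => Finset.sum_lt_sum_of_nonempty (Finset.nonempty_Icc.2 hin) fun j hj =>
    (hX.mean_condH j (by have := (Finset.mem_Icc.1 hj).1; omega)).1 hu hv huv

variable [IsProbabilityMeasure P₀]

theorem BasicAssumptions.continuousOn_sum_tMean (hX : BasicAssumptions P₀ X p A B α β)
    {i n : ℕ} {u v : ℝ} (hu : u ∈ openInterval α β) (hv : v ∈ openInterval α β) :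
    ContinuousOn (fun θ => ∑ j ∈ Finset.Icc (i + 1) n, tMean (p j) θ) (Set.Icc u v) := by
  refine continuousOn_finsetSum _ fun j hj θ hθ => ?_
  exact (hX.tiltable (by have := (Finset.mem_Icc.1 hj).1; omega)
    (Icc_subset_openInterval hu hv hθ)).hasDerivAt_tMean.continuousAt.continuousWithinAt

/-- The tilt lies between two parameters whose mean sums enclose the observed sum. -/
theorem BasicAssumptions.tiltOf_mem_Icc (hX : BasicAssumptions P₀ X p A B α β) {i n : ℕ}
    (hin : i < n) {u v : ℝ} (hu : u ∈ openInterval α β) (hv : v ∈ openInterval α β) (huv : u ≤ v)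
    {y : ℕ → ℝ}
    (h1 : ∑ j ∈ Finset.Icc (i + 1) n, tMean (p j) u < ∑ j ∈ Finset.Icc (i + 1) n, y j)
    (h2 : ∑ j ∈ Finset.Icc (i + 1) n, y j < ∑ j ∈ Finset.Icc (i + 1) n, tMean (p j) v) :
    tiltOf p α β i n y ∈ Set.Icc u v := by
  obtain ⟨θ, hθ, hθy⟩ := intermediate_value_Icc huv (hX.continuousOn_sum_tMean (i := i) (n := n)
    hu hv) ⟨h1.le, h2.le⟩
  have hex : ∃ θ ∈ openInterval α β,
      (∑ j ∈ Finset.Icc (i + 1) n, tMean (p j) θ) / ((n : ℝ) - i) =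
        (∑ j ∈ Finset.Icc (i + 1) n, y j) / ((n : ℝ) - i) :=
    ⟨θ, Icc_subset_openInterval hu hv hθ, by rw [← hθy]⟩
  unfold tiltOf
  rw [dif_pos hex]
  obtain ⟨hm, he⟩ := hex.choose_spec
  have hpos : ((n : ℝ) - i) ≠ 0 := sub_ne_zero.2 (by exact_mod_cast hin.ne')
  rw [div_left_inj' hpos] at he
  have hmono := hX.strictMonoOn_sum_tMean hin
  rw [← he] at h1 h2
  exact ⟨((hmono.lt_iff_lt hu hm).1 h1).le, ((hmono.lt_iff_lt hm hv).1 h2).le⟩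

/-- Under the assumptions on compact sets, there are bounds that hold for the tilt with index `i`
except for an event whose probability is summable in `n - i`. -/
theorem exists_measure_not_tiltBounds_le (hX : BasicAssumptions P₀ X p A B α β) {a : ℝ}
    (ha : a ∈ openInterval A B) {m : ℕ} (hm : 3 ≤ m) (hUf : AssumptionUf p A B α β)
    (hCv : AssumptionCv p α β) (hAM : AssumptionAM p α β (m + 1)) (hCf : AssumptionCf p α β) :
    ∃ (C : ℝ≥0) (b : ℕ → ℝ≥0∞) (N : ℕ), ∑' l, b l ≠ ∞ ∧ ∀ n, N ≤ n → ∀ i < n,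
      ∀ {Ω : Type*} [MeasurableSpace Ω] (μ : Measure Ω) (Y : ℕ → Ω → ℝ),
        IsConditionedSample μ p n (n * a) Y →
        μ {ω | ¬ TiltBounds p m C (tiltOf p α β i n fun j => Y j ω)} ≤ b (n - i) := by
  obtain ⟨fp, fm, hfp, hfm, hle⟩ := hUf
  have h0 := hX.zero_mem
  have hαβ : α < β := h0.1.trans h0.2
  obtain ⟨lo, hlo, hlo'⟩ := hfp.exists_gt hαβ ha.1
  obtain ⟨hi, hhi, hhi'⟩ := hfm.exists_lt hαβ ha.2
  have hmlo : ∀ j, 1 ≤ j → tMean (p j) lo < a := fun j hj => (hle j hj lo hlo).2.trans_lt hlo'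
  have hmhi : ∀ j, 1 ≤ j → a < tMean (p j) hi := fun j hj => hhi'.trans_le (hle j hj hi hhi).1
  have hlohi : lo < hi := ((hX.mean_condH 1 le_rfl).1.lt_iff_lt hlo hhi).1
    ((hmlo 1 le_rfl).trans (hmhi 1 le_rfl))
  -- the tilts with total mean `n a` lie in `[lo, hi]`; a random tilt may leave `[lo - δ, hi + δ]`
  -- only if it deviates from such a tilt by more than `δ`
  obtain ⟨ε₁, hε₁, hball₁⟩ := Metric.isOpen_iff.1 (isOpen_openInterval α β) lo hlo
  obtain ⟨ε₂, hε₂, hball₂⟩ := Metric.isOpen_iff.1 (isOpen_openInterval α β) hi hhi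
  obtain ⟨δ, hδ, hδ'⟩ := exists_between (lt_min hε₁ hε₂)
  have hθ₁ : lo - δ ∈ openInterval α β := hball₁ (by
    rw [Metric.mem_ball, Real.dist_eq, sub_sub_cancel_left, abs_neg, abs_of_pos hδ]
    exact hδ'.trans_le (min_le_left _ _))
  have hθ₂ : hi + δ ∈ openInterval α β := hball₂ (by
    rw [Metric.mem_ball, Real.dist_eq, add_sub_cancel_left, abs_of_pos hδ]
    exact hδ'.trans_le (min_le_right _ _))
  set K := Set.Icc (lo - δ) (hi + δ) with hKd
  have hK : K ⊆ openInterval α β := Icc_subset_openInterval hθ₁ hθ₂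
  obtain ⟨c, _, hc, hcK⟩ := hCv K isCompact_Icc hK
  obtain ⟨C₁, hC₁⟩ := hAM K isCompact_Icc hK
  obtain ⟨C₂, hC₂⟩ := hCf K isCompact_Icc hK
  set C : ℝ≥0 := C₁ + C₂ + Real.toNNReal c⁻¹ with hCd
  have hC0 : (0 : ℝ) ≤ C := C.2
  have hCc : (1 + (C : ℝ))⁻¹ ≤ c := by
    refine inv_le_of_inv_le₀ hc ?_
    have : (C : ℝ) = C₁ + C₂ + c⁻¹ := by
      rw [hCd, NNReal.coe_add, NNReal.coe_add, Real.coe_toNNReal _ (inv_pos.2 hc).le]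
    rw [this]
    linarith [C₁.coe_nonneg, C₂.coe_nonneg]
  have hTB : ∀ θ ∈ K, TiltBounds p m C θ := fun θ hθ j hj => by
    refine ⟨hCc.trans (hcK j hj θ hθ).1, (hC₁ j hj θ hθ).trans ?_, (hC₂ j hj θ hθ).trans ?_⟩
    · exact_mod_cast le_add_right (le_add_right le_rfl)
    · exact_mod_cast le_add_right (le_add_left le_rfl)
  set σ : ℝ := (1 + (C : ℝ))⁻¹ with hσd
  have hσ : 0 < σ := by positivity
  obtain ⟨R, N₀, hR, hratio⟩ := exists_sumDensity_le_mul (m := m) (σ := σ) (M := C) (D := C + 1)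
    hm hC0 (by linarith) hσ (inv_le_one_of_one_le₀ (by linarith))
  set r : ℝ := σ * δ ^ 2 / 2 with hr
  have hr0 : 0 < r := by positivity
  refine ⟨C, fun l => ENNReal.ofReal (2 * (R * (1 + l) * Real.exp (-r * l))), N₀, ?_, ?_⟩
  · refine Summable.tsum_ofReal_ne_top (Summable.mul_left _ ?_)
    have h1 := ((Real.summable_pow_mul_exp_neg_nat_mul 0 hr0).add
      (Real.summable_pow_mul_exp_neg_nat_mul 1 hr0)).mul_left R
    refine h1.congr fun l => ?_
    rw [pow_zero, pow_one]
    ring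
  intro n hn i hin Ω _ μ Y hY
  have hna : ∑ j ∈ Finset.Icc (0 + 1) n, a = n * a := by simp
  have hne : (Finset.Icc (0 + 1) n).Nonempty := Finset.nonempty_Icc.2 (by omega)
  -- the parameter `θ ∈ [lo, hi]` at which the tilted variables have total mean `n a`
  obtain ⟨θ, hθ, hθa⟩ := intermediate_value_Icc hlohi.le
    (hX.continuousOn_sum_tMean (i := 0) (n := n) hlo hhi) (show n * a ∈ Set.Icc _ _ by
      rw [← hna]
      exact ⟨Finset.sum_le_sum fun j hj => (hmlo j (Finset.mem_Icc.1 hj).1).le,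
        Finset.sum_le_sum fun j hj => (hmhi j (Finset.mem_Icc.1 hj).1).le⟩)
  simp only [zero_add] at hθa
  have hθK : θ ∈ K := ⟨by linarith [hθ.1], by linarith [hθ.2]⟩
  have hθm : θ - δ ∈ K := ⟨by linarith [hθ.1], by linarith [hθ.2]⟩
  have hθp : θ + δ ∈ K := ⟨by linarith [hθ.1], by linarith [hθ.2]⟩
  have hbad : ∀ ω, ¬ TiltBounds p m C (tiltOf p α β i n fun j => Y j ω) →
      ∑ j ∈ Finset.Icc (i + 1) n, Y j ω ≤ ∑ j ∈ Finset.Icc (i + 1) n, tMean (p j) (θ - δ) ∨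
      ∑ j ∈ Finset.Icc (i + 1) n, tMean (p j) (θ + δ) ≤ ∑ j ∈ Finset.Icc (i + 1) n, Y j ω := by
    intro ω hω
    by_contra! hcon
    refine hω (hTB _ ?_)
    have := hX.tiltOf_mem_Icc hin (hK hθm) (hK hθp) (by linarith) hcon.1 hcon.2
    exact ⟨hθm.1.trans this.1, this.2.trans hθp.2⟩
  -- for `i = 0` the sum is not random; there is no partial sum `Y 1 + ⋯ + Y i` to integrate out
  rcases Nat.eq_zero_or_pos i with rfl | hi0
  · refine le_of_eq_of_le (measure_mono_null (t := {ω | ¬ ∑ j ∈ Finset.Icc 1 n, Y j ω = n * a})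
      (fun ω hω hsum => ?_) (ae_iff.1 hY.sum_eq)) zero_le
    have hmono := hX.strictMonoOn_sum_tMean hin
    have h1 := hmono (hK hθm) (hK hθK) (by linarith)
    have h2 := hmono (hK hθK) (hK hθp) (by linarith)
    have h3 := hbad ω hω
    simp only [zero_add] at h1 h2 h3
    rw [hsum, ← hθa] at h3
    rcases h3 with h3 | h3
    · exact absurd h3 h1.not_ge
    · exact absurd h3 h2.not_ge
  · set f : ℕ → ℝ → ℝ := fun j => tiltedDensity (p j) θ with hf
    have htilt : ∀ j, 1 ≤ j → Tiltable (p j) θ := fun j hj => hX.tiltable hj (hK hθK)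
    have hb : ∀ j, 1 ≤ j → _ := fun j hj => (hTB θ hθK).tilt_bounds hj
    have hreg : ∀ j ∈ Finset.Icc 1 n, RegDensity (C + 1) (f j) := fun j hj =>
      (htilt j (Finset.mem_Icc.1 hj).1).regDensity (hb j (Finset.mem_Icc.1 hj).1).2.2
    obtain ⟨hpos, hle'⟩ := hratio f (fun j => tMean (p j) θ) (Finset.Icc 1 i) (Finset.Icc 1 n) 1
      (Finset.mem_Icc.2 ⟨le_rfl, hi0⟩) (Finset.Icc_subset_Icc_right hin.le) hreg
      (fun j hj => (htilt j (Finset.mem_Icc.1 hj).1).tameLaw hC0 (by linarith)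
        (hb j (Finset.mem_Icc.1 hj).1).1 (hb j (Finset.mem_Icc.1 hj).1).2.1
        (hb j (Finset.mem_Icc.1 hj).1).2.2) (by rwa [Nat.card_Icc, Nat.add_sub_cancel])
    rw [hθa] at hpos hle'
    set L : ℝ := R * (1 + ((n - i : ℕ) : ℝ)) with hL
    have hL0 : 0 ≤ L := by positivity
    have hcard : (R * (1 + (((Finset.Icc 1 n).card : ℝ) - (Finset.Icc 1 i).card))) = L := by
      rw [Nat.card_Icc, Nat.card_Icc, Nat.add_sub_cancel, Nat.add_sub_cancel, hL,
        Nat.cast_sub hin.le]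
    rw [hcard] at hle'
    -- both tails, at the parameters `θ ± δ`
    have htail : ∀ θ' ∈ K, (θ' - θ) ^ 2 = δ ^ 2 →
        μ {ω | ∑ j ∈ Finset.Icc (i + 1) n, Y j ω ∈
          {t | (θ' - θ) * ∑ j ∈ Finset.Icc (i + 1) n, tMean (p j) θ' ≤ (θ' - θ) * t}} ≤
        ENNReal.ofReal (L * Real.exp (-r * ((n - i : ℕ) : ℝ))) := fun θ' hθ' hsq => by
      refine (hY.measure_sum_mem_le (fun j hj => htilt j (Finset.mem_Icc.1 hj).1) (by linarith)
        hreg hpos hi0 hin hle' (measurableSet_le (by fun_prop) (by fun_prop))).trans ?_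
      rw [ENNReal.ofReal_mul hL0]
      refine mul_le_mul_right ?_ _
      have h1 := sumLaw_tiltedLaw_le (p := p) (I := Finset.Icc (i + 1) n) (c := σ)
        (fun j hj θ hθ => hX.tiltable (by have := (Finset.mem_Icc.1 hj).1; omega) (hK hθ))
        (fun j hj θ hθ => (hTB θ hθ j (by have := (Finset.mem_Icc.1 hj).1; omega)).1) hθK hθ'
      rw [hsq, Nat.card_Icc, Nat.add_sub_add_right] at h1
      exact h1
    change _ ≤ ENNReal.ofReal (2 * (L * Real.exp (-r * ((n - i : ℕ) : ℝ))))
    rw [two_mul, ENNReal.ofReal_add (by positivity) (by positivity)]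
    refine (measure_mono fun ω hω => ?_).trans ((measure_union_le _ _).trans
      (add_le_add (htail (θ - δ) hθm (by ring)) (htail (θ + δ) hθp (by ring))))
    rcases hbad ω hω with h | h
    · left
      change (θ - δ - θ) * _ ≤ (θ - δ - θ) * _
      nlinarith
    · right
      change (θ + δ - θ) * _ ≤ (θ + δ - θ) * _
      nlinarith

/-- The corollary: the assumptions on compact sets imply boundedness in probability along the
random tilts, since these concentrate near a deterministic compact set. -/
theorem edgeworthExpansionAt_of_compacts (hX : BasicAssumptions P₀ X p A B α β) {a : ℝ}
    (ha : a ∈ openInterval A B) {Ω : ℕ → Type*} [∀ n, MeasurableSpace (Ω n)]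
    {P : ∀ n, Measure (Ω n)} {Y : ∀ n, ℕ → Ω n → ℝ}
    (hY : ∀ n, 1 ≤ n → IsConditionedSample (P n) p n (n * a) (Y n))
    {k : ℕ → ℕ} (hk : Tendsto (fun n => n - k n) atTop atTop) {t : ∀ n, ℕ → Ω n → ℝ}
    (ht : ∀ n i ω, t n i ω = tiltOf p α β i n (fun j => Y n j ω)) {m : ℕ} (hm : 3 ≤ m)
    (hUf : AssumptionUf p A B α β) (hCv : AssumptionCv p α β) (hAM : AssumptionAM p α β (m + 1))
    (hCf : AssumptionCf p α β) {e : ℕ} (he : e = 1 ∨ e = 2) :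
    EdgeworthExpansionAt P p k t m e := by
  obtain ⟨C, b, N, hb, h⟩ := exists_measure_not_tiltBounds_le hX ha hm hUf hCv hAM hCf
  refine edgeworthExpansionAt_of_tiltBounds hX hk (fun n i ω => by
    rw [ht]; exact hX.tiltOf_mem _ _ _) hm (fun ε hε => ⟨C, ?_⟩) he
  have hlim := (ENNReal.tendsto_sum_nat_add b hb).comp hk
  obtain ⟨N', hN'⟩ := eventually_atTop.1 ((hlim.eventually
    (gt_mem_nhds (ENNReal.ofReal_pos.2 hε))).and (hk.eventually (eventually_ge_atTop 1)))
  refine ⟨max N N', fun n hn => ?_⟩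
  obtain ⟨h1, h2⟩ := hN' n (le_of_max_le_right hn)
  have hkn : k n < n := by omega
  calc P n {ω | ¬ ∀ i : Fin (k n), TiltBounds p m C (t n i ω)}
      = P n (⋃ i ∈ Finset.range (k n), {ω | ¬ TiltBounds p m C (t n i ω)}) := by
        congr 1
        ext ω
        simp only [Set.mem_ofPred_eq, Set.mem_iUnion, Finset.mem_range, not_forall, exists_prop]
        exact ⟨fun ⟨i, hi⟩ => ⟨i, i.2, hi⟩, fun ⟨i, hi, h⟩ => ⟨⟨i, hi⟩, h⟩⟩
    _ ≤ ∑ i ∈ Finset.range (k n), P n {ω | ¬ TiltBounds p m C (t n i ω)} :=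
        measure_biUnion_finset_le _ _
    _ ≤ ∑ i ∈ Finset.range (k n), b (k n - 1 - i + 1 + (n - k n)) := by
        refine Finset.sum_le_sum fun i hi => ?_
        have hi' := Finset.mem_range.1 hi
        simp_rw [ht]
        rw [show k n - 1 - i + 1 + (n - k n) = n - i by omega]
        exact h n (le_of_max_le_left hn) i (by omega) (P n) (Y n) (hY n (by omega))
    _ = ∑ i ∈ Finset.range (k n), b (i + 1 + (n - k n)) :=
        Finset.sum_range_reflect (fun i => b (i + 1 + (n - k n))) (k n)
    _ ≤ ∑ i ∈ Finset.range (k n + 1), b (i + (n - k n)) := by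
        rw [Finset.sum_range_succ']
        exact le_self_add
    _ ≤ ∑' i, b (i + (n - k n)) := ENNReal.sum_le_tsum _
    _ ≤ ENNReal.ofReal ε := h1.le

end Assumptions

end TiltedEdgeworth

theorem mainTheorem3
    -- the independent random variables `X 1, X 2, …` with densities `p 1, p 2, …`
    {Ω₀ : Type*} [MeasurableSpace Ω₀] (P₀ : Measure Ω₀) [IsProbabilityMeasure P₀]
    (X : ℕ → Ω₀ → ℝ) (p : ℕ → ℝ → ℝ) (A B α β : EReal)
    (hX : TiltedEdgeworth.BasicAssumptions P₀ X p A B α β)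
    -- the sample `Y n 1, …, Y n n` with the law of `X 1, …, X n` given `S_{1,n} = n a`
    (a : ℝ) (ha : a ∈ TiltedEdgeworth.openInterval A B)
    {Ω : ℕ → Type*} [∀ n, MeasurableSpace (Ω n)]
    (P : ∀ n, Measure (Ω n)) [∀ n, IsProbabilityMeasure (P n)]
    (Y : ∀ n, ℕ → Ω n → ℝ)
    (hY : ∀ n, 1 ≤ n → TiltedEdgeworth.IsConditionedSample (P n) p n (n * a) (Y n))
    -- the number `k = k n` with `n - k → ∞`, and the random tilts `t n i`, `0 ≤ i ≤ k - 1`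
    (k : ℕ → ℕ) (hk : Tendsto (fun n => n - k n) atTop atTop)
    (t : ∀ n, ℕ → Ω n → ℝ)
    (ht : ∀ n i ω, t n i ω = TiltedEdgeworth.tiltOf p α β i n (fun j => Y n j ω))
    (m : ℕ) (hm : 3 ≤ m) :
    -- the second extension of the Edgeworth expansion
    ((TiltedEdgeworth.IsBigOProb P (fun n ω => ⨆ i : Fin (k n), ⨆ (j : ℕ) (_ : 1 ≤ j),
          (ENNReal.ofReal (TiltedEdgeworth.tVar (p j) (t n i ω)))⁻¹) →
      TiltedEdgeworth.IsBigOProb P (fun n ω => ⨆ i : Fin (k n), ⨆ (j : ℕ) (_ : 1 ≤ j),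
          TiltedEdgeworth.tAbsMoment (p j) (m + 1) (t n i ω)) →
      TiltedEdgeworth.IsBigOProb P (fun n ω => ⨆ i : Fin (k n), ⨆ (j : ℕ) (_ : 1 ≤ j),
          TiltedEdgeworth.tDerivNorm (p j) (t n i ω)) →
      ∀ e : ℕ, e = 1 ∨ e = 2 → TiltedEdgeworth.EdgeworthExpansionAt P p k t m e)) ∧
    -- the corollary, under the assumptions on compact sets of parameters
    (TiltedEdgeworth.AssumptionUf p A B α β →
      TiltedEdgeworth.AssumptionCv p α β →
      TiltedEdgeworth.AssumptionAM p α β 6 →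
      TiltedEdgeworth.AssumptionAM p α β (m + 1) →
      TiltedEdgeworth.AssumptionCf p α β →
      TiltedEdgeworth.IsBigOProb P (fun n ω => ⨆ i : Fin (k n), ‖t n i ω‖ₑ) →
      ∀ e : ℕ, e = 1 ∨ e = 2 → TiltedEdgeworth.EdgeworthExpansionAt P p k t m e) := by
  have ht' : ∀ n i ω, t n i ω ∈ TiltedEdgeworth.openInterval α β := fun n i ω => by
    rw [ht]
    exact hX.tiltOf_mem i n _
  exact ⟨fun h₁ h₂ h₃ _ he =>
      TiltedEdgeworth.edgeworthExpansionAt_of_isBigOProb hX hk ht' hm h₁ h₂ h₃ he,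
    fun hUf hCv _ hAM hCf _ _ he =>
      TiltedEdgeworth.edgeworthExpansionAt_of_compacts hX ha hY hk ht hm hUf hCv hAM hCf he⟩
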